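/- Let $d\ge 1$ and let $\chi\in C_c^\infty(\mathbb R^d)$ be radial, nonincreasing along rays, supported in the ball of radius $4/3$ and equal to $1$ on the ball of radius $3/4$. Put $\varphi(\xi)=\chi(\xi/2)-\chi(\xi)$, $\dot\Delta_l=\varphi(2^{-l}D)$, $\dot S_l=\chi(2^{-l}D)$ $(l\in\mathbb Z)$, where a multiplier $m(D)$ acts by $\widehat{m(D)u}=m\,\widehat u$ with $\widehat u(\xi)=\int e^{-i x\cdot\xi}u(x)\,dx$. Let $\mathcal S'_h$ be the set of tempered distributions $u$ with $\|\dot S_l u\|_{L^\infty}\to 0$ as $l\to-\infty$, put $\|u\|_{\dot B^s_{2,1}}=\sum_{l\in\mathbb Z}2^{ls}\|\dot\Delta_l u\|_{L^2}$, and let $\dot B^s_{2,1}$ be the set of $u\in\mathcal S'_h$ for which this is finite. For $\varepsilon>0$ and a fixed constant $\gamma>0$ put $l_\varepsilon=\big\lfloor \tfrac12\log_2\frac{3\gamma}{8\varepsilon^2}-1\big\rfloor$, and let $\dot B_\varepsilon^{s,r}$ be the set of $u\in\mathcal S'_h$ with $$\sum_{l\le l_\varepsilon}2^{ls}\|\dot\Delta_l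 u\|_{L^2}+\sum_{l>l_\varepsilon}\frac1{\varepsilon^2}2^{lr}\|\dot\Delta_l u\|_{L^2}<\infty .$$ Let $\phi(x)=(4\pi)^{-d/2}e^{-|x|^2/4}$, $\phi_\varepsilon(x)=\varepsilon^{-d}\phi(x/\varepsilon)$ (so that $\widehat{\phi_\varepsilon}(\xi)=e^{-\varepsilon^2|\xi|^2}$), and $L_\varepsilon f=\dfrac{\phi_\varepsilon*f-f}{\varepsilon^2}$. **Theorem.** For every $\sigma\in\mathbb R$ there is a constant $C>0$, depending only on $\sigma$, $d$ (and on the fixed cut-off $\chi$), such that for all $\varepsilon>0$ and all $f\in\dot B_\varepsilon^{\sigma+2,\sigma}$ there is a sequence $(c_j)_{j\in\mathbb Z}$ of positive numbers with $\sum_{j\in\mathbb Z}c_j=1$ for which the following holds. Let $I=[0,T)$ with $0<T\le\infty$ and let $v\in L^1(I;\dot B^{d/2+1}_{2,1})\cap L^2(I;\dot B^{d/2}_{2,1})$ be a time-dependent real vector field on $\mathbb R^d$. For $t\in I$ let $V=V(t)=\int_0^t\|\nabla v(\tau)\|_{L^\infty}\,d\tau$, where $\|\nabla v\|_{L^\infty}=\max_{i,k}\|\partial_k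 v_i\|_{L^\infty}$, and for $j\in\mathbb Z$ let $\psi_{j,t}$ be the flow of $\dot S_{j-1}v$, that is, $\psi_{j,t}(x)=x+\int_0^t(\dot S_{j-1}v)(\tau,\psi_{j,\tau}(x))\,d\tau$. Then for every $t\in I$ so small that $e^{2CV}-1\le\frac12$ and every $j\in\mathbb Z$, the commutator $$II'_j(f)=\big(L_\varepsilon\dot\Delta_j f\big)\circ\psi_{j,t}-L_\varepsilon\big((\dot\Delta_j f)\circ\psi_{j,t}\big)$$ satisfies $$\|II'_j(f)\|_{L^2}\le C\,e^{CV}\,\big(V+e^{2CV}-1\big)\,c_j\,2^{-j\sigma}\,\|L_\varepsilon f\|_{\dot B^\sigma_{2,1}} .$$ -/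

import Mathlib

open MeasureTheory Set Filter Topology
open scoped ENNReal SchwartzMap FourierTransform ContDiff LineDeriv Convolution

noncomputable section

namespace Capillary

/-- The space `ℝ^d` with its Euclidean norm. -/
abbrev Rd (d : ℕ) : Type := EuclideanSpace ℝ (Fin d)

/-! ### Littlewood-Paley theory -/

/-- A Littlewood-Paley low frequency cut-off: a smooth radial function, nonincreasing along rays,
supported in the ball of radius `4/3` and equal to `1` on the ball of radius `3/4`.
The field `antitone` says both that `χ` is radial and that it is nonincreasing in the radius. -/
structure LPCutoff (d : ℕ) where
  toFun : Rd d → ℝ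
  smooth : ContDiff ℝ ∞ toFun
  antitone : ∀ ξ η : Rd d, ‖ξ‖ ≤ ‖η‖ → toFun η ≤ toFun ξ
  support : tsupport toFun ⊆ Metric.closedBall 0 (4 / 3)
  eq_one : ∀ ξ : Rd d, ‖ξ‖ ≤ 3 / 4 → toFun ξ = 1

variable {d : ℕ}

/-- The annular function `φ(ξ) = χ(ξ/2) - χ(ξ)`. -/
def LPCutoff.annulus (χ : LPCutoff d) (ξ : Rd d) : ℝ :=
  χ.toFun ((1 / 2 : ℝ) • ξ) - χ.toFun ξ

theorem LPCutoff.hasCompactSupport (χ : LPCutoff d) : HasCompactSupport χ.toFun :=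
  (isCompact_closedBall (0 : Rd d) (4 / 3)).of_isClosed_subset (isClosed_tsupport _) χ.support

theorem LPCutoff.annulus_smooth (χ : LPCutoff d) : ContDiff ℝ ∞ χ.annulus :=
  (χ.smooth.comp (contDiff_const_smul (1 / 2 : ℝ))).sub χ.smooth

theorem LPCutoff.annulus_hasCompactSupport (χ : LPCutoff d) : HasCompactSupport χ.annulus :=
  (χ.hasCompactSupport.comp_smul (by norm_num : (1 / 2 : ℝ) ≠ 0)).sub χ.hasCompactSupport

/-- The symbol `η(2^{-l} ξ)`, as a Schwartz function. Mathlib's Fourier transform uses the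
character `exp(-2πi⟨x,ξ⟩)`, so that the frequency variable of the convention `exp(-i⟨x,ξ⟩)`
is `2π` times that of Mathlib. -/
def symbol (η : Rd d → ℝ) (hη : ContDiff ℝ ∞ η) (hc : HasCompactSupport η) (l : ℤ) :
    𝓢(Rd d, ℂ) :=
  HasCompactSupport.toSchwartzMap
    (f := fun ξ : Rd d => ((η ((2 * Real.pi * (2 : ℝ) ^ (-l)) • ξ) : ℝ) : ℂ))
    ((hc.comp_smul (by positivity : (2 * Real.pi * (2 : ℝ) ^ (-l)) ≠ 0)).comp_left
      Complex.ofReal_zero)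
    (Complex.ofRealCLM.contDiff.comp
      (hη.comp (contDiff_const_smul (2 * Real.pi * (2 : ℝ) ^ (-l)))))

/-- The Schwartz function `y ↦ k (x - y)`. -/
def reflectAt (k : 𝓢(Rd d, ℂ)) (x : Rd d) : 𝓢(Rd d, ℂ) :=
  SchwartzMap.compSubConstCLM ℂ x
    (SchwartzMap.compCLMOfContinuousLinearEquiv ℂ (ContinuousLinearEquiv.neg ℝ) k)

theorem reflectAt_apply (k : 𝓢(Rd d, ℂ)) (x y : Rd d) : reflectAt k x y = k (x - y) := by
  simp [reflectAt]

/-- The convolution `(k * u)(x) = ⟨u, k(x - ·)⟩` of a Schwartz function with a tempered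
distribution; it is a smooth function. -/
def conv (k : 𝓢(Rd d, ℂ)) (u : 𝓢'(Rd d, ℂ)) (x : Rd d) : ℂ := u (reflectAt k x)

/-- The low frequency cut-off `Ṡ_l u = χ(2^{-l} D) u`. -/
def lowFreq (χ : LPCutoff d) (l : ℤ) (u : 𝓢'(Rd d, ℂ)) : Rd d → ℂ :=
  conv (𝓕⁻ (symbol χ.toFun χ.smooth χ.hasCompactSupport l)) u

/-- The dyadic block `Δ̇_l u = φ(2^{-l} D) u`. -/
def dyadicBlock (χ : LPCutoff d) (l : ℤ) (u : 𝓢'(Rd d, ℂ)) : Rd d → ℂ :=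
  conv (𝓕⁻ (symbol χ.annulus χ.annulus_smooth χ.annulus_hasCompactSupport l)) u

/-- The class `𝓢'_h` of tempered distributions `u` with `‖Ṡ_l u‖_{L^∞} → 0` as `l → -∞`. -/
def MemSh (χ : LPCutoff d) (u : 𝓢'(Rd d, ℂ)) : Prop :=
  Tendsto (fun l : ℤ => eLpNorm (lowFreq χ l u) ⊤ volume) atBot (𝓝 0)

/-- The homogeneous Besov norm of `Ḃ^s_{2,1}`. -/
def besovNorm (χ : LPCutoff d) (s : ℝ) (u : 𝓢'(Rd d, ℂ)) : ℝ≥0∞ :=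
  ∑' l : ℤ, ENNReal.ofReal ((2 : ℝ) ^ ((l : ℝ) * s)) * eLpNorm (dyadicBlock χ l u) 2 volume

/-- The homogeneous Besov space `Ḃ^s_{2,1}`. -/
def MemBesov (χ : LPCutoff d) (s : ℝ) (u : 𝓢'(Rd d, ℂ)) : Prop :=
  MemSh χ u ∧ besovNorm χ s u < ⊤

/-- The frequency threshold `l_ε = [½ log₂(γ / (C₀ ε²)) - 1]`, with `C₀ = 8/3`. -/
def threshold (γ ε : ℝ) : ℤ := ⌊1 / 2 * Real.logb 2 (γ / (8 / 3 * ε ^ 2)) - 1⌋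

/-- The hybrid Besov norm of `Ḃ_ε^{s,r}`: regularity `s` for the frequencies `l ≤ l_ε`, and
regularity `r` with the weight `1/ε²` for the frequencies `l > l_ε`. -/
def hybridNorm (χ : LPCutoff d) (γ ε s r : ℝ) (u : 𝓢'(Rd d, ℂ)) : ℝ≥0∞ :=
  ∑' l : ℤ, ENNReal.ofReal
      (if l ≤ threshold γ ε then (2 : ℝ) ^ ((l : ℝ) * s) else 1 / ε ^ 2 * (2 : ℝ) ^ ((l : ℝ) * r))
    * eLpNorm (dyadicBlock χ l u) 2 volume

/-- The hybrid Besov space `Ḃ_ε^{s,r}`. -/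
def MemHybrid (χ : LPCutoff d) (γ ε s r : ℝ) (u : 𝓢'(Rd d, ℂ)) : Prop :=
  MemSh χ u ∧ hybridNorm χ γ ε s r u < ⊤

/-! ### The non-local operator -/

/-- The Gaussian kernel `φ_ε = ε^{-d} φ(·/ε)`, with `φ(x) = (4π)^{-d/2} exp(-|x|²/4)`. -/
def gaussianKernel (ε : ℝ) (x : Rd d) : ℝ :=
  (ε ^ d)⁻¹ * ((4 * Real.pi) ^ (-(d : ℝ) / 2) * Real.exp (-‖ε⁻¹ • x‖ ^ 2 / 4))

/-- `φ_ε` is normalised so that its Fourier transform is `exp(-ε²|ξ|²)` in the convention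
`exp(-i⟨x,ξ⟩)`. -/
theorem fourier_gaussianKernel {ε : ℝ} (hε : 0 < ε) (ξ : Rd d) :
    𝓕 (fun x : Rd d => ((gaussianKernel ε x : ℝ) : ℂ)) ξ =
      (Real.exp (-(ε ^ 2 * ‖(2 * Real.pi) • ξ‖ ^ 2)) : ℝ) := by
  have hb : 0 < ((((4 * ε ^ 2)⁻¹ : ℝ) : ℂ)).re := by
    rw [Complex.ofReal_re]; positivity
  have h := fourier_gaussian_innerProductSpace (V := Rd d) hb ξ
  have hfun : (fun x : Rd d => ((gaussianKernel ε x : ℝ) : ℂ)) =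
      (((ε ^ d)⁻¹ * (4 * Real.pi) ^ (-(d : ℝ) / 2) : ℝ) : ℂ) •
        (fun v : Rd d => Complex.exp (-(((4 * ε ^ 2)⁻¹ : ℝ) : ℂ) * (‖v‖ : ℂ) ^ 2)) := by
    funext x
    simp only [gaussianKernel, Pi.smul_apply, smul_eq_mul, norm_smul, norm_inv,
      Real.norm_of_nonneg hε.le]
    push_cast
    rw [mul_assoc]
    congr 3
    field_simp
  have hs : 𝓕 ((((ε ^ d)⁻¹ * (4 * Real.pi) ^ (-(d : ℝ) / 2) : ℝ) : ℂ) •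
        (fun v : Rd d => Complex.exp (-(((4 * ε ^ 2)⁻¹ : ℝ) : ℂ) * (‖v‖ : ℂ) ^ 2))) ξ
      = (((ε ^ d)⁻¹ * (4 * Real.pi) ^ (-(d : ℝ) / 2) : ℝ) : ℂ) •
        𝓕 (fun v : Rd d => Complex.exp (-(((4 * ε ^ 2)⁻¹ : ℝ) : ℂ) * (‖v‖ : ℂ) ^ 2)) ξ := by
    simp only [Real.fourier_eq, Pi.smul_apply]
    rw [← integral_smul]
    congr 1; funext v
    rw [smul_comm]
  rw [hfun, hs, h]
  have e1 : ((Real.pi : ℂ) / (((4 * ε ^ 2)⁻¹ : ℝ) : ℂ)) = ((4 * Real.pi * ε ^ 2 : ℝ) : ℂ) := by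
    push_cast; field_simp
  have e2 : ((4 * Real.pi * ε ^ 2 : ℝ) : ℂ) ^ ((Module.finrank ℝ (Rd d) : ℂ) / 2)
      = (((4 * Real.pi * ε ^ 2) ^ ((d : ℝ) / 2) : ℝ) : ℂ) := by
    rw [Complex.ofReal_cpow (by positivity)]; simp
  have e3 : (ε ^ d)⁻¹ * (4 * Real.pi) ^ (-(d : ℝ) / 2) * (4 * Real.pi * ε ^ 2) ^ ((d : ℝ) / 2)
      = 1 := by
    have h2 : (ε ^ 2) ^ ((d : ℝ) / 2) = ε ^ d := by
      rw [← Real.rpow_natCast ε 2, ← Real.rpow_mul hε.le, ← Real.rpow_natCast ε d]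
      congr 1; push_cast; ring
    rw [Real.mul_rpow (x := 4 * Real.pi) (by positivity) (by positivity), h2, neg_div,
      Real.rpow_neg (by positivity)]
    have h4 : (4 * Real.pi) ^ ((d : ℝ) / 2) ≠ 0 := by positivity
    have h5 : ε ^ d ≠ 0 := by positivity
    generalize (4 * Real.pi) ^ ((d : ℝ) / 2) = a at *
    field_simp
  rw [e1, e2, smul_eq_mul, ← mul_assoc, ← Complex.ofReal_mul, e3, Complex.ofReal_one, one_mul,
    Complex.ofReal_exp]
  congr 1
  rw [norm_smul, Real.norm_of_nonneg (by positivity)]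
  push_cast
  field_simp
  ring

theorem hasTemperateGrowth_fourier_gaussianKernel {ε : ℝ} (hε : 0 < ε) :
    (𝓕 (fun x : Rd d => ((gaussianKernel ε x : ℝ) : ℂ))).HasTemperateGrowth := by
  have key : ((fun s : ℝ => Real.exp (-s)) ∘
      (fun ξ : Rd d => ε ^ 2 * ‖(2 * Real.pi) • ξ‖ ^ 2)).HasTemperateGrowth := by
    have hder : ∀ n (s : ℝ), ‖iteratedFDeriv ℝ n (fun s : ℝ => Real.exp (-s)) s‖ =
        Real.exp (-s) := by
      intro n s
      rw [norm_iteratedFDeriv_eq_norm_iteratedDeriv, iteratedDeriv_comp_neg n Real.exp]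
      simp [iteratedDeriv_eq_iterate]
    have hcd : ContDiff ℝ ∞ (fun s : ℝ => Real.exp (-s)) := Real.contDiff_exp.comp contDiff_neg
    refine Function.HasTemperateGrowth.comp' (t := Ici 0) ?_ (uniqueDiffOn_Ici 0)
      hcd.contDiffOn ?_ ?_
    · rintro _ ⟨ξ, rfl⟩
      exact mem_Ici.2 (by positivity)
    · intro N
      refine ⟨0, 1, zero_le_one, fun n _ s hs => ?_⟩
      rw [iteratedFDerivWithin_eq_iteratedFDeriv (uniqueDiffOn_Ici 0)
        (hcd.contDiffAt.of_le (mod_cast le_top)) hs, hder]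
      simpa using hs
    · have := Function.hasTemperateGrowth_norm_sq (H := Rd d)
      simp only [norm_smul, mul_pow]
      fun_prop
  have heq : 𝓕 (fun x : Rd d => ((gaussianKernel ε x : ℝ) : ℂ)) = Complex.ofReal ∘
      ((fun s : ℝ => Real.exp (-s)) ∘ (fun ξ : Rd d => ε ^ 2 * ‖(2 * Real.pi) • ξ‖ ^ 2)) := by
    funext ξ
    exact fourier_gaussianKernel hε ξ
  rw [heq]
  exact Function.HasTemperateGrowth.comp (by fun_prop) key

/-- `L_ε g = (φ_ε * g - g) / ε²` for a function `g`. -/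
def nonlocal (ε : ℝ) (g : Rd d → ℂ) (x : Rd d) : ℂ :=
  (ε ^ 2)⁻¹ • ((gaussianKernel ε ⋆[ContinuousLinearMap.lsmul ℝ ℝ, volume] g) x - g x)

/-- `L_ε u = (φ_ε * u - u) / ε²` for a tempered distribution `u`, where the convolution `φ_ε * u`
is the tempered distribution whose Fourier transform is the product of those of `φ_ε` and `u`. -/
def nonlocalDist (ε : ℝ) (u : 𝓢'(Rd d, ℂ)) : 𝓢'(Rd d, ℂ) :=
  ((ε ^ 2 : ℝ) : ℂ)⁻¹ •
    (TemperedDistribution.fourierMultiplierCLM ℂ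
      (𝓕 (fun x : Rd d => ((gaussianKernel ε x : ℝ) : ℂ))) u - u)

/-! ### The velocity field and its flow -/

/-- The time interval `[0, T)`, with `T = ∞` allowed. -/
def timeInterval (T : ℝ≥0∞) : Set ℝ := {τ | 0 ≤ τ ∧ ENNReal.ofReal τ < T}

/-- A tempered distribution is real if it takes real values on real test functions. -/
def IsRealDist (u : 𝓢'(Rd d, ℂ)) : Prop :=
  ∀ g : 𝓢(Rd d, ℂ), (∀ x, (g x).im = 0) → (u g).im = 0

/-- `u ∈ L^p(I; Ḃ^s_{2,1})` for `1 ≤ p < ∞`. -/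
def MemLpBesov (χ : LPCutoff d) (I : Set ℝ) (p s : ℝ) (u : ℝ → 𝓢'(Rd d, ℂ)) : Prop :=
  (∀ g : 𝓢(Rd d, ℂ), AEMeasurable (fun τ => u τ g) (volume.restrict I)) ∧
  (∀ᵐ τ ∂(volume.restrict I), MemBesov χ s (u τ)) ∧
  ∫⁻ τ in I, besovNorm χ s (u τ) ^ p < ⊤

/-- A real vector field `v ∈ L¹(I; Ḃ^{d/2+1}_{2,1}) ∩ L²(I; Ḃ^{d/2}_{2,1})`. -/
def IsVelocity (χ : LPCutoff d) (I : Set ℝ) (v : ℝ → Fin d → 𝓢'(Rd d, ℂ)) : Prop :=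
  ∀ i : Fin d, (∀ τ ∈ I, IsRealDist (v τ i)) ∧
    MemLpBesov χ I 1 ((d : ℝ) / 2 + 1) (fun τ => v τ i) ∧
    MemLpBesov χ I 2 ((d : ℝ) / 2) (fun τ => v τ i)

/-- The `L^∞` norm of a tempered distribution (`∞` if it is not a bounded function). -/
def distLinftyNorm (u : 𝓢'(Rd d, ℂ)) : ℝ≥0∞ :=
  ⨅ (g : Lp ℂ ⊤ (volume : Measure (Rd d))) (_ : Lp.toTemperedDistribution g = u), ‖g‖ₑ

/-- `‖∇w‖_{L^∞}`, the largest of the `L^∞` norms of the entries of the Jacobian matrix. -/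
def gradNorm (w : Fin d → 𝓢'(Rd d, ℂ)) : ℝ≥0∞ :=
  ⨆ (i : Fin d) (k : Fin d), distLinftyNorm (∂_{(EuclideanSpace.single k (1 : ℝ) : Rd d)} (w i))

/-- `V(t) = ∫_0^t ‖∇v(τ)‖_{L^∞} dτ`. -/
def lipIntegral (v : ℝ → Fin d → 𝓢'(Rd d, ℂ)) (t : ℝ) : ℝ :=
  (∫⁻ τ in Ioc 0 t, gradNorm (v τ)).toReal

/-- The vector field `Ṡ_l v`; its components are real since `v` and `χ` are real and `χ` even. -/
def lowFreqField (χ : LPCutoff d) (l : ℤ) (v : ℝ → Fin d → 𝓢'(Rd d, ℂ)) (τ : ℝ) (x : Rd d) :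
    Rd d :=
  WithLp.toLp 2 fun i => (lowFreq χ l (v τ i) x).re

/-- `ψ` is the flow on `I` of the time dependent vector field `w`:
`ψ_t(x) = x + ∫_0^t w(τ, ψ_τ(x)) dτ`. -/
def IsFlow (I : Set ℝ) (w : ℝ → Rd d → Rd d) (ψ : ℝ → Rd d → Rd d) : Prop :=
  ∀ x : Rd d, ∀ t ∈ I, IntervalIntegrable (fun τ => w τ (ψ τ x)) volume 0 t ∧
    ψ t x = x + ∫ τ in (0 : ℝ)..t, w τ (ψ τ x)

/-- The commutator `II'_j(f) = (L_ε f_j) ∘ ψ - L_ε (f_j ∘ ψ)`, with `f_j = Δ̇_j f`. -/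
def commutator (χ : LPCutoff d) (ε : ℝ) (j : ℤ) (ψ : Rd d → Rd d) (f : 𝓢'(Rd d, ℂ)) (x : Rd d) :
    ℂ :=
  nonlocal ε (dyadicBlock χ j f) (ψ x) - nonlocal ε (dyadicBlock χ j f ∘ ψ) x

end Capillary

end

noncomputable section

namespace Capillary

open scoped BoundedContinuousFunction

/-! ### Translation continuity in the Schwartz space; integrals of Schwartz-valued maps. -/

section

variable {d : ℕ}

/-! ### Translations of Schwartz functions -/

/-! Put g = Δ̇_j f and ψ = ψ_{j,t}. The core is the estimate ‖II'_j(f)‖_{L²} ≲ δ min(2^{2j}, ε^{-2})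
‖g‖_{L²}, where δ is a constant times V (`eLpNorm_commutator_le`). On the annulus |ξ| ~ 2^j the
symbol (e^{-ε²|ξ|²} - 1)/ε² is bounded below in modulus by a multiple of min(2^{2j}, ε^{-2}), so L_ε
is inverted there by a Fourier multiplier, and the right-hand side is at most a constant times V
‖Δ̇_j L_ε f‖_{L²} (`exists_eLpNorm_dyadicBlock_le`). The c_j are the normalised numbers 2^{jσ} ‖Δ̇_j
L_ε f‖_{L²}, averaged with a fixed positive sequence (`exists_weights`). The resulting bound is
linear in V, which is stronger than the one claimed; the smallness condition serves to make δ ≤ 1/2.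

The flow enters through two facts (`IsVelocity.flow_bounds`): ψ - id is δ-Lipschitz, and ψ(x+y) +
ψ(x-y) - 2ψ(x) is at most δ 2^j |y|². The second holds because the kernel of Ṡ_{j-1} can absorb one
derivative at the cost of 2^j. Both follow from the integral equation by a bootstrap, without
differentiating the flow. That V is finite comes from the embedding of Ḃ^{d/2+1}_{2,1} in the
Lipschitz functions (`distLinftyNorm_lineDeriv_le`).

Bound by δ 2^{2j}: since φ_ε is even, the commutator is an average of g(ψx+y) + g(ψx-y) - g(ψ(x+y))
- g(ψ(x-y)). Writing g = K * g with K a low frequency kernel and expanding K around ψ(x), the linear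
terms see only the second difference of ψ and the remainders are quadratic, so the whole is O(δ
2^{2j} |y|²); the second moment of φ_ε is a multiple of ε² and cancels ε^{-2}. The intermediate
points of the expansion are near-identity maps of x, so composing with them is bounded on L².

Bound by δ ε^{-2}: after the change of variables z = ψ(w), the commutator compares Lebesgue measure
with its image under ψ and φ_ε(ψx - ψw) with φ_ε(x - w); each comparison gains δ.

The manipulations of distributions rest on `apply_integral`, which lets a tempered distribution pass
under an integral of Schwartz functions. -/

theorem seminorm_translate_le (g : 𝓢(Rd d, ℂ)) (a : Rd d) (m n : ℕ) :
    SchwartzMap.seminorm ℂ m n (SchwartzMap.compSubConstCLM ℂ a g) ≤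
      2 ^ m * (SchwartzMap.seminorm ℂ m n g + ‖a‖ ^ m * SchwartzMap.seminorm ℂ 0 n g) := by
  refine SchwartzMap.seminorm_le_bound ℂ m n _ (by positivity) fun z => ?_
  have h1 : iteratedFDeriv ℝ n (SchwartzMap.compSubConstCLM ℂ a g) z =
      iteratedFDeriv ℝ n g (z - a) := iteratedFDeriv_comp_sub n a z
  rw [h1]
  have h2 : ‖z‖ ^ m ≤ 2 ^ m * (‖z - a‖ ^ m + ‖a‖ ^ m) := by
    calc ‖z‖ ^ m ≤ (‖z - a‖ + ‖a‖) ^ m := by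
          gcongr; simpa using norm_add_le (z - a) a
      _ ≤ 2 ^ (m - 1) * (‖z - a‖ ^ m + ‖a‖ ^ m) :=
          add_pow_le (norm_nonneg _) (norm_nonneg _) m
      _ ≤ _ := by gcongr <;> norm_num
  have h3 := SchwartzMap.le_seminorm ℂ m n g (z - a)
  have h4 := SchwartzMap.le_seminorm ℂ 0 n g (z - a)
  simp only [pow_zero, one_mul] at h4
  calc ‖z‖ ^ m * ‖iteratedFDeriv ℝ n g (z - a)‖
      ≤ 2 ^ m * (‖z - a‖ ^ m + ‖a‖ ^ m) * ‖iteratedFDeriv ℝ n g (z - a)‖ := by gcongr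
    _ = 2 ^ m * (‖z - a‖ ^ m * ‖iteratedFDeriv ℝ n g (z - a)‖ +
        ‖a‖ ^ m * ‖iteratedFDeriv ℝ n g (z - a)‖) := by ring
    _ ≤ _ := by gcongr

/-- Mean value inequality on the segment from z - b to z - a, with the weight ‖z‖^m frozen. One lost
derivative buys the factor ‖a - b‖, which gives continuity of translation in the Schwartz topology.
-/
theorem seminorm_translate_sub_le (g : 𝓢(Rd d, ℂ)) (a b : Rd d) (m n : ℕ) :
    SchwartzMap.seminorm ℂ m n
        (SchwartzMap.compSubConstCLM ℂ a g - SchwartzMap.compSubConstCLM ℂ b g) ≤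
      2 ^ m * (SchwartzMap.seminorm ℂ m (n + 1) g +
        (‖a‖ + ‖b‖) ^ m * SchwartzMap.seminorm ℂ 0 (n + 1) g) * ‖a - b‖ := by
  refine SchwartzMap.seminorm_le_bound ℂ m n _ (by positivity) fun z => ?_
  have h1 : iteratedFDeriv ℝ n ⇑(SchwartzMap.compSubConstCLM ℂ a g -
      SchwartzMap.compSubConstCLM ℂ b g) z =
      iteratedFDeriv ℝ n g (z - a) - iteratedFDeriv ℝ n g (z - b) := by
    have e : ⇑(SchwartzMap.compSubConstCLM ℂ a g - SchwartzMap.compSubConstCLM ℂ b g) =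
      (fun y => g (y - a)) - (fun y => g (y - b)) := by ext y; simp
    rw [e, iteratedFDeriv_sub_apply, iteratedFDeriv_comp_sub, iteratedFDeriv_comp_sub]
    · exact ((g.smooth n).comp (contDiff_id.sub contDiff_const)).contDiffAt
    · exact ((g.smooth n).comp (contDiff_id.sub contDiff_const)).contDiffAt
  rw [h1]
  have hdiff : ∀ y, DifferentiableAt ℝ (iteratedFDeriv ℝ n g) y := fun y =>
    ((g.smooth ⊤).differentiable_iteratedFDeriv (mod_cast ENat.natCast_lt_top n)) y
  have key := (convex_segment (𝕜 := ℝ) (z - b) (z - a)).norm_image_sub_le_of_norm_fderiv_le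
    (f := fun y => ‖z‖ ^ m • iteratedFDeriv ℝ n g y)
    (C := 2 ^ m * (SchwartzMap.seminorm ℂ m (n + 1) g +
        (‖a‖ + ‖b‖) ^ m * SchwartzMap.seminorm ℂ 0 (n + 1) g))
    (𝕜 := ℝ) (fun y _ => (hdiff y).const_smul (‖z‖ ^ m)) ?_ (left_mem_segment ℝ _ _) (right_mem_segment ℝ _ _)
  · rw [← smul_sub, norm_smul, norm_pow, norm_norm] at key
    calc _ ≤ _ := key
      _ = _ := by
        congr 1
        rw [show z - a - (z - b) = -(a - b) by abel, norm_neg]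
  · intro y hy
    rw [fderiv_fun_const_smul (hdiff y), norm_smul, norm_pow, norm_norm, norm_fderiv_iteratedFDeriv]
    have h0 : ‖z‖ ≤ ‖y‖ + (‖a‖ + ‖b‖) := by
      obtain ⟨s, t, hs, ht, hst, rfl⟩ := hy
      have : z = (s • (z - b) + t • (z - a)) + (s • b + t • a) := by
        rw [smul_sub, smul_sub]
        have : s • z + t • z = z := by rw [← add_smul, hst, one_smul]
        nth_rewrite 1 [← this]; abel
      nth_rewrite 1 [this]
      refine (norm_add_le _ _).trans ?_
      gcongr
      refine (norm_add_le _ _).trans ?_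
      rw [norm_smul, norm_smul, Real.norm_of_nonneg hs, Real.norm_of_nonneg ht]
      nlinarith [norm_nonneg a, norm_nonneg b]
    have h2 : ‖z‖ ^ m ≤ 2 ^ m * (‖y‖ ^ m + (‖a‖ + ‖b‖) ^ m) := by
      calc ‖z‖ ^ m ≤ (‖y‖ + (‖a‖ + ‖b‖)) ^ m := by gcongr
        _ ≤ 2 ^ (m - 1) * (‖y‖ ^ m + (‖a‖ + ‖b‖) ^ m) :=
            add_pow_le (norm_nonneg _) (by positivity) m
        _ ≤ _ := by gcongr <;> norm_num
    have h3 := SchwartzMap.le_seminorm ℂ m (n + 1) g y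
    have h4 := SchwartzMap.le_seminorm ℂ 0 (n + 1) g y
    simp only [pow_zero, one_mul] at h4
    calc ‖z‖ ^ m * ‖iteratedFDeriv ℝ (n + 1) g y‖
        ≤ 2 ^ m * (‖y‖ ^ m + (‖a‖ + ‖b‖) ^ m) * ‖iteratedFDeriv ℝ (n + 1) g y‖ := by gcongr
      _ = 2 ^ m * (‖y‖ ^ m * ‖iteratedFDeriv ℝ (n + 1) g y‖ +
          (‖a‖ + ‖b‖) ^ m * ‖iteratedFDeriv ℝ (n + 1) g y‖) := by ring
      _ ≤ _ := by gcongr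

theorem continuous_translate (g : 𝓢(Rd d, ℂ)) :
    Continuous fun a : Rd d => SchwartzMap.compSubConstCLM ℂ a g := by
  refine continuous_iff_continuousAt.2 fun b => ?_
  refine ((schwartz_withSeminorms ℂ (Rd d) ℂ).tendsto_nhds _ _).2 fun i ε hε => ?_
  have h : Tendsto (fun a : Rd d => 2 ^ i.1 * (SchwartzMap.seminorm ℂ i.1 (i.2 + 1) g +
        (‖a‖ + ‖b‖) ^ i.1 * SchwartzMap.seminorm ℂ 0 (i.2 + 1) g) * ‖a - b‖) (𝓝 b) (𝓝 0) := by
    have hc : Continuous (fun a : Rd d => 2 ^ i.1 * (SchwartzMap.seminorm ℂ i.1 (i.2 + 1) g +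
        (‖a‖ + ‖b‖) ^ i.1 * SchwartzMap.seminorm ℂ 0 (i.2 + 1) g) * ‖a - b‖) := by fun_prop
    simpa using hc.tendsto b
  filter_upwards [h.eventually_lt_const hε] with a ha
  exact (seminorm_translate_sub_le g a b i.1 i.2).trans_lt ha

theorem continuous_reflectAt (k : 𝓢(Rd d, ℂ)) : Continuous (reflectAt k) :=
  continuous_translate _

/-- A continuous seminorm is dominated by finitely many Schwartz seminorms, and each of these grows
polynomially under translation. Hence the polynomial growth of `conv k u` and the integrability of
rapidly decaying families of translates. -/
theorem exists_seminorm_reflectAt_le (k : 𝓢(Rd d, ℂ)) (q : Seminorm ℂ 𝓢(Rd d, ℂ))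
    (hq : Continuous q) :
    ∃ (C : ℝ) (M : ℕ), 0 ≤ C ∧ ∀ x, q (reflectAt k x) ≤ C * (1 + ‖x‖) ^ M := by
  obtain ⟨s, C, -, hC⟩ := Seminorm.bound_of_continuous (schwartz_withSeminorms ℂ (Rd d) ℂ) q hq
  set g := SchwartzMap.compCLMOfContinuousLinearEquiv ℂ (ContinuousLinearEquiv.neg ℝ) k with hg
  refine ⟨C * ∑ i ∈ s, 2 ^ i.1 * (SchwartzMap.seminorm ℂ i.1 i.2 g + SchwartzMap.seminorm ℂ 0 i.2 g),
    ∑ i ∈ s, i.1, by positivity, fun x => ?_⟩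
  refine (hC _).trans ?_
  have h1 := Seminorm.finset_sup_le_sum (schwartzSeminormFamily ℂ (Rd d) ℂ) s (reflectAt k x)
  rw [_root_.smul_apply, NNReal.smul_def, smul_eq_mul, mul_assoc]
  refine mul_le_mul_of_nonneg_left (h1.trans ?_) C.2
  rw [_root_.sum_apply, Finset.sum_mul]
  refine Finset.sum_le_sum fun i hi => (seminorm_translate_le g x i.1 i.2).trans ?_
  have h2 : ‖x‖ ^ i.1 ≤ (1 + ‖x‖) ^ ∑ i ∈ s, i.1 :=
    calc ‖x‖ ^ i.1 ≤ (1 + ‖x‖) ^ i.1 := by gcongr; linarith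
      _ ≤ _ := pow_le_pow_right₀ (by linarith [norm_nonneg x])
        (Finset.single_le_sum (f := fun i : ℕ × ℕ => i.1) (fun _ _ => Nat.zero_le _) hi)
  have h3 : 1 ≤ (1 + ‖x‖) ^ ∑ i ∈ s, i.1 := one_le_pow₀ (by linarith [norm_nonneg x])
  have h4 : 0 ≤ SchwartzMap.seminorm ℂ i.1 i.2 g := apply_nonneg _ _
  have h5 : 0 ≤ SchwartzMap.seminorm ℂ 0 i.2 g := apply_nonneg _ _
  rw [mul_assoc]
  gcongr
  nlinarith

/-! ### Integrals of Schwartz-valued maps -/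

theorem hasDerivAt_schwartz_line (f : 𝓢(Rd d, ℂ)) (z e : Rd d) (t : ℝ) :
    HasDerivAt (fun t : ℝ => f (z + t • e)) (∂_{e} f (z + t • e)) t := by
  rw [SchwartzMap.lineDerivOp_apply_eq_fderiv]
  have h := (f.hasFDerivAt (z + t • e)).comp_hasDerivAt t
    (((hasDerivAt_id t).smul_const e).const_add z)
  simp only [one_smul] at h
  exact h

section Exchange

variable {X : Type*} [TopologicalSpace X] [MeasurableSpace X]
  [OpensMeasurableSpace X] {μ : Measure X}

theorem integrable_of_seminorm {F : X → 𝓢(Rd d, ℂ)} (hF : Continuous F)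
    (hint : ∀ q : Seminorm ℂ 𝓢(Rd d, ℂ), Continuous q → Integrable (fun x => q (F x)) μ)
    (u : 𝓢(Rd d, ℂ) →ₗ[ℂ] ℂ) (hu : Continuous u) : Integrable (fun x => u (F x)) μ := by
  have hq : Continuous ((normSeminorm ℂ ℂ).comp u) := by
    change Continuous fun g => ‖u g‖
    fun_prop
  refine (hint _ hq).mono (hu.comp hF).aestronglyMeasurable (.of_forall fun x => ?_)
  simp

theorem continuous_eval (z : Rd d) : Continuous fun f : 𝓢(Rd d, ℂ) => f z :=
  (SchwartzMap.toBoundedContinuousFunctionCLM ℂ (Rd d) ℂ).continuous.eval_const z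

theorem lineDeriv_integral {F : X → 𝓢(Rd d, ℂ)} (hF : Continuous F)
    (hint : ∀ q : Seminorm ℂ 𝓢(Rd d, ℂ), Continuous q → Integrable (fun x => q (F x)) μ)
    {G : 𝓢(Rd d, ℂ)} (hG : ∀ z, G z = ∫ x, F x z ∂μ) (e z : Rd d) :
    ∂_{e} G z = ∫ x, ∂_{e} (F x) z ∂μ := by
  have hc : Continuous fun x => ∂_{e} (F x) :=
    (LineDeriv.lineDerivOpCLM ℂ 𝓢(Rd d, ℂ) e).continuous.comp hF
  have hev : ∀ z : Rd d, Continuous fun x => F x z := fun z => (continuous_eval z).comp hF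
  have hq : Continuous (SchwartzMap.seminorm ℂ 0 0 : Seminorm ℂ 𝓢(Rd d, ℂ)) :=
    (schwartz_withSeminorms ℂ (Rd d) ℂ).continuous_seminorm (0, 0)
  have h := hasDerivAt_integral_of_dominated_loc_of_deriv_le (μ := μ) (𝕜 := ℝ)
    (F := fun t x => F x (z + t • e)) (F' := fun t x => ∂_{e} (F x) (z + t • e)) (x₀ := 0)
    (bound := fun x => SchwartzMap.seminorm ℂ 0 0 (∂_{e} (F x))) (s := univ) univ_mem
    (.of_forall fun t => (hev _).aestronglyMeasurable)
    ?_ ((continuous_eval _).comp hc).aestronglyMeasurable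
    (.of_forall fun x t _ => SchwartzMap.norm_le_seminorm ℂ _ _) ?_
    (.of_forall fun x t _ => hasDerivAt_schwartz_line _ _ _ _)
  · have h1 := h.2
    simp only [← hG, zero_smul, add_zero] at h1
    have h2 := hasDerivAt_schwartz_line G z e 0
    rw [zero_smul, add_zero] at h2
    exact h2.unique h1
  · refine (hint _ hq).mono (hev _).aestronglyMeasurable (.of_forall fun x => ?_)
    rw [Real.norm_of_nonneg (apply_nonneg _ _)]
    exact SchwartzMap.norm_le_seminorm ℂ _ _
  · exact hint (Seminorm.comp (SchwartzMap.seminorm ℂ 0 0 : Seminorm ℂ 𝓢(Rd d, ℂ))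
      (LineDeriv.lineDerivOpCLM ℂ 𝓢(Rd d, ℂ) e).toLinearMap)
      (hq.comp (LineDeriv.lineDerivOpCLM ℂ 𝓢(Rd d, ℂ) e).continuous)

theorem iteratedLineDeriv_integral (n : ℕ) : ∀ {F : X → 𝓢(Rd d, ℂ)}, Continuous F →
    (∀ q : Seminorm ℂ 𝓢(Rd d, ℂ), Continuous q → Integrable (fun x => q (F x)) μ) →
    ∀ {G : 𝓢(Rd d, ℂ)}, (∀ z, G z = ∫ x, F x z ∂μ) → ∀ (m : Fin n → Rd d) (z : Rd d),
    ∂^{m} G z = ∫ x, ∂^{m} (F x) z ∂μ := by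
  induction n with
  | zero => intro F _ _ G hG m z; simpa using hG z
  | succ n ih =>
    intro F hF hint G hG m z
    simp only [LineDeriv.iteratedLineDerivOp_succ_right]
    refine ih ((LineDeriv.lineDerivOpCLM ℂ 𝓢(Rd d, ℂ) (m (Fin.last n))).continuous.comp hF)
      (fun q hq => ?_) (fun z => lineDeriv_integral hF hint hG _ z) _ z
    exact hint (q.comp (LineDeriv.lineDerivOpCLM ℂ 𝓢(Rd d, ℂ) (m (Fin.last n))).toLinearMap)
      (hq.comp (LineDeriv.lineDerivOpCLM ℂ 𝓢(Rd d, ℂ) _).continuous)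

/-- Bounded continuous functions on `ℝ^d` with values in the `n`-linear forms. -/
def DerivSpace (d n : ℕ) : Type := Rd d →ᵇ (Rd d) [×n]→L[ℝ] ℂ

instance (d n : ℕ) : NormedAddCommGroup (DerivSpace d n) :=
  inferInstanceAs (NormedAddCommGroup (Rd d →ᵇ (Rd d) [×n]→L[ℝ] ℂ))

instance (d n : ℕ) : NormedSpace ℂ (DerivSpace d n) :=
  inferInstanceAs (NormedSpace ℂ (Rd d →ᵇ (Rd d) [×n]→L[ℝ] ℂ))

instance (d n : ℕ) : CompleteSpace (DerivSpace d n) :=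
  inferInstanceAs (CompleteSpace (Rd d →ᵇ (Rd d) [×n]→L[ℝ] ℂ))

/-- Evaluation of an element of `DerivSpace d n` at a point and at `n` vectors. -/
def DerivSpace.eval {n : ℕ} (z : Rd d) (v : Fin n → Rd d) : DerivSpace d n →L[ℂ] ℂ :=
  LinearMap.mkContinuous
    { toFun := fun A => (show Rd d →ᵇ (Rd d) [×n]→L[ℝ] ℂ from A) z v
      map_add' := fun _ _ => rfl
      map_smul' := fun _ _ => rfl } (∏ i, ‖v i‖) fun A => by
    rw [mul_comm]
    refine (ContinuousMultilinearMap.le_opNorm _ v).trans ?_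
    gcongr
    exact BoundedContinuousFunction.norm_coe_le_norm (show Rd d →ᵇ (Rd d) [×n]→L[ℝ] ℂ from A) z

theorem DerivSpace.ext_eval {n : ℕ} {A B : DerivSpace d n}
    (h : ∀ z v, DerivSpace.eval z v A = DerivSpace.eval z v B) : A = B :=
  BoundedContinuousFunction.ext fun z => ContinuousMultilinearMap.ext fun v => h z v

theorem norm_weightedDeriv_le (m n : ℕ) (g : 𝓢(Rd d, ℂ)) (z : Rd d) :
    ‖‖z‖ ^ m • iteratedFDeriv ℝ n g z‖ ≤ SchwartzMap.seminorm ℂ m n g := by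
  rw [norm_smul, norm_pow, norm_norm]
  exact SchwartzMap.le_seminorm ℂ m n g z

/-- The function `z ↦ ‖z‖ ^ m D^n g(z)`. -/
def weightedDerivFun (m n : ℕ) (g : 𝓢(Rd d, ℂ)) : DerivSpace d n :=
  BoundedContinuousFunction.ofNormedAddCommGroup
      (fun z => ‖z‖ ^ m • iteratedFDeriv ℝ n g z)
      ((continuous_norm.pow m).smul ((g.smooth n).continuous_iteratedFDeriv le_rfl))
      (SchwartzMap.seminorm ℂ m n g) (norm_weightedDeriv_le m n g)

theorem eval_weightedDerivFun (m n : ℕ) (g : 𝓢(Rd d, ℂ)) (z : Rd d) (v : Fin n → Rd d) :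
    DerivSpace.eval z v (weightedDerivFun m n g) = ‖z‖ ^ m • ∂^{v} g z := by
  rw [SchwartzMap.iteratedLineDerivOp_eq_iteratedFDeriv]
  rfl

/-- The map `g ↦ ‖z‖ ^ m D^n g(z)` from Schwartz functions to bounded continuous functions. -/
def weightedDeriv (m n : ℕ) : 𝓢(Rd d, ℂ) →L[ℂ] DerivSpace d n :=
  SchwartzMap.mkCLMtoNormedSpace (σ := RingHom.id ℂ) (weightedDerivFun m n)
    (fun f g => DerivSpace.ext_eval fun z v => by
      simp only [map_add, eval_weightedDerivFun]
      simp only [← LineDeriv.iteratedLineDerivOpCLM_apply (R := ℂ), map_add]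
      simp)
    (fun c f => DerivSpace.ext_eval fun z v => by
      simp only [map_smul, eval_weightedDerivFun]
      simp only [← LineDeriv.iteratedLineDerivOpCLM_apply (R := ℂ), map_smul]
      simp [mul_left_comm])
    ⟨{(m, n)}, 1, zero_le_one, fun f => by
      rw [one_mul, Finset.sup_singleton]
      exact BoundedContinuousFunction.norm_ofNormedAddCommGroup_le _ (apply_nonneg _ _)
        (norm_weightedDeriv_le m n f)⟩

theorem eval_weightedDeriv (m n : ℕ) (g : 𝓢(Rd d, ℂ)) (z : Rd d) (v : Fin n → Rd d) :
    DerivSpace.eval z v (weightedDeriv m n g) = ‖z‖ ^ m • ∂^{v} g z :=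
  eval_weightedDerivFun m n g z v

theorem seminorm_le_norm_weightedDeriv (m n : ℕ) (g : 𝓢(Rd d, ℂ)) :
    SchwartzMap.seminorm ℂ m n g ≤ ‖weightedDeriv m n g‖ :=
  SchwartzMap.seminorm_le_bound ℂ m n g (norm_nonneg (weightedDeriv m n g)) fun z => by
    have h := BoundedContinuousFunction.norm_coe_le_norm
      (show Rd d →ᵇ (Rd d) [×n]→L[ℝ] ℂ from weightedDeriv m n g) z
    have e : (show Rd d →ᵇ (Rd d) [×n]→L[ℝ] ℂ from weightedDeriv m n g) z =
      ‖z‖ ^ m • iteratedFDeriv ℝ n g z := rfl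
    rw [e, norm_smul, norm_pow, norm_norm] at h
    exact h

/-- Continuity bounds `u g` by the norm of finitely many weighted derivatives of `g`, so `u`
descends to the range of the corresponding map into a finite product of Banach spaces and extends by
Hahn-Banach. This makes the Bochner integral available. -/
theorem exists_factor_weightedDeriv (u : 𝓢(Rd d, ℂ) →ₗ[ℂ] ℂ) (hu : Continuous u) :
    ∃ (s : Finset (ℕ × ℕ))
      (L : (∀ i : s, DerivSpace d i.1.2) →L[ℂ] ℂ),
      ∀ g, u g = L fun i => weightedDeriv i.1.1 i.1.2 g := by
  have hq : Continuous ((normSeminorm ℂ ℂ).comp u) := by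
    change Continuous fun g => ‖u g‖
    fun_prop
  obtain ⟨s, C, -, hC⟩ := Seminorm.bound_of_continuous (schwartz_withSeminorms ℂ (Rd d) ℂ) _ hq
  set ι : 𝓢(Rd d, ℂ) →ₗ[ℂ] (∀ i : s, DerivSpace d i.1.2) :=
    LinearMap.pi fun i => (weightedDeriv i.1.1 i.1.2).toLinearMap with hι
  have hb : ∀ g, ‖u g‖ ≤ C * ‖ι g‖ := fun g => by
    refine (hC g).trans ?_
    rw [_root_.smul_apply, NNReal.smul_def, smul_eq_mul]
    refine mul_le_mul_of_nonneg_left ?_ C.2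
    refine Seminorm.finset_sup_apply_le (norm_nonneg _) fun i hi => ?_
    exact (seminorm_le_norm_weightedDeriv i.1 i.2 g).trans (norm_le_pi_norm (ι g) ⟨i, hi⟩)
  have hker : LinearMap.ker ι ≤ LinearMap.ker u := fun g hg => by
    rw [LinearMap.mem_ker] at hg ⊢
    have := hb g
    rw [hg, norm_zero, mul_zero] at this
    exact norm_le_zero_iff.1 this
  set l : LinearMap.range ι →ₗ[ℂ] ℂ :=
    ((LinearMap.ker ι).liftQ u hker) ∘ₗ ι.quotKerEquivRange.symm.toLinearMap with hl
  have hlu : ∀ g (h : ι g ∈ LinearMap.range ι), l ⟨ι g, h⟩ = u g := fun g h => by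
    simp only [hl, LinearMap.comp_apply, LinearEquiv.coe_coe]
    rw [LinearMap.quotKerEquivRange_symm_apply_image ι g h]
    simp
  obtain ⟨L, hL, -⟩ := exists_extension_norm_eq (𝕜 := ℂ) (LinearMap.range ι)
    (l.mkContinuous C (by
      intro x
      obtain ⟨g, hg⟩ := LinearMap.mem_range.1 x.2
      have hx : x = ⟨ι g, LinearMap.mem_range_self ι g⟩ := Subtype.ext hg.symm
      rw [hx, hlu]
      exact hb g))
  refine ⟨s, L, fun g => ?_⟩
  have h := hL ⟨ι g, LinearMap.mem_range_self ι g⟩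
  rw [LinearMap.mkContinuous_apply, hlu] at h
  exact h.symm

variable [SecondCountableTopology X]

/-- A continuous linear functional commutes with the integral of a Schwartz-valued map. -/
theorem apply_integral {F : X → 𝓢(Rd d, ℂ)} (hF : Continuous F)
    (hint : ∀ q : Seminorm ℂ 𝓢(Rd d, ℂ), Continuous q → Integrable (fun x => q (F x)) μ)
    {G : 𝓢(Rd d, ℂ)} (hG : ∀ z, G z = ∫ x, F x z ∂μ) (u : 𝓢'(Rd d, ℂ)) :
    u G = ∫ x, u (F x) ∂μ := by
  obtain ⟨s, L, hL⟩ := exists_factor_weightedDeriv (u : 𝓢(Rd d, ℂ) →ₗ[ℂ] ℂ) (map_continuous u)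
  change (u : 𝓢(Rd d, ℂ) →ₗ[ℂ] ℂ) G = ∫ x, (u : 𝓢(Rd d, ℂ) →ₗ[ℂ] ℂ) (F x) ∂μ
  simp only [hL]
  set Φ : 𝓢(Rd d, ℂ) →L[ℂ] (∀ i : s, DerivSpace d i.1.2) :=
    ContinuousLinearMap.pi fun i => weightedDeriv i.1.1 i.1.2 with hΦ
  have hc : Continuous fun x => Φ (F x) := Φ.continuous.comp hF
  have hi : Integrable (fun x => Φ (F x)) μ := by
    have hq := hint ((normSeminorm ℂ _).comp Φ.toLinearMap) (by
      change Continuous fun g => ‖Φ g‖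
      fun_prop)
    exact hq.mono hc.aestronglyMeasurable (.of_forall fun x => by simp)
  change L (Φ G) = ∫ x, L (Φ (F x)) ∂μ
  rw [L.integral_comp_comm hi]
  congr 1
  -- `G` is known only as a pointwise integral. Evaluations of weighted derivatives separate points
  -- of the Banach space, and differentiation under the integral identifies the image of `G` with
  -- the Bochner integral.
  refine funext fun i => DerivSpace.ext_eval fun z v => ?_
  set ev : (∀ i : s, DerivSpace d i.1.2) →L[ℂ] ℂ :=
    (DerivSpace.eval z v).comp (ContinuousLinearMap.proj i) with hev
  change ev (Φ G) = ev (∫ x, Φ (F x) ∂μ)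
  rw [← ev.integral_comp_comm hi]
  have e : ∀ g, ev (Φ g) = ‖z‖ ^ i.1.1 • ∂^{v} g z := fun g => eval_weightedDeriv _ _ g z v
  simp only [e]
  rw [integral_smul, iteratedLineDeriv_integral _ hF hint hG]

end Exchange

end

/-! ### Calculus for `conv k u`: associativity, derivatives, multipliers. -/

section

variable {d : ℕ}

/-! ### Convolution of a Schwartz function with a tempered distribution -/

/-- The convolution of two Schwartz functions. -/
def sconv (h k : 𝓢(Rd d, ℂ)) : 𝓢(Rd d, ℂ) :=
  SchwartzMap.convolution (ContinuousLinearMap.mul ℂ ℂ) h k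

theorem sconv_apply (h k : 𝓢(Rd d, ℂ)) (x : Rd d) : sconv h k x = ∫ t, h t * k (x - t) := by
  rw [sconv, SchwartzMap.convolution_apply, convolution_def]
  rfl

theorem sconv_apply_swap (h k : 𝓢(Rd d, ℂ)) (x : Rd d) :
    sconv h k x = ∫ y, h (x - y) * k y := by
  rw [sconv_apply, ← integral_sub_left_eq_self _ volume x]
  simp

theorem fourier_sconv (h k : 𝓢(Rd d, ℂ)) (ξ : Rd d) : 𝓕 (sconv h k) ξ = 𝓕 h ξ * 𝓕 k ξ := by
  rw [sconv, SchwartzMap.fourier_convolution, SchwartzMap.pairing_apply_apply]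
  rfl

theorem sconv_comm (h k : 𝓢(Rd d, ℂ)) : sconv h k = sconv k h := by
  ext x
  rw [sconv_apply, sconv_apply_swap]
  simp_rw [mul_comm]

theorem sconv_eq_of_fourier {h k r : 𝓢(Rd d, ℂ)} (H : ∀ ξ, 𝓕 h ξ * 𝓕 k ξ = 𝓕 r ξ) :
    sconv h k = r := by
  have : 𝓕 (sconv h k) = 𝓕 r := by
    ext ξ; rw [fourier_sconv, H]
  have h2 := congrArg (fun g : 𝓢(Rd d, ℂ) => (𝓕⁻ g : 𝓢(Rd d, ℂ))) this
  simpa using h2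

theorem integrable_one_add_norm_pow_mul (ρ : 𝓢(Rd d, ℂ)) (M : ℕ) :
    Integrable fun y : Rd d => ‖ρ y‖ * (1 + ‖y‖) ^ M := by
  have h0 := ρ.integrable_pow_mul (volume : Measure (Rd d)) 0
  have h1 := ρ.integrable_pow_mul (volume : Measure (Rd d)) M
  refine ((h0.add h1).const_mul (2 ^ M)).mono (by fun_prop) (.of_forall fun y => ?_)
  have h2 : (1 + ‖y‖) ^ M ≤ 2 ^ M * (1 + ‖y‖ ^ M) :=
    calc (1 + ‖y‖) ^ M ≤ 2 ^ (M - 1) * (1 ^ M + ‖y‖ ^ M) :=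
          add_pow_le zero_le_one (norm_nonneg _) M
      _ ≤ _ := by rw [one_pow]; gcongr <;> norm_num
  simp only [Pi.add_apply, pow_zero, one_mul]
  rw [Real.norm_of_nonneg (by positivity), Real.norm_of_nonneg (by positivity)]
  calc _ ≤ ‖ρ y‖ * (2 ^ M * (1 + ‖y‖ ^ M)) := by gcongr
    _ = _ := by ring

theorem integrable_seminorm_smul_reflectAt (ρ k : 𝓢(Rd d, ℂ)) (q : Seminorm ℂ 𝓢(Rd d, ℂ))
    (hq : Continuous q) : Integrable fun y : Rd d => q (ρ y • reflectAt k y) := by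
  obtain ⟨C, M, hC, h⟩ := exists_seminorm_reflectAt_le k q hq
  refine ((integrable_one_add_norm_pow_mul ρ M).const_mul C).mono
    (hq.comp (ρ.continuous.smul (continuous_reflectAt k))).aestronglyMeasurable
    (.of_forall fun y => ?_)
  rw [Real.norm_of_nonneg (apply_nonneg _ _), Real.norm_of_nonneg (by positivity), map_smul_eq_mul]
  calc ‖ρ y‖ * q (reflectAt k y) ≤ ‖ρ y‖ * (C * (1 + ‖y‖) ^ M) := by gcongr; exact h y
    _ = _ := by ring

theorem continuous_conv (k : 𝓢(Rd d, ℂ)) (u : 𝓢'(Rd d, ℂ)) : Continuous (conv k u) :=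
  (map_continuous u).comp (continuous_reflectAt k)

theorem exists_norm_conv_le (k : 𝓢(Rd d, ℂ)) (u : 𝓢'(Rd d, ℂ)) :
    ∃ (C : ℝ) (M : ℕ), 0 ≤ C ∧ ∀ x, ‖conv k u x‖ ≤ C * (1 + ‖x‖) ^ M := by
  have hq : Continuous ((normSeminorm ℂ ℂ).comp (u : 𝓢(Rd d, ℂ) →ₗ[ℂ] ℂ)) := by
    change Continuous fun g => ‖u g‖
    exact (map_continuous u).norm
  exact exists_seminorm_reflectAt_le k _ hq

theorem apply_eq_conv (u : 𝓢'(Rd d, ℂ)) (h : 𝓢(Rd d, ℂ)) : u h = conv (reflectAt h 0) u 0 := by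
  rw [conv]
  congr 1
  ext z
  simp [reflectAt_apply]

theorem integrable_mul_conv (h k : 𝓢(Rd d, ℂ)) (u : 𝓢'(Rd d, ℂ)) (x : Rd d) :
    Integrable fun y => h (x - y) * conv k u y := by
  have := integrable_of_seminorm (μ := volume)
    ((reflectAt h x).continuous.smul (continuous_reflectAt k))
    (integrable_seminorm_smul_reflectAt (reflectAt h x) k) (u : 𝓢(Rd d, ℂ) →ₗ[ℂ] ℂ)
    (map_continuous u)
  simpa [reflectAt_apply, conv] using this

/-- Associativity of convolution: the reflected translate of h * k at x is an integral over y of h(x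
- y) times reflected translates of k, and `apply_integral` takes `u` inside. -/
theorem conv_sconv (h k : 𝓢(Rd d, ℂ)) (u : 𝓢'(Rd d, ℂ)) (x : Rd d) :
    conv (sconv h k) u x = ∫ y, h (x - y) * conv k u y := by
  have := apply_integral (μ := volume)
    ((reflectAt h x).continuous.smul (continuous_reflectAt k))
    (integrable_seminorm_smul_reflectAt (reflectAt h x) k) (G := reflectAt (sconv h k) x)
    (fun z => by
      rw [reflectAt_apply, sconv_apply_swap, ← integral_sub_right_eq_self _ z]
      congr 1; ext y
      simp [reflectAt_apply]) u
  rw [conv, this]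
  simp [reflectAt_apply, conv]

theorem neg_lineDeriv_reflectAt (k : 𝓢(Rd d, ℂ)) (e x : Rd d) :
    -∂_{e} (reflectAt k x) = reflectAt (∂_{e} k) x := by
  ext z
  have h := hasDerivAt_schwartz_line (reflectAt k x) z e 0
  have h2 := hasDerivAt_schwartz_line k (x - z) (-e) 0
  have e1 : (fun t : ℝ => reflectAt k x (z + t • e)) = fun t : ℝ => k (x - z + t • (-e)) := by
    ext t
    rw [reflectAt_apply, smul_neg]
    congr 1; abel
  rw [e1] at h
  have h3 := h.unique h2
  rw [zero_smul, zero_smul, add_zero, add_zero] at h3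
  rw [reflectAt_apply]
  change -(∂_{e} (reflectAt k x) z) = _
  rw [h3, SchwartzMap.lineDerivOp_apply_eq_fderiv, SchwartzMap.lineDerivOp_apply_eq_fderiv]
  simp

theorem conv_lineDeriv (k : 𝓢(Rd d, ℂ)) (u : 𝓢'(Rd d, ℂ)) (e x : Rd d) :
    conv k (∂_{e} u) x = conv (∂_{e} k) u x := by
  rw [conv, conv, ← neg_lineDeriv_reflectAt, TemperedDistribution.lineDerivOp_apply_apply]

/-- The fundamental theorem of calculus along a segment holds for the kernel, and `apply_integral`
transfers it, so no differentiability of `conv k u` has to be established. -/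
theorem conv_add_sub_conv (k : 𝓢(Rd d, ℂ)) (u : 𝓢'(Rd d, ℂ)) (x e : Rd d) :
    conv k u (x + e) - conv k u x = ∫ s in (0 : ℝ)..1, conv (∂_{e} k) u (x + s • e) := by
  have hF : Continuous fun s : ℝ => reflectAt (∂_{e} k) (x + s • e) :=
    (continuous_reflectAt _).comp (by fun_prop)
  have := apply_integral (μ := volume.restrict (Ioc (0 : ℝ) 1)) hF
    (fun q hq => (hq.comp hF).integrableOn_Ioc) (G := reflectAt k (x + e) - reflectAt k x)
    (fun z => by
      rw [← intervalIntegral.integral_of_le zero_le_one]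
      have h := intervalIntegral.integral_eq_sub_of_hasDerivAt (a := 0) (b := 1)
        (fun t _ => hasDerivAt_schwartz_line k (x - z) e t)
        (((∂_{e} k).continuous.comp (by fun_prop)).intervalIntegrable _ _)
      rw [zero_smul, one_smul, add_zero] at h
      simp only [reflectAt_apply]
      have e1 : ∀ s : ℝ, x + s • e - z = x - z + s • e := fun s => by abel
      simp only [e1]
      rw [h]
      simp only [_root_.sub_apply, reflectAt_apply]
      congr 2; abel) u
  rw [intervalIntegral.integral_of_le zero_le_one]
  simp only [conv]
  rw [← this, map_sub]

theorem fourierInv_reflectAt (k : 𝓢(Rd d, ℂ)) (x ξ : Rd d) :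
    𝓕⁻ (reflectAt k x) ξ = (Real.fourierChar (inner ℝ x ξ) : ℂ) * 𝓕 k ξ := by
  rw [SchwartzMap.fourierInv_coe, SchwartzMap.fourier_coe, Real.fourierInv_eq, Real.fourier_eq,
    ← integral_sub_left_eq_self _ volume x, ← integral_const_mul]
  congr 1; ext y
  rw [reflectAt_apply, Circle.smul_def, Circle.smul_def, sub_sub_cancel, inner_sub_left,
    sub_eq_add_neg, AddChar.map_add_eq_mul]
  simp [mul_assoc]

/-- Both sides test `u` against the same function of z, the integral over ξ of e^{2πi⟨x-z,ξ⟩} m(ξ)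
𝓕k(ξ). Multipliers can therefore be moved onto the kernel. -/
theorem conv_fourierMultiplier {m : Rd d → ℂ} (hm : m.HasTemperateGrowth) (k : 𝓢(Rd d, ℂ))
    (u : 𝓢'(Rd d, ℂ)) (x : Rd d) :
    conv k (TemperedDistribution.fourierMultiplierCLM ℂ m u) x =
      conv (SchwartzMap.fourierMultiplierCLM ℂ m k) u x := by
  rw [conv, conv, TemperedDistribution.fourierMultiplierCLM_apply_apply]
  congr 1
  ext z
  rw [reflectAt_apply, SchwartzMap.fourierMultiplierCLM_apply, SchwartzMap.fourier_coe,
    SchwartzMap.fourierInv_coe, Real.fourierInv_eq, Real.fourier_eq]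
  congr 1; ext ξ
  rw [SchwartzMap.smulLeftCLM_apply_apply hm, SchwartzMap.smulLeftCLM_apply_apply hm,
    fourierInv_reflectAt, Circle.smul_def, Circle.smul_def, inner_sub_right,
    sub_eq_add_neg, AddChar.map_add_eq_mul, real_inner_comm ξ x]
  simp only [Circle.coe_mul, smul_eq_mul]
  ring

end

/-! ### Integral operators and near-identity changes of variable on L². -/

section

variable {d : ℕ}

/-! ### `L²` bounds for integral operators -/

theorem eLpNorm_two_sq {α : Type*} [MeasurableSpace α] (μ : Measure α) (F : α → ℝ≥0∞) :
    eLpNorm F 2 μ ^ 2 = ∫⁻ x, F x ^ 2 ∂μ := by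
  have h := eLpNorm_nnreal_pow_eq_lintegral (μ := μ) (f := F) (p := 2) two_ne_zero
  simp only [NNReal.coe_ofNat, ENNReal.coe_ofNat, ENNReal.rpow_ofNat, enorm_eq_self] at h
  exact h

theorem eLpNorm_two_le_of_sq {α : Type*} [MeasurableSpace α] {μ : Measure α} {F : α → ℝ≥0∞}
    {A : ℝ≥0∞} (h : ∫⁻ x, F x ^ 2 ∂μ ≤ A ^ 2) : eLpNorm F 2 μ ≤ A := by
  rw [← eLpNorm_two_sq] at h
  exact (ENNReal.pow_le_pow_left_iff two_ne_zero).1 h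

theorem sq_lintegral_le {Y : Type*} [MeasurableSpace Y] (ν : Measure Y) {H : Y → ℝ≥0∞}
    (hH : AEMeasurable H ν) : (∫⁻ y, H y ∂ν) ^ 2 ≤ ν univ * ∫⁻ y, H y ^ 2 ∂ν := by
  have h := ENNReal.lintegral_mul_le_Lp_mul_Lq ν Real.HolderConjugate.two_two
    (f := fun _ => 1) (g := H) aemeasurable_const hH
  simp only [Pi.mul_apply, one_mul, lintegral_const, ENNReal.rpow_ofNat, one_pow] at h
  calc (∫⁻ y, H y ∂ν) ^ 2
      ≤ (ν univ ^ (1 / (2 : ℝ)) * (∫⁻ y, H y ^ 2 ∂ν) ^ (1 / (2 : ℝ))) ^ 2 := by gcongr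
    _ = _ := by
      rw [mul_pow, ← ENNReal.rpow_natCast, ← ENNReal.rpow_natCast, ← ENNReal.rpow_mul,
        ← ENNReal.rpow_mul]
      norm_num

/-- Minkowski's integral inequality for a uniformly bounded family. -/
theorem eLpNorm_lintegral_le {X Y : Type*} [MeasurableSpace X] [MeasurableSpace Y]
    (μ : Measure X) [SFinite μ] (ν : Measure Y) [SFinite ν] {H : X → Y → ℝ≥0∞}
    (hH : Measurable (Function.uncurry H)) {A : ℝ≥0∞}
    (hA : ∀ᵐ y ∂ν, eLpNorm (fun x => H x y) 2 μ ≤ A) :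
    eLpNorm (fun x => ∫⁻ y, H x y ∂ν) 2 μ ≤ ν univ * A := by
  refine eLpNorm_two_le_of_sq ?_
  calc ∫⁻ x, (∫⁻ y, H x y ∂ν) ^ 2 ∂μ ≤ ∫⁻ x, ν univ * ∫⁻ y, H x y ^ 2 ∂ν ∂μ :=
        lintegral_mono fun x => sq_lintegral_le ν hH.of_uncurry_left.aemeasurable
    _ = ν univ * ∫⁻ x, ∫⁻ y, H x y ^ 2 ∂ν ∂μ := by
        rw [lintegral_const_mul]
        exact Measurable.lintegral_prod_right' (f := fun p : X × Y => H p.1 p.2 ^ 2) (hH.pow_const 2)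
    _ = ν univ * ∫⁻ y, ∫⁻ x, H x y ^ 2 ∂μ ∂ν := by
        rw [lintegral_lintegral_swap]
        exact (hH.pow_const 2).aemeasurable
    _ ≤ ν univ * ∫⁻ _, A ^ 2 ∂ν := by
        refine mul_le_mul_right ?_ _
        refine lintegral_mono_ae (hA.mono fun y hy => ?_)
        rw [← eLpNorm_two_sq]
        gcongr
    _ = (ν univ * A) ^ 2 := by rw [lintegral_const]; ring

/-- The weight is absorbed into the measure, whose total mass becomes ∫ w. -/
theorem eLpNorm_lintegral_mul_le {X Y : Type*} [MeasurableSpace X] [MeasurableSpace Y]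
    (μ : Measure X) [SFinite μ] (ν : Measure Y) [SFinite ν] {w : Y → ℝ≥0∞} (hw : Measurable w)
    {H : X → Y → ℝ≥0∞} (hH : Measurable (Function.uncurry H)) {A : ℝ≥0∞}
    (hA : ∀ y, eLpNorm (fun x => H x y) 2 μ ≤ A) :
    eLpNorm (fun x => ∫⁻ y, w y * H x y ∂ν) 2 μ ≤ (∫⁻ y, w y ∂ν) * A := by
  have h := eLpNorm_lintegral_le μ (ν.withDensity w) hH (.of_forall hA)
  rw [withDensity_apply _ MeasurableSet.univ, setLIntegral_univ] at h
  have e : ∀ x, ∫⁻ y, H x y ∂ν.withDensity w = ∫⁻ y, w y * H x y ∂ν := fun x =>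
    lintegral_withDensity_eq_lintegral_mul ν hw hH.of_uncurry_left
  simpa only [e] using h

/-- The convolution of two nonnegative functions. -/
def lconv (κ γ : Rd d → ℝ≥0∞) (p : Rd d) : ℝ≥0∞ := ∫⁻ z, κ (p - z) * γ z

theorem measurable_lconv {κ γ : Rd d → ℝ≥0∞} (hκ : Measurable κ) (hγ : Measurable γ) :
    Measurable (lconv κ γ) :=
  Measurable.lintegral_prod_right' (f := fun q : Rd d × Rd d => κ (q.1 - q.2) * γ q.2)
    ((hκ.comp (measurable_fst.sub measurable_snd)).mul (hγ.comp measurable_snd))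

/-- Young's inequality. -/
theorem eLpNorm_lconv_le {κ γ : Rd d → ℝ≥0∞} (hκ : Measurable κ) (hγ : Measurable γ) :
    eLpNorm (lconv κ γ) 2 volume ≤ (∫⁻ y, κ y) * eLpNorm γ 2 volume := by
  have e : lconv κ γ = fun x => ∫⁻ y, κ y * γ (x - y) := by
    ext x
    rw [lconv, ← lintegral_sub_left_eq_self _ x]
    simp
  rw [e]
  refine eLpNorm_lintegral_mul_le volume volume hκ (H := fun x y => γ (x - y))
    (hγ.comp (measurable_fst.sub measurable_snd)) fun y => ?_
  exact (eLpNorm_comp_measurePreserving (g := γ) hγ.aestronglyMeasurable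
    (measurePreserving_sub_right volume y)).le

/-! ### Perturbations of the identity -/

theorem exists_volume_eq_hausdorff (d : ℕ) :
    ∃ c : NNReal, (volume : Measure (Rd d)) = c • μH[(d : ℝ)] := by
  have h := isAddHaarMeasure_hausdorffMeasure (E := Rd d)
  rw [finrank_euclideanSpace_fin] at h
  exact ⟨_, Measure.isAddLeftInvariant_eq_smul volume μH[(d : ℝ)]⟩

/-- Lebesgue measure is a multiple of d-dimensional Hausdorff measure, which metric bounds control
directly; neither differentiability of P nor a Jacobian is needed. -/
theorem map_le_of_antilipschitz {K : NNReal} {P : Rd d → Rd d} (hP : AntilipschitzWith K P)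
    (hm : Measurable P) : volume.map P ≤ ((K : ℝ≥0∞) ^ d) • (volume : Measure (Rd d)) := by
  obtain ⟨c, hc⟩ := exists_volume_eq_hausdorff d
  refine Measure.le_iff.2 fun s hs => ?_
  rw [Measure.map_apply hm hs, hc]
  have h := hP.hausdorffMeasure_preimage_le d.cast_nonneg s
  rw [ENNReal.rpow_natCast] at h
  calc (c • μH[(d : ℝ)]) (P ⁻¹' s) = c • μH[(d : ℝ)] (P ⁻¹' s) := rfl
    _ ≤ c • ((K : ℝ≥0∞) ^ d * μH[(d : ℝ)] s) := by gcongr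
    _ = (K : ℝ≥0∞) ^ d * (c • μH[(d : ℝ)] s) := by rw [mul_smul_comm]
    _ = _ := rfl

theorem le_map_of_lipschitz {K : NNReal} {P : Rd d → Rd d} (hP : LipschitzWith K P)
    (hs : Function.Surjective P) :
    (volume : Measure (Rd d)) ≤ ((K : ℝ≥0∞) ^ d) • volume.map P := by
  obtain ⟨c, hc⟩ := exists_volume_eq_hausdorff d
  refine Measure.le_iff.2 fun s h => ?_
  have h1 := hP.hausdorffMeasure_image_le d.cast_nonneg (P ⁻¹' s)
  rw [ENNReal.rpow_natCast, image_preimage_eq _ hs] at h1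
  rw [Measure.smul_apply, Measure.map_apply hP.continuous.measurable h, hc]
  calc (c • μH[(d : ℝ)]) s = c • μH[(d : ℝ)] s := rfl
    _ ≤ c • ((K : ℝ≥0∞) ^ d * μH[(d : ℝ)] (P ⁻¹' s)) := by gcongr
    _ = (K : ℝ≥0∞) ^ d * (c • μH[(d : ℝ)] (P ⁻¹' s)) := by rw [mul_smul_comm]
    _ = _ := rfl

/-- `P` is a perturbation of the identity by a `δ`-Lipschitz map. -/
def IsNearId (δ : ℝ) (P : Rd d → Rd d) : Prop :=
  ∀ x y, ‖(P x - P y) - (x - y)‖ ≤ δ * ‖x - y‖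

theorem IsNearId.mono {δ δ' : ℝ} {P : Rd d → Rd d} (h : IsNearId δ P) (hδ : δ ≤ δ') :
    IsNearId δ' P := fun x y => (h x y).trans (by gcongr)

theorem IsNearId.le_norm {δ : ℝ} {P : Rd d → Rd d} (h : IsNearId δ P) (x y : Rd d) :
    (1 - δ) * ‖x - y‖ ≤ ‖P x - P y‖ := by
  have h1 := h x y
  have h2 := norm_sub_norm_le (x - y) (P x - P y)
  rw [norm_sub_rev (x - y)] at h2
  linarith

theorem IsNearId.norm_le {δ : ℝ} {P : Rd d → Rd d} (h : IsNearId δ P) (x y : Rd d) :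
    ‖P x - P y‖ ≤ (1 + δ) * ‖x - y‖ := by
  have h1 := h x y
  have h2 := norm_sub_norm_le (P x - P y) (x - y)
  linarith

theorem IsNearId.lipschitzWith {δ : ℝ} {P : Rd d → Rd d} (h : IsNearId δ P) :
    LipschitzWith (1 + δ).toNNReal P :=
  LipschitzWith.of_dist_le_mul fun x y => by
    rw [dist_eq_norm, dist_eq_norm]
    refine (h.norm_le x y).trans ?_
    gcongr
    exact Real.le_coe_toNNReal _

theorem IsNearId.continuous {δ : ℝ} {P : Rd d → Rd d} (h : IsNearId δ P) : Continuous P :=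
  h.lipschitzWith.continuous

theorem IsNearId.antilipschitzWith {δ : ℝ} (hδ : δ < 1) {P : Rd d → Rd d} (h : IsNearId δ P) :
    AntilipschitzWith (1 - δ)⁻¹.toNNReal P :=
  AntilipschitzWith.of_le_mul_dist fun x y => by
    rw [dist_eq_norm, dist_eq_norm, Real.coe_toNNReal _ (inv_nonneg.2 (by linarith)),
      ← div_eq_inv_mul, le_div_iff₀ (by linarith), mul_comm]
    exact h.le_norm x y

/-- Solving P x = z amounts to finding a fixed point of x ↦ z - (P x - x), a contraction for δ < 1.
-/
theorem IsNearId.surjective {δ : ℝ} (hδ0 : 0 ≤ δ) (hδ : δ < 1) {P : Rd d → Rd d}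
    (h : IsNearId δ P) : Function.Surjective P := by
  intro z
  have hc : ContractingWith δ.toNNReal fun x => z - (P x - x) := by
    refine ⟨by rwa [Real.toNNReal_lt_one], LipschitzWith.of_dist_le_mul fun x y => ?_⟩
    rw [Real.coe_toNNReal _ hδ0, dist_eq_norm, dist_eq_norm]
    refine le_trans (le_of_eq ?_) (h x y)
    rw [← norm_neg]
    congr 1; abel
  have hf : z - (P hc.fixedPoint - hc.fixedPoint) = hc.fixedPoint := hc.fixedPoint_isFixedPt
  refine ⟨hc.fixedPoint, ?_⟩
  have : z - P hc.fixedPoint = 0 := by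
    rw [sub_sub_eq_add_sub, sub_eq_iff_eq_add] at hf
    rw [sub_eq_zero]
    exact add_right_cancel (hf.trans (add_comm _ _))
  exact (sub_eq_zero.1 this).symm

/-- P is antilipschitz with constant 2, so the image of Lebesgue measure is at most 2^d times
Lebesgue measure. The square root that the L² norm would allow is given up. -/
theorem IsNearId.eLpNorm_comp_le {P : Rd d → Rd d} (h : IsNearId (1 / 2) P) {F : Rd d → ℝ≥0∞}
    (hF : Measurable F) : eLpNorm (F ∘ P) 2 volume ≤ 2 ^ d * eLpNorm F 2 volume := by
  have h1 := map_le_of_antilipschitz (h.antilipschitzWith (by norm_num)) h.continuous.measurable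
  have e : (((1 - 1 / 2 : ℝ)⁻¹.toNNReal : NNReal) : ℝ≥0∞) = 2 := by norm_num
  rw [e] at h1
  refine eLpNorm_two_le_of_sq ?_
  calc ∫⁻ x, (F ∘ P) x ^ 2 = ∫⁻ x, F x ^ 2 ∂(volume.map P) :=
        (lintegral_map (hF.pow_const 2) h.continuous.measurable).symm
    _ ≤ ∫⁻ x, F x ^ 2 ∂((2 : ℝ≥0∞) ^ d • volume) := lintegral_mono' h1 le_rfl
    _ = 2 ^ d * eLpNorm F 2 volume ^ 2 := by rw [lintegral_smul_measure, eLpNorm_two_sq]; rfl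
    _ ≤ (2 ^ d) ^ 2 * eLpNorm F 2 volume ^ 2 := by
        refine mul_le_mul_left (le_self_pow ?_ two_ne_zero) _
        exact one_le_pow_of_one_le' (by norm_num : (1 : ℝ≥0∞) ≤ 2) d
    _ = _ := by ring

end

/-! ### The commutator bound of order δ 2^{2j}: symmetrisation and Taylor expansion. -/

section

variable {d : ℕ}

/-! ### Taylor expansions -/

theorem enorm_add_sub_le {E F : Type*} [NormedAddCommGroup E] [NormedSpace ℝ E]
    [NormedAddCommGroup F] [NormedSpace ℝ F] [CompleteSpace F] {f : E → F} (hf : ContDiff ℝ 1 f)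
    (c b : E) :
    ‖f (c + b) - f c‖ₑ ≤ ‖b‖ₑ * ∫⁻ θ in Icc (0 : ℝ) 1, ‖fderiv ℝ f (c + θ • b)‖ₑ := by
  have hc : Continuous fun θ : ℝ => fderiv ℝ f (c + θ • b) :=
    (hf.continuous_fderiv one_ne_zero).comp (by fun_prop)
  have hd : ∀ θ : ℝ, HasDerivAt (fun θ : ℝ => f (c + θ • b)) (fderiv ℝ f (c + θ • b) b) θ := by
    intro θ
    have h := ((hf.differentiable one_ne_zero) (c + θ • b)).hasFDerivAt.comp_hasDerivAt θ
      (((hasDerivAt_id θ).smul_const b).const_add c)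
    simp only [one_smul] at h
    exact h
  have h := intervalIntegral.integral_eq_sub_of_hasDerivAt (a := 0) (b := 1)
    (fun θ _ => hd θ) ((hc.clm_apply continuous_const).intervalIntegrable _ _)
  rw [zero_smul, one_smul, add_zero] at h
  rw [← h, intervalIntegral.integral_of_le zero_le_one, integral_Icc_eq_integral_Ioc.symm]
  calc _ ≤ ∫⁻ θ in Icc (0 : ℝ) 1, ‖fderiv ℝ f (c + θ • b) b‖ₑ := enorm_integral_le_lintegral_enorm _
    _ ≤ ∫⁻ θ in Icc (0 : ℝ) 1, ‖b‖ₑ * ‖fderiv ℝ f (c + θ • b)‖ₑ := by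
        gcongr with θ
        rw [mul_comm]
        exact (fderiv ℝ f (c + θ • b)).le_opENorm b
    _ = _ := by
        rw [lintegral_const_mul]
        exact hc.enorm.measurable

/-- The mean value bound is applied to p ↦ f p - Df(c) p between c + a and c + a + b, then to Df.
The increment is compared with the differential at c rather than at c + a, so that expansions with
opposite a share one linear map and their linear terms can be added. -/
theorem enorm_taylor_two_le {E F : Type*} [NormedAddCommGroup E] [NormedSpace ℝ E]
    [NormedAddCommGroup F] [NormedSpace ℝ F] [CompleteSpace F] {f : E → F} (hf : ContDiff ℝ 2 f)
    (c a b : E) :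
    ‖f (c + a + b) - f (c + a) - fderiv ℝ f c b‖ₑ ≤
      ‖b‖ₑ * ∫⁻ θ in Icc (0 : ℝ) 1, ‖a + θ • b‖ₑ *
        ∫⁻ s in Icc (0 : ℝ) 1, ‖fderiv ℝ (fderiv ℝ f) (c + s • (a + θ • b))‖ₑ := by
  have hf1 : ContDiff ℝ 1 f := hf.of_le one_le_two
  have hf' : ContDiff ℝ 1 (fderiv ℝ f) := hf.fderiv_right (by norm_num)
  have h := enorm_add_sub_le (f := fun p => f p - fderiv ℝ f c p)
    (hf1.sub (fderiv ℝ f c).contDiff) (c + a) b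
  have e : f (c + a + b) - fderiv ℝ f c (c + a + b) - (f (c + a) - fderiv ℝ f c (c + a)) =
      f (c + a + b) - f (c + a) - fderiv ℝ f c b := by
    rw [map_add _ (c + a) b]; abel
  rw [e] at h
  refine h.trans ?_
  gcongr with θ
  have e2 : fderiv ℝ (fun p => f p - fderiv ℝ f c p) (c + a + θ • b) =
      fderiv ℝ f (c + (a + θ • b)) - fderiv ℝ f c := by
    rw [fderiv_fun_sub ((hf1.differentiable one_ne_zero) _) (fderiv ℝ f c).differentiableAt,
      ContinuousLinearMap.fderiv, add_assoc]
  rw [e2]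
  exact enorm_add_sub_le hf' c (a + θ • b)

/-! ### The commutator at low frequencies -/

/-- The intermediate points in the Taylor expansion of `g (ψ (x + y))` around `ψ x`. -/
def interp (ψ : Rd d → Rd d) (y : Rd d) (θ s : ℝ) (x : Rd d) : Rd d :=
  ψ x + s • (y + θ • (ψ (x + y) - ψ x - y))

/-- Up to an additive constant the map is (1 - sθ) ψ(x) + sθ ψ(x + y), a convex combination of two
perturbations of the identity. -/
theorem isNearId_interp {δ : ℝ} {ψ : Rd d → Rd d} (h : IsNearId δ ψ) (y : Rd d) {θ s : ℝ}
    (hθ : θ ∈ Icc (0 : ℝ) 1) (hs : s ∈ Icc (0 : ℝ) 1) : IsNearId δ (interp ψ y θ s) := by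
  intro x x'
  have e : interp ψ y θ s x - interp ψ y θ s x' - (x - x') =
      (1 - s * θ) • (ψ x - ψ x' - (x - x')) +
        (s * θ) • (ψ (x + y) - ψ (x' + y) - ((x + y) - (x' + y))) := by
    simp only [interp]
    module
  have h1 : 0 ≤ s * θ := mul_nonneg hs.1 hθ.1
  have h2 : 0 ≤ 1 - s * θ := by nlinarith [hs.1, hs.2, hθ.1, hθ.2]
  rw [e]
  calc _ ≤ ‖(1 - s * θ) • (ψ x - ψ x' - (x - x'))‖ +
        ‖(s * θ) • (ψ (x + y) - ψ (x' + y) - ((x + y) - (x' + y)))‖ := norm_add_le _ _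
    _ ≤ (1 - s * θ) * (δ * ‖x - x'‖) + (s * θ) * (δ * ‖x + y - (x' + y)‖) := by
        rw [norm_smul, norm_smul, Real.norm_of_nonneg h1, Real.norm_of_nonneg h2]
        gcongr
        · exact h x x'
        · exact h (x + y) (x' + y)
    _ = _ := by rw [add_sub_add_right_eq_sub]; ring

/-- The function `g` is reproduced by convolution with the Schwartz function `K`. -/
def IsReproduced (K : 𝓢(Rd d, ℂ)) (g : Rd d → ℂ) : Prop :=
  ∀ p, Integrable (fun z => K (p - z) * g z) ∧ g p = ∫ z, K (p - z) * g z

/-- The size of the first derivative of a Schwartz function. -/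
def derivSize (K : 𝓢(Rd d, ℂ)) (p : Rd d) : ℝ≥0∞ := ‖fderiv ℝ K p‖ₑ

/-- The size of the second derivative of a Schwartz function. -/
def derivTwoSize (K : 𝓢(Rd d, ℂ)) (p : Rd d) : ℝ≥0∞ := ‖fderiv ℝ (fderiv ℝ K) p‖ₑ

theorem measurable_derivSize (K : 𝓢(Rd d, ℂ)) : Measurable (derivSize K) :=
  ((K.smooth 1).continuous_fderiv one_ne_zero).enorm.measurable

theorem measurable_derivTwoSize (K : 𝓢(Rd d, ℂ)) : Measurable (derivTwoSize K) :=
  (((K.smooth 2).fderiv_right (m := 1) (by norm_num)).continuous_fderiv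
    one_ne_zero).enorm.measurable

variable {ψ : Rd d → Rd d} {δ R : ℝ}

/-- Expand K(ψ(x ± y) - z) around ψ(x) - z with b = ψ(x ± y) - ψ(x) ∓ y. The two linear terms add up
to DK applied to the second difference of ψ. Each remainder is at most ‖b‖ (‖y‖ + ‖b‖) ≤ 2δ‖y‖²
times an average of D²K over intermediate points. -/
theorem enorm_second_difference_le (hψ : IsNearId δ ψ) (hδ1 : δ ≤ 1 / 2)
    (hψ2 : ∀ x y, ‖ψ (x + y) + ψ (x - y) - (2 : ℝ) • ψ x‖ ≤ δ * R * ‖y‖ ^ 2)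
    (K : 𝓢(Rd d, ℂ)) (x y z : Rd d) :
    ‖K (ψ x + y - z) + K (ψ x - y - z) - K (ψ (x + y) - z) - K (ψ (x - y) - z)‖ₑ ≤
      ‖y‖ₑ ^ 2 * (ENNReal.ofReal (δ * R) * derivSize K (ψ x - z) +
        2 * ENNReal.ofReal δ * (
          (∫⁻ θ in Icc (0 : ℝ) 1, ∫⁻ s in Icc (0 : ℝ) 1, derivTwoSize K (interp ψ y θ s x - z)) +
          ∫⁻ θ in Icc (0 : ℝ) 1, ∫⁻ s in Icc (0 : ℝ) 1,
            derivTwoSize K (interp ψ (-y) θ s x - z))) := by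
  have key : ∀ y : Rd d, ‖K (ψ (x + y) - z) - K (ψ x + y - z) -
      fderiv ℝ K (ψ x - z) (ψ (x + y) - ψ x - y)‖ₑ ≤ ‖y‖ₑ ^ 2 * (2 * ENNReal.ofReal δ *
        ∫⁻ θ in Icc (0 : ℝ) 1, ∫⁻ s in Icc (0 : ℝ) 1, derivTwoSize K (interp ψ y θ s x - z)) := by
    intro y
    have h := enorm_taylor_two_le (K.smooth 2) (ψ x - z) y (ψ (x + y) - ψ x - y)
    have e1 : ψ x - z + y + (ψ (x + y) - ψ x - y) = ψ (x + y) - z := by abel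
    have e2 : ψ x - z + y = ψ x + y - z := by abel
    rw [e1, e2] at h
    refine h.trans ?_
    have hb : ‖ψ (x + y) - ψ x - y‖ₑ ≤ ENNReal.ofReal δ * ‖y‖ₑ := by
      rw [← ofReal_norm, ← ofReal_norm, ← ENNReal.ofReal_mul' (norm_nonneg _)]
      refine ENNReal.ofReal_le_ofReal ?_
      simpa using hψ (x + y) x
    have hb2 : ‖ψ (x + y) - ψ x - y‖ ≤ 1 / 2 * ‖y‖ := by
      simpa using (hψ.mono hδ1) (x + y) x
    calc _ ≤ (ENNReal.ofReal δ * ‖y‖ₑ) * ∫⁻ θ in Icc (0 : ℝ) 1, (2 * ‖y‖ₑ) *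
          ∫⁻ s in Icc (0 : ℝ) 1, derivTwoSize K (interp ψ y θ s x - z) := by
          gcongr ?_ * ?_
          refine setLIntegral_mono' measurableSet_Icc fun θ hθ => ?_
          gcongr ?_ * ?_
          · have h2 : (2 : ℝ≥0∞) * ENNReal.ofReal ‖y‖ = ENNReal.ofReal (2 * ‖y‖) := by
              rw [ENNReal.ofReal_mul zero_le_two, ENNReal.ofReal_ofNat]
            rw [← ofReal_norm, ← ofReal_norm, h2]
            refine ENNReal.ofReal_le_ofReal ((norm_add_le _ _).trans ?_)
            rw [norm_smul, Real.norm_of_nonneg hθ.1]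
            nlinarith [hθ.1, hθ.2, norm_nonneg y, norm_nonneg (ψ (x + y) - ψ x - y)]
          · refine lintegral_mono fun s => le_of_eq ?_
            rw [derivTwoSize, interp]
            congr 2; abel
      _ = _ := by
          rw [lintegral_const_mul' _ _ (by finiteness)]
          ring
  have k1 := key y
  have k2 := key (-y)
  rw [← sub_eq_add_neg, ← sub_eq_add_neg, enorm_neg] at k2
  have e : K (ψ x + y - z) + K (ψ x - y - z) - K (ψ (x + y) - z) - K (ψ (x - y) - z) =
      -(fderiv ℝ K (ψ x - z) (ψ (x + y) + ψ (x - y) - (2 : ℝ) • ψ x)) -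
      (K (ψ (x + y) - z) - K (ψ x + y - z) - fderiv ℝ K (ψ x - z) (ψ (x + y) - ψ x - y)) -
      (K (ψ (x - y) - z) - K (ψ x - y - z) - fderiv ℝ K (ψ x - z) (ψ (x - y) - ψ x - -y)) := by
    have : ψ (x + y) + ψ (x - y) - (2 : ℝ) • ψ x =
      (ψ (x + y) - ψ x - y) + (ψ (x - y) - ψ x - -y) := by module
    rw [this, map_add]; ring
  have k0 : ‖-(fderiv ℝ K (ψ x - z) (ψ (x + y) + ψ (x - y) - (2 : ℝ) • ψ x))‖ₑ ≤
      ‖y‖ₑ ^ 2 * (ENNReal.ofReal (δ * R) * derivSize K (ψ x - z)) := by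
    rw [enorm_neg]
    refine ((fderiv ℝ K (ψ x - z)).le_opENorm _).trans ?_
    rw [derivSize, mul_comm, ← mul_assoc]
    gcongr
    rw [← ofReal_norm, ← ofReal_norm, ← ENNReal.ofReal_pow (norm_nonneg _),
      ← ENNReal.ofReal_mul (by positivity), mul_comm]
    exact ENNReal.ofReal_le_ofReal (hψ2 x y)
  rw [e]
  refine (enorm_sub_le.trans (add_le_add (enorm_sub_le.trans (add_le_add k0 k1)) k2)).trans
    (le_of_eq ?_)
  ring

/-- The second difference of `g ∘ ψ` compared with that of `g`. -/
def secondDiff (g : Rd d → ℂ) (ψ : Rd d → Rd d) (x y : Rd d) : ℂ :=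
  g (ψ x + y) + g (ψ x - y) - g (ψ (x + y)) - g (ψ (x - y))

theorem lintegral_derivTwoSize_interp (hψ : Continuous ψ) (K : 𝓢(Rd d, ℂ)) {γ : Rd d → ℝ≥0∞}
    (hγ : Measurable γ) (x y : Rd d) :
    ∫⁻ z, (∫⁻ θ in Icc (0 : ℝ) 1, ∫⁻ s in Icc (0 : ℝ) 1,
        derivTwoSize K (interp ψ y θ s x - z)) * γ z =
      ∫⁻ θ in Icc (0 : ℝ) 1, ∫⁻ s in Icc (0 : ℝ) 1,
        lconv (derivTwoSize K) γ (interp ψ y θ s x) := by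
  have hK := measurable_derivTwoSize K
  have hm : Measurable fun p : (Rd d × ℝ) × ℝ => derivTwoSize K (interp ψ y p.1.2 p.2 x - p.1.1) :=
    hK.comp (by unfold interp; fun_prop)
  have hm1 : Measurable fun p : Rd d × ℝ => ∫⁻ s in Icc (0 : ℝ) 1,
      derivTwoSize K (interp ψ y p.2 s x - p.1) := hm.lintegral_prod_right'
  have e1 : ∀ z, (∫⁻ θ in Icc (0 : ℝ) 1, ∫⁻ s in Icc (0 : ℝ) 1,
        derivTwoSize K (interp ψ y θ s x - z)) * γ z =
      ∫⁻ θ in Icc (0 : ℝ) 1, ∫⁻ s in Icc (0 : ℝ) 1,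
        derivTwoSize K (interp ψ y θ s x - z) * γ z := fun z => by
    rw [← lintegral_mul_const]
    · refine lintegral_congr fun θ => ?_
      rw [lintegral_mul_const]
      exact hm.comp (f := fun s : ℝ => ((z, θ), s)) (by fun_prop)
    · exact hm1.comp (f := fun θ : ℝ => (z, θ)) (by fun_prop)
  simp only [e1]
  have hm2 : Measurable fun p : (Rd d × ℝ) × ℝ =>
      derivTwoSize K (interp ψ y p.1.2 p.2 x - p.1.1) * γ p.1.1 :=
    hm.mul (hγ.comp (by fun_prop))
  rw [lintegral_lintegral_swap hm2.lintegral_prod_right'.aemeasurable]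
  refine lintegral_congr fun θ => ?_
  rw [lintegral_lintegral_swap]
  · rfl
  · exact (hm2.comp (f := fun p : Rd d × ℝ => ((p.1, θ), p.2)) (by fun_prop)).aemeasurable

/-- The majorant of the second difference. -/
def lowMajorant (K : 𝓢(Rd d, ℂ)) (γ : Rd d → ℝ≥0∞) (ψ : Rd d → Rd d) (δ R : ℝ) (x y : Rd d) :
    ℝ≥0∞ :=
  ENNReal.ofReal (δ * R) * lconv (derivSize K) γ (ψ x) + 2 * ENNReal.ofReal δ * (
    (∫⁻ θ in Icc (0 : ℝ) 1, ∫⁻ s in Icc (0 : ℝ) 1,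
      lconv (derivTwoSize K) γ (interp ψ y θ s x)) +
    ∫⁻ θ in Icc (0 : ℝ) 1, ∫⁻ s in Icc (0 : ℝ) 1,
      lconv (derivTwoSize K) γ (interp ψ (-y) θ s x))

/-- Reproduction by K moves the differences from g to the smooth kernel; g then enters only through
|g|, and the derivatives of K supply the powers of the frequency. -/
theorem enorm_secondDiff_le (hψ : IsNearId δ ψ) (hδ1 : δ ≤ 1 / 2)
    (hψ2 : ∀ x y, ‖ψ (x + y) + ψ (x - y) - (2 : ℝ) • ψ x‖ ≤ δ * R * ‖y‖ ^ 2)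
    {K : 𝓢(Rd d, ℂ)} {g : Rd d → ℂ} (hg : Measurable g) (hK : IsReproduced K g) (x y : Rd d) :
    ‖secondDiff g ψ x y‖ₑ ≤ ‖y‖ₑ ^ 2 * lowMajorant K (fun z => ‖g z‖ₑ) ψ δ R x y := by
  have e : secondDiff g ψ x y = ∫ z, (K (ψ x + y - z) + K (ψ x - y - z) - K (ψ (x + y) - z) -
      K (ψ (x - y) - z)) * g z := by
    simp only [secondDiff, sub_mul, add_mul]
    have i := fun p => (hK p).1
    rw [(hK (ψ x + y)).2, (hK (ψ x - y)).2, (hK (ψ (x + y))).2, (hK (ψ (x - y))).2,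
      integral_sub (by exact ((i _).add (i _)).sub (i _)) (i _),
      integral_sub (by exact (i _).add (i _)) (i _), integral_add (i _) (i _)]
  have hc := hψ.continuous
  rw [e]
  refine (enorm_integral_le_lintegral_enorm _).trans ?_
  calc _ ≤ ∫⁻ z, (‖y‖ₑ ^ 2 * (ENNReal.ofReal (δ * R) * derivSize K (ψ x - z) +
        2 * ENNReal.ofReal δ * (
          (∫⁻ θ in Icc (0 : ℝ) 1, ∫⁻ s in Icc (0 : ℝ) 1, derivTwoSize K (interp ψ y θ s x - z)) +
          ∫⁻ θ in Icc (0 : ℝ) 1, ∫⁻ s in Icc (0 : ℝ) 1,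
            derivTwoSize K (interp ψ (-y) θ s x - z)))) * ‖g z‖ₑ := by
        refine lintegral_mono fun z => ?_
        rw [enorm_mul]
        exact mul_le_mul_left (enorm_second_difference_le hψ hδ1 hψ2 K x y z) _
    _ = ∫⁻ z, (‖y‖ₑ ^ 2 * ENNReal.ofReal (δ * R) * (derivSize K (ψ x - z) * ‖g z‖ₑ) +
        ‖y‖ₑ ^ 2 * (2 * ENNReal.ofReal δ) * (
          (∫⁻ θ in Icc (0 : ℝ) 1, ∫⁻ s in Icc (0 : ℝ) 1,
            derivTwoSize K (interp ψ y θ s x - z)) * ‖g z‖ₑ +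
          (∫⁻ θ in Icc (0 : ℝ) 1, ∫⁻ s in Icc (0 : ℝ) 1,
            derivTwoSize K (interp ψ (-y) θ s x - z)) * ‖g z‖ₑ)) := by
        congr 1; ext z; ring
    _ = _ := by
        have m1 : Measurable fun z => derivSize K (ψ x - z) * ‖g z‖ₑ :=
          ((measurable_derivSize K).comp (measurable_const.sub measurable_id)).mul hg.enorm
        have m2 : ∀ y, Measurable fun z => (∫⁻ θ in Icc (0 : ℝ) 1, ∫⁻ s in Icc (0 : ℝ) 1,
            derivTwoSize K (interp ψ y θ s x - z)) * ‖g z‖ₑ := fun y => by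
          have hm : Measurable fun p : (Rd d × ℝ) × ℝ =>
              derivTwoSize K (interp ψ y p.1.2 p.2 x - p.1.1) :=
            (measurable_derivTwoSize K).comp (by unfold interp; fun_prop)
          exact (Measurable.lintegral_prod_right' (Measurable.lintegral_prod_right' hm)).mul
            hg.enorm
        rw [lintegral_add_left (m1.const_mul _), lintegral_const_mul _ m1,
          lintegral_const_mul _ (by exact (m2 _).add (m2 _)),
          lintegral_add_left (m2 _),
          lintegral_derivTwoSize_interp hc K hg.enorm, lintegral_derivTwoSize_interp hc K hg.enorm,
          lowMajorant, lconv]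
        ring

theorem measurable_lintegral_interp (hψ : Continuous ψ) {G : Rd d → ℝ≥0∞} (hG : Measurable G)
    {r : Rd d → Rd d} (hr : Continuous r) :
    Measurable fun p : Rd d × Rd d => ∫⁻ θ in Icc (0 : ℝ) 1, ∫⁻ s in Icc (0 : ℝ) 1,
      G (interp ψ (r p.2) θ s p.1) := by
  have hm : Measurable fun p : ((Rd d × Rd d) × ℝ) × ℝ =>
      G (interp ψ (r p.1.1.2) p.1.2 p.2 p.1.1.1) :=
    hG.comp (by unfold interp; fun_prop)
  exact Measurable.lintegral_prod_right' (Measurable.lintegral_prod_right' hm)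

/-- Both parameter intervals have mass one, and for fixed parameters composition with the
near-identity map `interp` costs at most 2^d; Minkowski's inequality is used once in each parameter.
-/
theorem eLpNorm_lintegral_interp_le (hψ : IsNearId (1 / 2) ψ) {G : Rd d → ℝ≥0∞}
    (hG : Measurable G) (y : Rd d) :
    eLpNorm (fun x => ∫⁻ θ in Icc (0 : ℝ) 1, ∫⁻ s in Icc (0 : ℝ) 1, G (interp ψ y θ s x)) 2
      volume ≤ 2 ^ d * eLpNorm G 2 volume := by
  have hc := hψ.continuous
  have hm : Measurable fun p : (Rd d × ℝ) × ℝ => G (interp ψ y p.1.2 p.2 p.1.1) :=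
    hG.comp (by unfold interp; fun_prop)
  have h1 : ∀ ν : Measure ℝ, ν = volume.restrict (Icc (0 : ℝ) 1) → ν univ = 1 := by
    rintro ν rfl; simp
  have := eLpNorm_lintegral_le (volume : Measure (Rd d)) (volume.restrict (Icc (0 : ℝ) 1))
    (H := fun x θ => ∫⁻ s in Icc (0 : ℝ) 1, G (interp ψ y θ s x)) (A := 2 ^ d * eLpNorm G 2 volume)
    (Measurable.lintegral_prod_right' hm)
    ((ae_restrict_mem measurableSet_Icc).mono fun θ hθ => by
      have := eLpNorm_lintegral_le (volume : Measure (Rd d)) (volume.restrict (Icc (0 : ℝ) 1))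
        (H := fun x s => G (interp ψ y θ s x)) (A := 2 ^ d * eLpNorm G 2 volume)
        (hm.comp (f := fun p : Rd d × ℝ => ((p.1, θ), p.2)) (by fun_prop))
        ((ae_restrict_mem measurableSet_Icc).mono fun s hs =>
          (isNearId_interp hψ y hθ hs).eLpNorm_comp_le hG)
      rwa [h1 _ rfl, one_mul] at this)
  rwa [h1 _ rfl, one_mul] at this

theorem eLpNorm_lowMajorant_le (hψ : IsNearId (1 / 2) ψ) (K : 𝓢(Rd d, ℂ)) {γ : Rd d → ℝ≥0∞}
    (hγ : Measurable γ) (y : Rd d) :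
    eLpNorm (fun x => lowMajorant K γ ψ δ R x y) 2 volume ≤
      2 ^ d * (ENNReal.ofReal (δ * R) * (∫⁻ z, derivSize K z) +
        4 * ENNReal.ofReal δ * ∫⁻ z, derivTwoSize K z) * eLpNorm γ 2 volume := by
  have hc := hψ.continuous
  have g1 := measurable_lconv (measurable_derivSize K) hγ
  have g2 := measurable_lconv (measurable_derivTwoSize K) hγ
  have n1 := eLpNorm_lconv_le (measurable_derivSize K) hγ
  have n2 := eLpNorm_lconv_le (measurable_derivTwoSize K) hγ
  have m2 : ∀ y : Rd d, Measurable fun x => ∫⁻ θ in Icc (0 : ℝ) 1, ∫⁻ s in Icc (0 : ℝ) 1,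
      lconv (derivTwoSize K) γ (interp ψ y θ s x) := fun y =>
    (measurable_lintegral_interp hc g2 (r := fun y => y) continuous_id).comp
      (f := fun x : Rd d => (x, y)) (by fun_prop)
  have hsmul : ∀ (c : ℝ≥0∞) {F : Rd d → ℝ≥0∞}, Measurable F →
      eLpNorm (fun x => c * F x) 2 volume ≤ c * eLpNorm F 2 volume := fun c F hF => by
    refine eLpNorm_two_le_of_sq ?_
    simp only [mul_pow]
    rw [eLpNorm_two_sq, lintegral_const_mul _ (hF.pow_const 2)]
  have hadd : ∀ {F G : Rd d → ℝ≥0∞}, Measurable F → Measurable G →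
      eLpNorm (fun x => F x + G x) 2 volume ≤ eLpNorm F 2 volume + eLpNorm G 2 volume :=
    fun hF hG => eLpNorm_add_le hF.aestronglyMeasurable hG.aestronglyMeasurable one_le_two
  have g1' := g1.comp hc.measurable
  have b1 := hψ.eLpNorm_comp_le g1
  have b2 := eLpNorm_lintegral_interp_le hψ g2 y
  have b3 := eLpNorm_lintegral_interp_le hψ g2 (-y)
  calc _ ≤ ENNReal.ofReal (δ * R) * eLpNorm (lconv (derivSize K) γ ∘ ψ) 2 volume +
        2 * ENNReal.ofReal δ * (eLpNorm (fun x => ∫⁻ θ in Icc (0 : ℝ) 1, ∫⁻ s in Icc (0 : ℝ) 1,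
          lconv (derivTwoSize K) γ (interp ψ y θ s x)) 2 volume +
          eLpNorm (fun x => ∫⁻ θ in Icc (0 : ℝ) 1, ∫⁻ s in Icc (0 : ℝ) 1,
          lconv (derivTwoSize K) γ (interp ψ (-y) θ s x)) 2 volume) := by
        refine (hadd (g1'.const_mul _) (((m2 y).add (m2 (-y))).const_mul _)).trans ?_
        refine add_le_add (hsmul _ g1') ((hsmul _ ((m2 y).add (m2 (-y)))).trans ?_)
        exact mul_le_mul_right (hadd (m2 y) (m2 (-y))) _
    _ ≤ ENNReal.ofReal (δ * R) * (2 ^ d * ((∫⁻ z, derivSize K z) * eLpNorm γ 2 volume)) +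
        2 * ENNReal.ofReal δ * (2 ^ d * ((∫⁻ z, derivTwoSize K z) * eLpNorm γ 2 volume) +
          2 ^ d * ((∫⁻ z, derivTwoSize K z) * eLpNorm γ 2 volume)) := by
        gcongr
        · exact b1.trans (by gcongr)
        · exact b2.trans (by gcongr)
        · exact b3.trans (by gcongr)
    _ = _ := by ring

/-! ### The nonlocal operator -/

theorem continuous_gaussianKernel (ε : ℝ) : Continuous (gaussianKernel ε : Rd d → ℝ) := by
  unfold gaussianKernel; fun_prop

theorem gaussianKernel_neg (ε : ℝ) (x : Rd d) : gaussianKernel ε (-x) = gaussianKernel ε x := by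
  simp [gaussianKernel]

theorem gaussianKernel_nonneg {ε : ℝ} (hε : 0 < ε) (x : Rd d) : 0 ≤ gaussianKernel ε x := by
  unfold gaussianKernel; positivity

theorem integrable_exp_neg_mul_norm_sq {b : ℝ} (hb : 0 < b) :
    Integrable fun x : Rd d => Real.exp (-b * ‖x‖ ^ 2) := by
  have h := GaussianFourier.integrable_cexp_neg_mul_sq_norm_add (V := Rd d) (b := (b : ℂ))
    (by simpa using hb) 0 0
  refine h.norm.congr (.of_forall fun x => ?_)
  simp only [inner_zero_left, Complex.ofReal_zero, mul_zero, add_zero]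
  rw [← Complex.ofReal_neg, ← Complex.ofReal_pow, ← Complex.ofReal_mul, ← Complex.ofReal_exp,
    Complex.norm_real, Real.norm_of_nonneg (Real.exp_nonneg _)]

theorem integrable_gaussianKernel {ε : ℝ} (hε : 0 < ε) :
    Integrable (gaussianKernel ε : Rd d → ℝ) := by
  have h := ((integrable_exp_neg_mul_norm_sq (d := d) (b := (4 * ε ^ 2)⁻¹)
    (by positivity)).const_mul ((4 * Real.pi) ^ (-(d : ℝ) / 2))).const_mul (ε ^ d)⁻¹
  refine h.congr (.of_forall fun x => ?_)
  simp only [gaussianKernel, norm_smul, norm_inv, Real.norm_of_nonneg hε.le]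
  congr 3
  field_simp

/-- The terms g(ψ x) cancel between the two operators, and evenness of the Gaussian allows averaging
over y and -y. This symmetrisation makes the integrand quadratic in y instead of linear; the factor
1/2 of the average is discarded. -/
theorem enorm_nonlocal_sub_le {ε : ℝ} (hε : 0 < ε) {g : Rd d → ℂ} (hg : Continuous g) {B : ℝ}
    (hB : ∀ x, ‖g x‖ ≤ B) (hψ : Continuous ψ) (x : Rd d) :
    ‖nonlocal ε g (ψ x) - nonlocal ε (g ∘ ψ) x‖ₑ ≤ ENNReal.ofReal (ε ^ 2)⁻¹ *
      ∫⁻ y, ‖(gaussianKernel ε y : ℝ)‖ₑ * ‖secondDiff g ψ x y‖ₑ := by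
  have hi : ∀ r : Rd d → Rd d, Continuous r →
      Integrable fun y => gaussianKernel ε y • g (r y) := fun r hr =>
    (integrable_gaussianKernel hε).smul_bdd B (hg.comp hr).aestronglyMeasurable
      (.of_forall fun y => hB _)
  have e1 : ∫ y, gaussianKernel ε y • g (ψ x - y) = ∫ y, gaussianKernel ε y • g (ψ x + y) := by
    rw [← integral_neg_eq_self]
    simp only [gaussianKernel_neg, sub_neg_eq_add]
  have e2 : ∫ y, gaussianKernel ε y • g (ψ (x - y)) =
      ∫ y, gaussianKernel ε y • g (ψ (x + y)) := by
    rw [← integral_neg_eq_self]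
    simp only [gaussianKernel_neg, sub_neg_eq_add]
  have i1 := hi (fun y => ψ x + y) (by fun_prop)
  have i2 := hi (fun y => ψ x - y) (by fun_prop)
  have i3 := hi (fun y => ψ (x + y)) (by fun_prop)
  have i4 := hi (fun y => ψ (x - y)) (by fun_prop)
  have e : (2 : ℂ) * (nonlocal ε g (ψ x) - nonlocal ε (g ∘ ψ) x) =
      (ε ^ 2)⁻¹ • ∫ y, gaussianKernel ε y • secondDiff g ψ x y := by
    have e3 : ∫ y, gaussianKernel ε y • secondDiff g ψ x y =
        (∫ y, gaussianKernel ε y • g (ψ x + y)) + (∫ y, gaussianKernel ε y • g (ψ x - y)) -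
        (∫ y, gaussianKernel ε y • g (ψ (x + y))) - ∫ y, gaussianKernel ε y • g (ψ (x - y)) := by
      simp only [secondDiff, smul_sub, smul_add]
      rw [integral_sub (by exact (i1.add i2).sub i3) i4, integral_sub (by exact i1.add i2) i3,
        integral_add i1 i2]
    rw [e3, ← e1, ← e2]
    simp only [nonlocal, convolution_def, ContinuousLinearMap.lsmul_apply, Function.comp_apply,
      Complex.real_smul]
    ring
  calc _ ≤ ‖(2 : ℂ) * (nonlocal ε g (ψ x) - nonlocal ε (g ∘ ψ) x)‖ₑ := by
        rw [enorm_mul]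
        refine le_mul_of_one_le_left' ?_
        rw [← ofReal_norm]
        norm_num
    _ ≤ ENNReal.ofReal (ε ^ 2)⁻¹ * ∫⁻ y, ‖gaussianKernel ε y • secondDiff g ψ x y‖ₑ := by
        rw [e, enorm_smul, Real.enorm_of_nonneg (by positivity)]
        gcongr
        exact enorm_integral_le_lintegral_enorm _
    _ = _ := by simp only [enorm_smul]

theorem eLpNorm_nonlocal_sub_le_low {ε : ℝ} (hε : 0 < ε) (hψ : IsNearId δ ψ) (hδ1 : δ ≤ 1 / 2)
    (hψ2 : ∀ x y, ‖ψ (x + y) + ψ (x - y) - (2 : ℝ) • ψ x‖ ≤ δ * R * ‖y‖ ^ 2)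
    {K : 𝓢(Rd d, ℂ)} {g : Rd d → ℂ} (hg : Continuous g) {B : ℝ} (hB : ∀ x, ‖g x‖ ≤ B)
    (hK : IsReproduced K g) :
    eLpNorm (fun x => nonlocal ε g (ψ x) - nonlocal ε (g ∘ ψ) x) 2 volume ≤
      ENNReal.ofReal (ε ^ 2)⁻¹ * ((∫⁻ y : Rd d, ‖gaussianKernel ε y‖ₑ * ‖y‖ₑ ^ 2) *
        (2 ^ d * (ENNReal.ofReal (δ * R) * (∫⁻ z, derivSize K z) +
        4 * ENNReal.ofReal δ * ∫⁻ z, derivTwoSize K z) * eLpNorm g 2 volume)) := by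
  have hc := hψ.continuous
  have hγ : Measurable fun z => ‖g z‖ₑ := hg.measurable.enorm
  have g1 := measurable_lconv (measurable_derivSize K) hγ
  have g2 := measurable_lconv (measurable_derivTwoSize K) hγ
  have hm : Measurable fun p : Rd d × Rd d => lowMajorant K (fun z => ‖g z‖ₑ) ψ δ R p.1 p.2 :=
    ((g1.comp (hc.measurable.comp measurable_fst)).const_mul _).add
      (((measurable_lintegral_interp hc g2 (r := fun y => y) continuous_id).add
        (measurable_lintegral_interp hc g2 (r := fun y => -y) continuous_neg)).const_mul _)
  have hw : Measurable fun y : Rd d => ‖gaussianKernel ε y‖ₑ * ‖y‖ₑ ^ 2 :=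
    (continuous_gaussianKernel ε).measurable.enorm.mul (measurable_enorm.pow_const 2)
  have key := eLpNorm_lintegral_mul_le (volume : Measure (Rd d)) (volume : Measure (Rd d)) hw
    (H := lowMajorant K (fun z => ‖g z‖ₑ) ψ δ R) hm
    (eLpNorm_lowMajorant_le (hψ.mono hδ1) K hγ)
  rw [eLpNorm_enorm g] at key
  refine eLpNorm_two_le_of_sq ?_ |>.trans' (le_of_eq (eLpNorm_enorm _).symm)
  rw [mul_pow]
  refine le_trans ?_ (mul_le_mul_right (pow_le_pow_left' key 2) _)
  rw [eLpNorm_two_sq, ← lintegral_const_mul]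
  · refine lintegral_mono fun x => ?_
    rw [← mul_pow]
    refine pow_le_pow_left' ((enorm_nonlocal_sub_le hε hg hB hc x).trans ?_) 2
    refine mul_le_mul_right (lintegral_mono fun y => ?_) _
    rw [mul_assoc]
    exact mul_le_mul_right (enorm_secondDiff_le hψ hδ1 hψ2 hg.measurable hK x y) _
  · exact (Measurable.lintegral_prod_right' (f := fun p : Rd d × Rd d => _)
      ((hw.comp measurable_snd).mul hm)).pow_const 2

end

/-! ### The commutator bound of order δ ε^{-2}: comparison of measures and of Gaussians. -/

section

variable {d : ℕ}

/-! ### Scaling of integrals -/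

theorem lintegral_comp_smul {r : ℝ} (hr : 0 < r) {F : Rd d → ℝ≥0∞} (hF : Measurable F) :
    ∫⁻ x, F (r • x) = ENNReal.ofReal ((r ^ d)⁻¹) * ∫⁻ x, F x := by
  have h := Measure.map_addHaar_smul (volume : Measure (Rd d)) hr.ne'
  rw [finrank_euclideanSpace_fin, abs_of_nonneg (by positivity)] at h
  rw [← lintegral_map hF (measurable_const_smul r), h, lintegral_smul_measure]
  rfl

theorem lintegral_rescale {r : ℝ} (hr : 0 < r) {F : Rd d → ℝ≥0∞} (hF : Measurable F) :
    ∫⁻ x, ENNReal.ofReal (r ^ d) * F (r • x) = ∫⁻ x, F x := by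
  rw [lintegral_const_mul _ (by exact hF.comp (measurable_const_smul r)), lintegral_comp_smul hr hF,
    ← mul_assoc, ← ENNReal.ofReal_mul (by positivity), mul_inv_cancel₀ (by positivity),
    ENNReal.ofReal_one, one_mul]

theorem gaussianKernel_eq_rescale {ε : ℝ} (x : Rd d) :
    gaussianKernel ε x = ε⁻¹ ^ d * gaussianKernel 1 (ε⁻¹ • x) := by
  simp [gaussianKernel]

theorem lintegral_enorm_gaussianKernel {ε : ℝ} (hε : 0 < ε) :
    ∫⁻ x : Rd d, ‖gaussianKernel ε x‖ₑ = ∫⁻ x : Rd d, ‖gaussianKernel 1 x‖ₑ := by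
  rw [← lintegral_rescale (inv_pos.2 hε) (continuous_gaussianKernel 1).measurable.enorm]
  congr 1; ext x
  rw [gaussianKernel_eq_rescale, enorm_mul, Real.enorm_of_nonneg (by positivity)]

theorem lintegral_enorm_gaussianKernel_mul_sq {ε : ℝ} (hε : 0 < ε) :
    ∫⁻ x : Rd d, ‖gaussianKernel ε x‖ₑ * ‖x‖ₑ ^ 2 =
      ENNReal.ofReal (ε ^ 2) * ∫⁻ x : Rd d, ‖gaussianKernel 1 x‖ₑ * ‖x‖ₑ ^ 2 := by
  have hm : Measurable fun x : Rd d => ‖gaussianKernel 1 x‖ₑ * ‖x‖ₑ ^ 2 :=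
    (continuous_gaussianKernel 1).measurable.enorm.mul (measurable_enorm.pow_const 2)
  rw [← lintegral_rescale (inv_pos.2 hε) hm, ← lintegral_const_mul']
  · congr 1; ext x
    rw [gaussianKernel_eq_rescale, enorm_mul,
      Real.enorm_of_nonneg (r := ε⁻¹ ^ d) (by positivity), enorm_smul,
      Real.enorm_of_nonneg (r := ε⁻¹) (by positivity), mul_pow, ← ENNReal.ofReal_pow (by positivity)]
    have : ENNReal.ofReal (ε ^ 2) * ENNReal.ofReal (ε⁻¹ ^ 2) = 1 := by
      rw [← ENNReal.ofReal_mul (by positivity), ← mul_pow, mul_inv_cancel₀ hε.ne']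
      simp
    calc _ = ENNReal.ofReal (ε⁻¹ ^ d) * ‖gaussianKernel 1 (ε⁻¹ • x)‖ₑ * ‖x‖ₑ ^ 2 * 1 := by ring
      _ = _ := by rw [← this]; ring
  · exact ENNReal.ofReal_ne_top

/-- A polynomially weighted Gaussian. -/
def gaussianMoment (x : Rd d) : ℝ :=
  (4 * Real.pi) ^ (-(d : ℝ) / 2) * (‖x‖ ^ 2 * Real.exp (-‖x‖ ^ 2 / 16))

theorem continuous_gaussianMoment : Continuous (gaussianMoment : Rd d → ℝ) := by
  unfold gaussianMoment; fun_prop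

theorem gaussianMoment_nonneg (x : Rd d) : 0 ≤ gaussianMoment x := by
  unfold gaussianMoment; positivity

theorem integrable_gaussianMoment : Integrable (gaussianMoment : Rd d → ℝ) := by
  have h := ((integrable_exp_neg_mul_norm_sq (d := d) (b := 32⁻¹) (by norm_num)).const_mul
    32).const_mul ((4 * Real.pi) ^ (-(d : ℝ) / 2))
  refine h.mono continuous_gaussianMoment.aestronglyMeasurable (.of_forall fun x => ?_)
  rw [Real.norm_of_nonneg (gaussianMoment_nonneg x), Real.norm_of_nonneg (by positivity)]
  unfold gaussianMoment
  refine mul_le_mul_of_nonneg_left ?_ (by positivity)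
  -- Half of the decay exp(-‖x‖²/16) is spent on the factor ‖x‖².
  have h1 : ‖x‖ ^ 2 / 32 ≤ Real.exp (‖x‖ ^ 2 / 32) := by
    have := Real.add_one_le_exp (‖x‖ ^ 2 / 32); linarith
  have h2 : Real.exp (-32⁻¹ * ‖x‖ ^ 2) = Real.exp (‖x‖ ^ 2 / 32) * Real.exp (-‖x‖ ^ 2 / 16) := by
    rw [← Real.exp_add]; congr 1; ring
  rw [h2, ← mul_assoc]
  gcongr
  linarith

theorem lintegral_gaussianMoment_lt_top :
    ∫⁻ x : Rd d, ENNReal.ofReal (gaussianMoment x) < ⊤ := by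
  have := (integrable_gaussianMoment (d := d)).hasFiniteIntegral
  simpa only [HasFiniteIntegral, Real.enorm_of_nonneg (gaussianMoment_nonneg _)] using this

theorem lintegral_enorm_gaussianKernel_lt_top :
    ∫⁻ x : Rd d, ‖gaussianKernel 1 x‖ₑ < ⊤ :=
  (integrable_gaussianKernel one_pos).hasFiniteIntegral

theorem lintegral_enorm_gaussianKernel_mul_sq_lt_top :
    ∫⁻ x : Rd d, ‖gaussianKernel 1 x‖ₑ * ‖x‖ₑ ^ 2 < ⊤ := by
  refine lt_of_le_of_lt (lintegral_mono fun x => ?_) lintegral_gaussianMoment_lt_top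
  rw [Real.enorm_of_nonneg (gaussianKernel_nonneg one_pos x), ← ofReal_norm x,
    ← ENNReal.ofReal_pow (norm_nonneg _), ← ENNReal.ofReal_mul (gaussianKernel_nonneg one_pos x)]
  refine ENNReal.ofReal_le_ofReal ?_
  simp only [gaussianKernel, gaussianMoment, one_pow, inv_one, one_mul, one_smul]
  rw [mul_assoc, mul_comm (Real.exp _)]
  have : Real.exp (-‖x‖ ^ 2 / 4) ≤ Real.exp (-‖x‖ ^ 2 / 16) :=
    Real.exp_le_exp.2 (by nlinarith [sq_nonneg ‖x‖])
  gcongr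

theorem abs_exp_neg_sub_exp_neg_le {a b m : ℝ} (ha : m ≤ a) (hb : m ≤ b) :
    |Real.exp (-a) - Real.exp (-b)| ≤ |a - b| * Real.exp (-m) := by
  wlog h : a ≤ b generalizing a b
  · rw [abs_sub_comm, abs_sub_comm a]; exact this hb ha (le_of_not_ge h)
  have h1 : Real.exp (-b) ≤ Real.exp (-a) := by gcongr
  rw [abs_of_nonneg (by linarith), abs_of_nonpos (by linarith)]
  have h2 : Real.exp (-b) = Real.exp (-a) * Real.exp (-(b - a)) := by
    rw [← Real.exp_add]; congr 1; ring
  have h3 := Real.add_one_le_exp (-(b - a))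
  have h4 : Real.exp (-a) ≤ Real.exp (-m) := by gcongr
  rw [h2]
  nlinarith [Real.exp_pos (-a)]

/-- As δ ≤ 1/2 forces ‖X‖ ≥ ‖Y‖/2, both exponents are at least ‖Y‖²/16, hence the weaker Gaussian on
the right. The exponents differ by at most δ‖Y‖². -/
theorem abs_gaussian_sub_le {X Y : Rd d} {δ : ℝ} (hδ0 : 0 ≤ δ) (hδ1 : δ ≤ 1 / 2)
    (h : ‖X - Y‖ ≤ δ * ‖Y‖) :
    |Real.exp (-‖X‖ ^ 2 / 4) - Real.exp (-‖Y‖ ^ 2 / 4)| ≤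
      δ * (‖Y‖ ^ 2 * Real.exp (-‖Y‖ ^ 2 / 16)) := by
  have h1 : ‖Y‖ - ‖X‖ ≤ δ * ‖Y‖ := by
    have := norm_sub_norm_le Y X
    rw [norm_sub_rev] at this; linarith
  have h2 : ‖X‖ - ‖Y‖ ≤ δ * ‖Y‖ := (norm_sub_norm_le X Y).trans h
  have hX : ‖Y‖ / 2 ≤ ‖X‖ := by nlinarith [norm_nonneg Y]
  have h3 := abs_exp_neg_sub_exp_neg_le (a := ‖X‖ ^ 2 / 4) (b := ‖Y‖ ^ 2 / 4) (m := ‖Y‖ ^ 2 / 16)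
    (by nlinarith [norm_nonneg Y, norm_nonneg X]) (by nlinarith [norm_nonneg Y])
  have h4 : |‖X‖ ^ 2 / 4 - ‖Y‖ ^ 2 / 4| ≤ δ * ‖Y‖ ^ 2 := by
    have h5 : |‖X‖ - ‖Y‖| ≤ δ * ‖Y‖ := abs_le.2 ⟨by linarith, by linarith⟩
    have h6 : ‖X‖ ^ 2 / 4 - ‖Y‖ ^ 2 / 4 = (‖X‖ - ‖Y‖) * ((‖X‖ + ‖Y‖) / 4) := by ring
    rw [h6, abs_mul, abs_of_nonneg (a := (‖X‖ + ‖Y‖) / 4) (by positivity)]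
    calc _ ≤ (δ * ‖Y‖) * ‖Y‖ := by
          gcongr
          nlinarith [norm_nonneg Y]
      _ = _ := by ring
  simp only [neg_div]
  calc _ ≤ _ := h3
    _ ≤ δ * ‖Y‖ ^ 2 * Real.exp (-(‖Y‖ ^ 2 / 16)) := by gcongr
    _ = _ := by ring

theorem enorm_gaussianKernel_sub_le {ε : ℝ} (hε : 0 < ε) {X Y : Rd d} {δ : ℝ} (hδ0 : 0 ≤ δ)
    (hδ1 : δ ≤ 1 / 2) (h : ‖X - Y‖ ≤ δ * ‖Y‖) :
    ‖gaussianKernel ε X - gaussianKernel ε Y‖ₑ ≤ ENNReal.ofReal δ *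
      (ENNReal.ofReal (ε⁻¹ ^ d) * ENNReal.ofReal (gaussianMoment (ε⁻¹ • Y))) := by
  rw [← ENNReal.ofReal_mul (by positivity), ← ENNReal.ofReal_mul hδ0, ← ofReal_norm]
  refine ENNReal.ofReal_le_ofReal ?_
  have h1 : ‖ε⁻¹ • X - ε⁻¹ • Y‖ ≤ δ * ‖ε⁻¹ • Y‖ := by
    rw [← smul_sub, norm_smul, norm_smul, Real.norm_of_nonneg (by positivity)]
    calc _ ≤ ε⁻¹ * (δ * ‖Y‖) := by gcongr
      _ = _ := by ring
  have h2 := abs_gaussian_sub_le hδ0 hδ1 h1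
  simp only [gaussianKernel, gaussianMoment]
  rw [← mul_sub, ← mul_sub, norm_mul, norm_mul, Real.norm_eq_abs (Real.exp _ - _),
    Real.norm_of_nonneg (by positivity), Real.norm_of_nonneg (by positivity), ← inv_pow]
  calc _ ≤ ε⁻¹ ^ d * ((4 * Real.pi) ^ (-(d : ℝ) / 2) *
        (δ * (‖ε⁻¹ • Y‖ ^ 2 * Real.exp (-‖ε⁻¹ • Y‖ ^ 2 / 16)))) := by gcongr
    _ = _ := by ring

/-! ### Comparison of nearby measures -/

/-- The two-sided comparison puts the density of ν with respect to μ between (1 + κ)⁻¹ and 1 + κ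
almost everywhere, so within κ of 1. -/
theorem enorm_integral_sub_integral_le {α : Type*} [MeasurableSpace α] {μ ν : Measure α}
    [SigmaFinite μ] [SigmaFinite ν] {κ : ℝ} (hκ : 0 ≤ κ) (h1 : ν ≤ ENNReal.ofReal (1 + κ) • μ)
    (h2 : μ ≤ ENNReal.ofReal (1 + κ) • ν) {h : α → ℂ} (hi : Integrable h μ) :
    ‖(∫ x, h x ∂μ) - ∫ x, h x ∂ν‖ₑ ≤ ENNReal.ofReal κ * ∫⁻ x, ‖h x‖ₑ ∂μ := by
  have hac : ν ≪ μ := Measure.absolutelyContinuous_of_le_smul h1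
  have hρ := Measure.withDensity_rnDeriv_eq ν μ hac
  have hm := Measure.measurable_rnDeriv ν μ
  have b1 : ν.rnDeriv μ ≤ᵐ[μ] fun _ => ENNReal.ofReal (1 + κ) := by
    refine ae_le_of_forall_setLIntegral_le_of_sigmaFinite hm fun s hs _ => ?_
    rw [← withDensity_apply _ hs, hρ, setLIntegral_const]
    exact h1 s
  have b2 : (fun _ => 1) ≤ᵐ[μ] fun x => ENNReal.ofReal (1 + κ) * ν.rnDeriv μ x := by
    refine ae_le_of_forall_setLIntegral_le_of_sigmaFinite measurable_const fun s hs _ => ?_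
    rw [lintegral_const_mul _ hm, ← withDensity_apply (ν.rnDeriv μ) hs, hρ, setLIntegral_const, one_mul]
    exact h2 s
  have b3 : ∀ᵐ x ∂μ, |1 - (ν.rnDeriv μ x).toReal| ≤ κ := by
    filter_upwards [b1, b2] with x hx1 hx2
    have hf : ν.rnDeriv μ x ≠ ⊤ := ne_top_of_le_ne_top ENNReal.ofReal_ne_top hx1
    have c1 := ENNReal.toReal_mono ENNReal.ofReal_ne_top hx1
    have c2 := ENNReal.toReal_mono (by finiteness) hx2
    rw [ENNReal.toReal_ofReal (by linarith)] at c1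
    rw [ENNReal.toReal_mul, ENNReal.toReal_ofReal (by linarith), ENNReal.toReal_one] at c2
    rw [abs_le]
    refine ⟨by linarith, ?_⟩
    nlinarith [ENNReal.toReal_nonneg (a := ν.rnDeriv μ x), mul_nonneg hκ hκ]
  have i2 : Integrable (fun x => (ν.rnDeriv μ x).toReal • h x) μ := by
    refine hi.bdd_smul (1 + κ) hm.ennreal_toReal.aestronglyMeasurable ?_
    filter_upwards [b3] with x hx
    rw [Real.norm_of_nonneg ENNReal.toReal_nonneg]
    linarith [(abs_le.1 hx).1]
  rw [← integral_rnDeriv_smul hac, ← integral_sub hi i2, ← lintegral_const_mul' _ _ (by finiteness)]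
  refine (enorm_integral_le_lintegral_enorm _).trans (lintegral_mono_ae ?_)
  filter_upwards [b3] with x hx
  have : h x - (ν.rnDeriv μ x).toReal • h x = (1 - (ν.rnDeriv μ x).toReal) • h x := by
    rw [sub_smul, one_smul]
  rw [this, enorm_smul, ← ofReal_norm (1 - _), Real.norm_eq_abs]
  gcongr

/-- A convex function lies below its chord on [0, 1]. A bound linear in x is needed to see that the
measures differ by O(δ). -/
theorem one_add_pow_le (n : ℕ) {x : ℝ} (h0 : 0 ≤ x) (h1 : x ≤ 1) :
    (1 + x) ^ n ≤ 1 + (2 ^ n - 1) * x := by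
  induction n with
  | zero => simp
  | succ n ih =>
    have h2 : (1 : ℝ) ≤ 2 ^ n := one_le_pow₀ one_le_two
    calc (1 + x) ^ (n + 1) = (1 + x) ^ n * (1 + x) := pow_succ _ _
      _ ≤ (1 + (2 ^ n - 1) * x) * (1 + x) := by gcongr
      _ ≤ _ := by
        rw [pow_succ]
        nlinarith [mul_nonneg (mul_nonneg (sub_nonneg.2 h2) h0) (sub_nonneg.2 h1)]

variable {ψ : Rd d → Rd d} {δ : ℝ}

theorem IsNearId.map_le (hψ : IsNearId δ ψ) (hδ0 : 0 ≤ δ) (hδ1 : δ ≤ 1 / 2) :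
    volume.map ψ ≤ ENNReal.ofReal (1 + 2 ^ (d + 1) * δ) • (volume : Measure (Rd d)) := by
  refine (map_le_of_antilipschitz (hψ.antilipschitzWith (by linarith))
    hψ.continuous.measurable).trans ?_
  gcongr
  rw [ENNReal.ofNNReal_toNNReal, ← ENNReal.ofReal_pow (inv_nonneg.2 (by linarith))]
  refine ENNReal.ofReal_le_ofReal ?_
  have h1 : (1 - δ)⁻¹ ≤ 1 + 2 * δ := by
    rw [inv_le_iff_one_le_mul₀ (by linarith)]; nlinarith
  calc (1 - δ)⁻¹ ^ d ≤ (1 + 2 * δ) ^ d :=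
        pow_le_pow_left₀ (inv_nonneg.2 (by linarith)) h1 _
    _ ≤ 1 + (2 ^ d - 1) * (2 * δ) := one_add_pow_le d (by linarith) (by linarith)
    _ ≤ _ := by rw [pow_succ]; nlinarith

theorem IsNearId.le_map (hψ : IsNearId δ ψ) (hδ0 : 0 ≤ δ) (hδ1 : δ ≤ 1 / 2) :
    (volume : Measure (Rd d)) ≤ ENNReal.ofReal (1 + 2 ^ (d + 1) * δ) • volume.map ψ := by
  refine (le_map_of_lipschitz hψ.lipschitzWith (hψ.surjective hδ0 (by linarith))).trans ?_
  gcongr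
  rw [ENNReal.ofNNReal_toNNReal, ← ENNReal.ofReal_pow (by linarith)]
  refine ENNReal.ofReal_le_ofReal ?_
  calc (1 + δ) ^ d ≤ 1 + (2 ^ d - 1) * δ := one_add_pow_le d hδ0 (by linarith)
    _ ≤ _ := by
      have : (0 : ℝ) < 2 ^ d := by positivity
      rw [pow_succ]; nlinarith

/-! ### The commutator at high frequencies -/

/-- Insert the intermediate term ∫ φ_ε(ψx - ψw) g(ψw) dw. It differs from (φ_ε * g)(ψx) only in the
measure, Lebesgue against its image under ψ, and from (φ_ε * (g ∘ ψ))(x) only in the argument of the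
Gaussian. -/
theorem enorm_nonlocal_sub_le_high {ε : ℝ} (hε : 0 < ε) (hψ : IsNearId δ ψ) (hδ0 : 0 ≤ δ)
    (hδ1 : δ ≤ 1 / 2) {g : Rd d → ℂ} (hg : Continuous g) {B : ℝ} (hB : ∀ x, ‖g x‖ ≤ B) (x : Rd d) :
    ‖nonlocal ε g (ψ x) - nonlocal ε (g ∘ ψ) x‖ₑ ≤ ENNReal.ofReal (ε ^ 2)⁻¹ *
      (ENNReal.ofReal (2 ^ (d + 1) * δ) *
          lconv (fun y => ‖gaussianKernel ε y‖ₑ) (fun z => ‖g z‖ₑ) (ψ x) +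
        ENNReal.ofReal δ * lconv (fun y => ENNReal.ofReal (ε⁻¹ ^ d) *
          ENNReal.ofReal (gaussianMoment (ε⁻¹ • y))) ((fun z => ‖g z‖ₑ) ∘ ψ) x) := by
  have hc := hψ.continuous
  have hφ := continuous_gaussianKernel (d := d) ε
  have hi : ∀ (a : Rd d) (r : Rd d → Rd d), Continuous r →
      Integrable fun y => gaussianKernel ε (a - y) • g (r y) := fun a r hr =>
    ((integrable_gaussianKernel hε).comp_sub_left a).smul_bdd B
      (hg.comp hr).aestronglyMeasurable (.of_forall fun y => hB _)
  have i1 := hi (ψ x) id continuous_id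
  have i2 := hi x ψ hc
  -- The Radon-Nikodym comparison needs σ-finiteness of the image measure; ψ is a closed embedding,
  -- being Lipschitz and antilipschitz.
  have hsf : SigmaFinite (volume.map ψ) :=
    (hψ.antilipschitzWith (by linarith)).isClosedEmbedding
      hψ.lipschitzWith.uniformContinuous |>.measurableEmbedding.sigmaFinite_map
  have e1 : ∫ w, gaussianKernel ε (ψ x - ψ w) • g (ψ w) =
      ∫ z, gaussianKernel ε (ψ x - z) • g z ∂(volume.map ψ) := by
    rw [integral_map hc.aemeasurable]
    exact ((hφ.comp (by fun_prop)).smul hg).aestronglyMeasurable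
  have i3 : Integrable fun w => gaussianKernel ε (ψ x - ψ w) • g (ψ w) := by
    have h := (i1.smul_measure (c := ENNReal.ofReal (1 + 2 ^ (d + 1) * δ)) (by finiteness)).mono_measure
      (hψ.map_le hδ0 hδ1)
    exact h.comp_aemeasurable hc.aemeasurable
  have e : nonlocal ε g (ψ x) - nonlocal ε (g ∘ ψ) x = (ε ^ 2)⁻¹ •
      (((∫ z, gaussianKernel ε (ψ x - z) • g z) -
        ∫ z, gaussianKernel ε (ψ x - z) • g z ∂(volume.map ψ)) +
      ∫ w, (gaussianKernel ε (ψ x - ψ w) - gaussianKernel ε (x - w)) • g (ψ w)) := by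
    simp only [sub_smul]
    rw [integral_sub i3 i2, e1]
    have c1 : ∀ (a : Rd d) (r : Rd d → ℂ), ∫ y, gaussianKernel ε y • r (a - y) =
        ∫ y, gaussianKernel ε (a - y) • r y := fun a r => by
      rw [← integral_sub_left_eq_self _ volume a]
      simp
    simp only [nonlocal, convolution_def, ContinuousLinearMap.lsmul_apply]
    rw [c1, c1]
    simp only [Function.comp_apply, Complex.real_smul]
    ring
  rw [e, enorm_smul, Real.enorm_of_nonneg (by positivity)]
  refine mul_le_mul_right ((enorm_add_le _ _).trans (add_le_add ?_ ?_)) _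
  · refine (enorm_integral_sub_integral_le (by positivity) (hψ.map_le hδ0 hδ1)
      (hψ.le_map hδ0 hδ1) i1).trans (le_of_eq ?_)
    simp only [enorm_smul, lconv]
    rfl
  · refine (enorm_integral_le_lintegral_enorm _).trans ?_
    rw [lconv, ← lintegral_const_mul' _ _ (by finiteness)]
    refine lintegral_mono fun w => ?_
    rw [enorm_smul, ← mul_assoc]
    exact mul_le_mul_left (enorm_gaussianKernel_sub_le hε hδ0 hδ1 (hψ x w)) _

theorem eLpNorm_nonlocal_sub_le_high {ε : ℝ} (hε : 0 < ε) (hψ : IsNearId δ ψ) (hδ0 : 0 ≤ δ)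
    (hδ1 : δ ≤ 1 / 2) {g : Rd d → ℂ} (hg : Continuous g) {B : ℝ} (hB : ∀ x, ‖g x‖ ≤ B) :
    eLpNorm (fun x => nonlocal ε g (ψ x) - nonlocal ε (g ∘ ψ) x) 2 volume ≤
      ENNReal.ofReal (ε ^ 2)⁻¹ * (ENNReal.ofReal δ * (2 ^ d * (2 ^ (d + 1) *
        (∫⁻ y : Rd d, ‖gaussianKernel 1 y‖ₑ) + ∫⁻ y : Rd d, ENNReal.ofReal (gaussianMoment y)) *
          eLpNorm g 2 volume)) := by
  have hψ' := hψ.mono hδ1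
  have hc := hψ.continuous
  have hγ : Measurable fun z => ‖g z‖ₑ := hg.measurable.enorm
  have mφ : Measurable fun y : Rd d => ‖gaussianKernel ε y‖ₑ :=
    (continuous_gaussianKernel ε).measurable.enorm
  have mm : Measurable fun y : Rd d => ENNReal.ofReal (gaussianMoment y) :=
    continuous_gaussianMoment.measurable.ennreal_ofReal
  have mκ : Measurable fun y : Rd d => ENNReal.ofReal (ε⁻¹ ^ d) *
      ENNReal.ofReal (gaussianMoment (ε⁻¹ • y)) :=
    (mm.comp (measurable_const_smul ε⁻¹)).const_mul _
  have g1 := measurable_lconv mφ hγ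
  have g2 := measurable_lconv mκ (hγ.comp hc.measurable)
  have n1 := (hψ'.eLpNorm_comp_le g1).trans (mul_le_mul_right (eLpNorm_lconv_le mφ hγ) _)
  have n2 := (eLpNorm_lconv_le mκ (hγ.comp hc.measurable)).trans
    (mul_le_mul_right (hψ'.eLpNorm_comp_le hγ) _)
  rw [lintegral_enorm_gaussianKernel hε, eLpNorm_enorm] at n1
  rw [lintegral_rescale (inv_pos.2 hε) mm, eLpNorm_enorm] at n2
  have hsmul : ∀ (c : ℝ≥0∞) {F : Rd d → ℝ≥0∞}, Measurable F →
      eLpNorm (fun x => c * F x) 2 volume ≤ c * eLpNorm F 2 volume := fun c F hF => by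
    refine eLpNorm_two_le_of_sq ?_
    simp only [mul_pow]
    rw [eLpNorm_two_sq, lintegral_const_mul _ (hF.pow_const 2)]
  have g1' := g1.comp hc.measurable
  rw [← eLpNorm_enorm]
  refine (eLpNorm_mono_enorm (g := fun x => ENNReal.ofReal (ε ^ 2)⁻¹ *
      (ENNReal.ofReal (2 ^ (d + 1) * δ) *
          lconv (fun y => ‖gaussianKernel ε y‖ₑ) (fun z => ‖g z‖ₑ) (ψ x) +
        ENNReal.ofReal δ * lconv (fun y => ENNReal.ofReal (ε⁻¹ ^ d) *
          ENNReal.ofReal (gaussianMoment (ε⁻¹ • y))) ((fun z => ‖g z‖ₑ) ∘ ψ) x))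
    (fun x => by
      simpa only [enorm_eq_self, enorm_enorm] using
        enorm_nonlocal_sub_le_high hε hψ hδ0 hδ1 hg hB x)).trans ?_
  refine (hsmul _ ((g1'.const_mul _).add (g2.const_mul _))).trans (mul_le_mul_right ?_ _)
  refine (eLpNorm_add_le (g1'.const_mul _).aestronglyMeasurable
    (g2.const_mul _).aestronglyMeasurable one_le_two).trans ?_
  refine (add_le_add ((hsmul _ g1').trans (mul_le_mul_right n1 _))
    ((hsmul _ g2).trans (mul_le_mul_right n2 _))).trans (le_of_eq ?_)
  rw [ENNReal.ofReal_mul (by positivity), ENNReal.ofReal_pow (by positivity), ENNReal.ofReal_ofNat]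
  ring

end

/-! ### From gradient bounds on the velocity to bounds on the truncated field and its flow. -/

section

variable {d : ℕ}

/-! ### Regularity of the truncated velocity field -/

/-- A bounded function is determined by its distribution, so the infimum runs over at most one
element and is attained when finite. -/
theorem exists_toTemperedDistribution_eq {u : 𝓢'(Rd d, ℂ)} (hu : distLinftyNorm u < ⊤) :
    ∃ g : Lp ℂ ⊤ (volume : Measure (Rd d)), Lp.toTemperedDistribution g = u ∧
      ‖g‖ₑ = distLinftyNorm u := by
  obtain ⟨g, hg⟩ := iInf_lt_iff.1 hu
  obtain ⟨h, -⟩ := iInf_lt_iff.1 hg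
  refine ⟨g, h, le_antisymm (le_iInf₂ fun g' h' => ?_) (iInf₂_le g h)⟩
  have hinj := LinearMap.ker_eq_bot.1 (Lp.ker_toTemperedDistributionCLM_eq_bot (F := ℂ)
    (μ := (volume : Measure (Rd d))) (p := ⊤))
  rw [hinj (a₁ := g) (a₂ := g') (h.trans h'.symm)]

/-- The `L¹` norm of a Schwartz function. -/
def normOne (k : 𝓢(Rd d, ℂ)) : ℝ := ∫ y, ‖k y‖

theorem normOne_nonneg (k : 𝓢(Rd d, ℂ)) : 0 ≤ normOne k := integral_nonneg fun _ => norm_nonneg _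

theorem norm_conv_le_of_linfty {u : 𝓢'(Rd d, ℂ)} (hu : distLinftyNorm u < ⊤) (k : 𝓢(Rd d, ℂ))
    (x : Rd d) : ‖conv k u x‖ ≤ (distLinftyNorm u).toReal * normOne k := by
  obtain ⟨g, hg, hn⟩ := exists_toTemperedDistribution_eq hu
  have h0 : normOne k = ∫ y, ‖k (x - y)‖ :=
    (integral_sub_left_eq_self (fun y => ‖k y‖) volume x).symm
  have h1 : conv k u x = ∫ y, reflectAt k x y • g y := by
    rw [conv, ← hg]
    exact Lp.toTemperedDistribution_apply (μ := (volume : Measure (Rd d))) g _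
  rw [h1, ← hn, toReal_enorm, h0, ← integral_const_mul]
  refine norm_integral_le_of_norm_le ?_ ?_
  · exact ((k.integrable.norm).comp_sub_left x).const_mul _
  · have h : ∀ᵐ y, ‖g y‖ ≤ ‖g‖ := by
      have := ae_le_eLpNormEssSup (f := g) (μ := (volume : Measure (Rd d)))
      filter_upwards [this] with y hy
      rw [← eLpNorm_exponent_top, ← Lp.enorm_def] at hy
      simpa [← ofReal_norm] using hy
    filter_upwards [h] with y hy
    rw [norm_smul, reflectAt_apply, mul_comm]
    gcongr

theorem lineDeriv_eq_sum (k : 𝓢(Rd d, ℂ)) (e : Rd d) :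
    ∂_{e} k = ∑ i, ((e i : ℝ) : ℂ) • ∂_{(EuclideanSpace.single i (1 : ℝ) : Rd d)} k := by
  ext y
  have he : e = ∑ i, e i • (EuclideanSpace.single i (1 : ℝ) : Rd d) := by
    ext j
    simp [Finset.sum_apply, Pi.single_apply]
  rw [_root_.sum_apply]
  simp only [_root_.smul_apply, SchwartzMap.lineDerivOp_apply_eq_fderiv]
  conv_lhs => rw [he]
  simp [map_sum]

theorem conv_sum_smul {ι : Type*} (s : Finset ι) (c : ι → ℂ) (k : ι → 𝓢(Rd d, ℂ))
    (u : 𝓢'(Rd d, ℂ)) (x : Rd d) :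
    conv (∑ i ∈ s, c i • k i) u x = ∑ i ∈ s, c i * conv (k i) u x := by
  simp [conv, reflectAt, map_sum, map_smul]

/-- All the first order derivatives of `u` are bounded by `a`. -/
def GradLe (u : 𝓢'(Rd d, ℂ)) (a : ℝ) : Prop :=
  ∀ i : Fin d, distLinftyNorm (∂_{(EuclideanSpace.single i (1 : ℝ) : Rd d)} u) < ⊤ ∧
    (distLinftyNorm (∂_{(EuclideanSpace.single i (1 : ℝ) : Rd d)} u)).toReal ≤ a

variable {u : 𝓢'(Rd d, ℂ)} {a : ℝ}

/-- The derivative is moved from the kernel to `u`, so only ∇u has to be bounded. The factor d comes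
from summing over coordinate directions. -/
theorem GradLe.norm_conv_lineDeriv_le (hu : GradLe u a) (k : 𝓢(Rd d, ℂ)) (e x : Rd d) :
    ‖conv (∂_{e} k) u x‖ ≤ d * (a * normOne k) * ‖e‖ := by
  rw [lineDeriv_eq_sum, conv_sum_smul]
  refine (norm_sum_le _ _).trans ?_
  calc _ ≤ ∑ _i : Fin d, ‖e‖ * (a * normOne k) := by
        refine Finset.sum_le_sum fun i _ => ?_
        rw [norm_mul, Complex.norm_real, ← conv_lineDeriv]
        refine mul_le_mul (PiLp.norm_apply_le e i) ?_ (norm_nonneg _) (norm_nonneg _)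
        refine (norm_conv_le_of_linfty (hu i).1 k x).trans ?_
        exact mul_le_mul_of_nonneg_right (hu i).2 (normOne_nonneg k)
    _ = _ := by simp; ring

theorem GradLe.norm_conv_sub_le (hu : GradLe u a) (k : 𝓢(Rd d, ℂ)) (p q : Rd d) :
    ‖conv k u p - conv k u q‖ ≤ d * (a * normOne k) * ‖p - q‖ := by
  have h := conv_add_sub_conv k u q (p - q)
  rw [add_sub_cancel] at h
  rw [h]
  refine (intervalIntegral.norm_integral_le_of_norm_le_const fun s _ =>
    hu.norm_conv_lineDeriv_le k (p - q) _).trans (by simp)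

/-- The `L¹` norm of the derivative of a Schwartz function. -/
def normOneDeriv (k : 𝓢(Rd d, ℂ)) : ℝ := ∫ y, ‖fderiv ℝ k y‖

theorem integrable_norm_fderiv (k : 𝓢(Rd d, ℂ)) : Integrable fun y => ‖fderiv ℝ k y‖ :=
  (SchwartzMap.fderivCLM ℝ (Rd d) ℂ k).integrable.norm

theorem normOne_lineDeriv_le (k : 𝓢(Rd d, ℂ)) (e : Rd d) :
    normOne (∂_{e} k) ≤ normOneDeriv k * ‖e‖ := by
  rw [normOne, normOneDeriv, ← integral_mul_const]
  refine integral_mono (∂_{e} k).integrable.norm ((integrable_norm_fderiv k).mul_const _)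
    fun y => ?_
  simp only [SchwartzMap.lineDerivOp_apply_eq_fderiv]
  exact (fderiv ℝ k y).le_opNorm e

theorem GradLe.nonneg (hd : 0 < d) (hu : GradLe u a) : 0 ≤ a :=
  ENNReal.toReal_nonneg.trans (hu ⟨0, hd⟩).2

/-- The second difference is an integral of first differences of (∂_e k) * u between points e apart.
One derivative falls on `u`, the other on the kernel, where it costs the L¹ norm of ∇k. -/
theorem GradLe.norm_conv_second_le (hd : 0 < d) (hu : GradLe u a) (k : 𝓢(Rd d, ℂ)) (p e : Rd d) :
    ‖conv k u (p + e) + conv k u (p - e) - 2 * conv k u p‖ ≤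
      d * (a * normOneDeriv k) * ‖e‖ ^ 2 := by
  have ha := hu.nonneg hd
  have h1 := conv_add_sub_conv k u p e
  have h2 := conv_add_sub_conv k u (p - e) e
  rw [sub_add_cancel] at h2
  have hc : ∀ p : Rd d, IntervalIntegrable (fun s : ℝ => conv (∂_{e} k) u (p + s • e)) volume 0 1 :=
    fun p => ((continuous_conv _ u).comp (by fun_prop)).intervalIntegrable _ _
  have h3 : conv k u (p + e) + conv k u (p - e) - 2 * conv k u p =
      ∫ s in (0 : ℝ)..1, (conv (∂_{e} k) u (p + s • e) - conv (∂_{e} k) u (p - e + s • e)) := by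
    rw [intervalIntegral.integral_sub (hc p) (hc (p - e)), ← h1, ← h2]; ring
  rw [h3]
  have h4 : ∀ s : ℝ, ‖conv (∂_{e} k) u (p + s • e) - conv (∂_{e} k) u (p - e + s • e)‖ ≤
      d * (a * normOneDeriv k) * ‖e‖ ^ 2 := fun s => by
    refine (hu.norm_conv_sub_le _ _ _).trans ?_
    have e1 : p + s • e - (p - e + s • e) = e := by abel
    rw [e1]
    calc _ ≤ d * (a * (normOneDeriv k * ‖e‖)) * ‖e‖ := by
          gcongr
          exact normOne_lineDeriv_le k e
      _ = _ := by ring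
  exact (intervalIntegral.norm_integral_le_of_norm_le_const fun s _ => h4 s).trans (by simp)

theorem norm_le_sum_abs (x : Rd d) : ‖x‖ ≤ ∑ i, |x i| := by
  have hx : x = ∑ i, x i • (EuclideanSpace.single i (1 : ℝ) : Rd d) := by
    ext j
    simp [Finset.sum_apply, Pi.single_apply]
  conv_lhs => rw [hx]
  refine (norm_sum_le _ _).trans (Finset.sum_le_sum fun i _ => ?_)
  simp [norm_smul]

/-- The kernel of `Ṡ_l`. -/
def lowKernel (χ : LPCutoff d) (l : ℤ) : 𝓢(Rd d, ℂ) :=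
  𝓕⁻ (symbol χ.toFun χ.smooth χ.hasCompactSupport l)

variable {χ : LPCutoff d} {l : ℤ} {v : ℝ → Fin d → 𝓢'(Rd d, ℂ)} {τ : ℝ}

/-- One factor d comes from the components of the field, the other from the coordinate directions of
differentiation. -/
theorem norm_lowFreqField_sub_le (hv : ∀ i, GradLe (v τ i) a) (p q : Rd d) :
    ‖lowFreqField χ l v τ p - lowFreqField χ l v τ q‖ ≤
      d ^ 2 * normOne (lowKernel χ l) * a * ‖p - q‖ := by
  refine (norm_le_sum_abs _).trans ?_
  calc _ ≤ ∑ _i : Fin d, d * (a * normOne (lowKernel χ l)) * ‖p - q‖ := by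
        refine Finset.sum_le_sum fun i _ => ?_
        refine le_trans ?_ ((hv i).norm_conv_sub_le (lowKernel χ l) p q)
        exact (Complex.abs_re_le_norm _).trans' (by
          simp [lowFreqField, lowFreq, lowKernel])
    _ = _ := by simp; ring

theorem norm_lowFreqField_second_le (hd : 0 < d) (hv : ∀ i, GradLe (v τ i) a) (p e : Rd d) :
    ‖lowFreqField χ l v τ (p + e) + lowFreqField χ l v τ (p - e) -
      (2 : ℝ) • lowFreqField χ l v τ p‖ ≤ d ^ 2 * normOneDeriv (lowKernel χ l) * a * ‖e‖ ^ 2 := by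
  refine (norm_le_sum_abs _).trans ?_
  calc _ ≤ ∑ _i : Fin d, d * (a * normOneDeriv (lowKernel χ l)) * ‖e‖ ^ 2 := by
        refine Finset.sum_le_sum fun i _ => ?_
        refine le_trans ?_ ((hv i).norm_conv_second_le hd (lowKernel χ l) p e)
        exact (Complex.abs_re_le_norm _).trans' (by
          simp [lowFreqField, lowFreq, lowKernel])
    _ = _ := by simp; ring

/-! ### Estimates for the flow -/

/-- Iterating A ↦ a + A/2 from an arbitrary bound B converges to the fixed point 2a. It plays the
part of Grönwall's lemma while asking only for boundedness in time. -/
theorem le_two_mul_of_bootstrap {X : Type*} {s : Set X} {f : X → ℝ} {a B : ℝ} (hB : ∀ x ∈ s, f x ≤ B)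
    (h : ∀ A, (∀ x ∈ s, f x ≤ A) → ∀ x ∈ s, f x ≤ a + A / 2) : ∀ x ∈ s, f x ≤ 2 * a := by
  have h1 : ∀ n : ℕ, ∀ x ∈ s, f x ≤ 2 * a + (B - 2 * a) / 2 ^ n := by
    intro n
    induction n with
    | zero => intro x hx; simpa using hB x hx
    | succ n ih =>
      intro x hx
      refine (h _ ih x hx).trans (le_of_eq ?_)
      rw [pow_succ]; field_simp; ring
  intro x hx
  have h2 : Tendsto (fun n : ℕ => 2 * a + (B - 2 * a) / 2 ^ n) atTop (𝓝 (2 * a + 0)) :=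
    tendsto_const_nhds.add (tendsto_const_nhds.div_atTop (tendsto_pow_atTop_atTop_of_one_lt one_lt_two))
  rw [add_zero] at h2
  exact ge_of_tendsto' h2 fun n => h1 n x hx

/-- The field `w` has Lipschitz constant `L₁ a(τ)` and second differences bounded by `L₂ a(τ)`. -/
structure FieldBounds (w : ℝ → Rd d → Rd d) (a : ℝ → ℝ≥0∞) (t L₁ L₂ : ℝ) : Prop where
  lt_top : ∀ᵐ τ ∂(volume.restrict (Ioc 0 t)), a τ < ⊤
  lipschitz : ∀ᵐ τ ∂(volume.restrict (Ioc 0 t)), ∀ p q,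
    ‖w τ p - w τ q‖ ≤ L₁ * (a τ).toReal * ‖p - q‖
  second : ∀ᵐ τ ∂(volume.restrict (Ioc 0 t)), ∀ p e,
    ‖w τ (p + e) + w τ (p - e) - (2 : ℝ) • w τ p‖ ≤ L₂ * (a τ).toReal * ‖e‖ ^ 2

theorem norm_integral_le_of_le_toReal {a : ℝ → ℝ≥0∞} {t : ℝ} (ha : ∀ᵐ τ ∂(volume.restrict (Ioc 0 t)), a τ < ⊤)
    (hV : ∫⁻ τ in Ioc 0 t, a τ < ⊤) {c : ℝ} (hc : 0 ≤ c) {f : ℝ → Rd d}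
    (hf : ∀ᵐ τ ∂(volume.restrict (Ioc 0 t)), ‖f τ‖ ≤ c * (a τ).toReal) {s : ℝ} (hs : s ∈ Icc 0 t) :
    ‖∫ τ in (0 : ℝ)..s, f τ‖ ≤ c * (∫⁻ τ in Ioc 0 t, a τ).toReal := by
  rw [intervalIntegral.integral_of_le hs.1, ← toReal_enorm]
  have h1 : ‖∫ τ in Ioc 0 s, f τ‖ₑ ≤ ENNReal.ofReal c * ∫⁻ τ in Ioc 0 t, a τ :=
    calc _ ≤ ∫⁻ τ in Ioc 0 s, ‖f τ‖ₑ := enorm_integral_le_lintegral_enorm _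
      _ ≤ ∫⁻ τ in Ioc 0 t, ‖f τ‖ₑ := lintegral_mono_set (Ioc_subset_Ioc_right hs.2)
      _ ≤ ∫⁻ τ in Ioc 0 t, ENNReal.ofReal c * a τ := by
          refine lintegral_mono_ae ?_
          filter_upwards [ha, hf] with τ h1 h2
          rw [← ofReal_norm]
          refine (ENNReal.ofReal_le_ofReal h2).trans ?_
          rw [ENNReal.ofReal_mul hc, ENNReal.ofReal_toReal h1.ne]
      _ = _ := lintegral_const_mul' _ _ ENNReal.ofReal_ne_top
  have h2 := ENNReal.toReal_mono (by finiteness) h1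
  rwa [ENNReal.toReal_mul, ENNReal.toReal_ofReal hc] at h2

variable {w : ℝ → Rd d → Rd d} {ψ : ℝ → Rd d → Rd d} {a : ℝ → ℝ≥0∞} {t L₁ L₂ : ℝ} {I : Set ℝ}

theorem IsFlow.exists_bound (hψ : IsFlow I w ψ) (hI : Icc 0 t ⊆ I) (ht : 0 ≤ t) (x : Rd d) :
    ∃ B, ∀ s ∈ Icc 0 t, ‖ψ s x‖ ≤ B := by
  have hi := (hψ x t (hI ⟨ht, le_rfl⟩)).1
  rw [intervalIntegrable_iff_integrableOn_Ioc_of_le ht] at hi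
  refine ⟨‖x‖ + ∫ τ in Ioc 0 t, ‖w τ (ψ τ x)‖, fun s hs => ?_⟩
  rw [(hψ x s (hI hs)).2, intervalIntegral.integral_of_le hs.1]
  refine (norm_add_le _ _).trans ?_
  gcongr
  refine (norm_integral_le_integral_norm _).trans ?_
  exact setIntegral_mono_set hi.norm (.of_forall fun _ => norm_nonneg _)
    (Ioc_subset_Ioc_right hs.2).eventuallyLE

theorem IsFlow.norm_sub_sub_le (hψ : IsFlow I w ψ) (hI : Icc 0 t ⊆ I) (hL₁ : 0 ≤ L₁)
    (hw : FieldBounds w a t L₁ L₂)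
    (hV : ∫⁻ τ in Ioc 0 t, a τ < ⊤) {x y : Rd d} {A : ℝ} (hA0 : 0 ≤ A)
    (hA : ∀ s ∈ Icc 0 t, ‖ψ s x - ψ s y‖ ≤ A) {s : ℝ} (hs : s ∈ Icc 0 t) :
    ‖ψ s x - ψ s y - (x - y)‖ ≤ L₁ * A * (∫⁻ τ in Ioc 0 t, a τ).toReal := by
  have hx := hψ x s (hI hs)
  have hy := hψ y s (hI hs)
  have e : ψ s x - ψ s y - (x - y) = ∫ τ in (0 : ℝ)..s, (w τ (ψ τ x) - w τ (ψ τ y)) := by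
    rw [intervalIntegral.integral_sub hx.1 hy.1, hx.2, hy.2]; abel
  rw [e]
  refine norm_integral_le_of_le_toReal hw.lt_top hV (by positivity) ?_ hs
  filter_upwards [hw.lipschitz, ae_restrict_mem measurableSet_Ioc] with τ h1 hτ
  calc _ ≤ _ := h1 _ _
    _ ≤ L₁ * (a τ).toReal * A := by
        gcongr; exact hA τ ⟨hτ.1.le, hτ.2⟩
    _ = _ := by ring

theorem IsFlow.norm_flow_sub_le (hψ : IsFlow I w ψ) (hI : Icc 0 t ⊆ I) (ht : 0 ≤ t) (hL₁ : 0 ≤ L₁)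
    (hw : FieldBounds w a t L₁ L₂) (hV : ∫⁻ τ in Ioc 0 t, a τ < ⊤)
    (hsmall : L₁ * (∫⁻ τ in Ioc 0 t, a τ).toReal ≤ 1 / 2) (x y : Rd d) :
    ∀ s ∈ Icc 0 t, ‖ψ s x - ψ s y‖ ≤ 2 * ‖x - y‖ := by
  obtain ⟨B₁, hB₁⟩ := hψ.exists_bound hI ht x
  obtain ⟨B₂, hB₂⟩ := hψ.exists_bound hI ht y
  refine le_two_mul_of_bootstrap (B := B₁ + B₂)
    (fun s hs => (norm_sub_le _ _).trans (add_le_add (hB₁ s hs) (hB₂ s hs))) fun A hA s hs => ?_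
  have hA0 : 0 ≤ A := (norm_nonneg _).trans (hA s hs)
  have h1 := hψ.norm_sub_sub_le hI hL₁ hw hV hA0 hA hs
  have h2 := norm_sub_norm_le (ψ s x - ψ s y) (x - y)
  nlinarith

/-- The flow is a small perturbation of the identity. -/
theorem IsFlow.isNearId (hψ : IsFlow I w ψ) (hI : Icc 0 t ⊆ I) (ht : 0 ≤ t) (hL₁ : 0 ≤ L₁)
    (hw : FieldBounds w a t L₁ L₂) (hV : ∫⁻ τ in Ioc 0 t, a τ < ⊤)
    (hsmall : L₁ * (∫⁻ τ in Ioc 0 t, a τ).toReal ≤ 1 / 2) :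
    IsNearId (2 * L₁ * (∫⁻ τ in Ioc 0 t, a τ).toReal) (ψ t) := by
  intro x y
  refine (hψ.norm_sub_sub_le hI hL₁ hw hV (by positivity)
    (hψ.norm_flow_sub_le hI ht hL₁ hw hV hsmall x y) ⟨ht, le_rfl⟩).trans (le_of_eq ?_)
  ring

/-- Let p, q be the positions of the particles from x ± y and m their midpoint. Then w(p) + w(q) -
2w(ψx) is a second difference of w at m with step at most 2‖y‖, plus 2(w(m) - w(ψx)), where m - ψx
is half the quantity being estimated. Since L₁V ≤ 1/2 the bootstrap closes; the 8 is 4 from (2‖y‖)²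
times 2 from the bootstrap. -/
theorem IsFlow.norm_second_le (hψ : IsFlow I w ψ) (hI : Icc 0 t ⊆ I) (ht : 0 ≤ t) (hL₁ : 0 ≤ L₁)
    (hL₂ : 0 ≤ L₂) (hw : FieldBounds w a t L₁ L₂) (hV : ∫⁻ τ in Ioc 0 t, a τ < ⊤)
    (hsmall : L₁ * (∫⁻ τ in Ioc 0 t, a τ).toReal ≤ 1 / 2) (x y : Rd d) :
    ‖ψ t (x + y) + ψ t (x - y) - (2 : ℝ) • ψ t x‖ ≤
      8 * L₂ * (∫⁻ τ in Ioc 0 t, a τ).toReal * ‖y‖ ^ 2 := by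
  set V := (∫⁻ τ in Ioc 0 t, a τ).toReal with hVdef
  obtain ⟨B₁, hB₁⟩ := hψ.exists_bound hI ht (x + y)
  obtain ⟨B₂, hB₂⟩ := hψ.exists_bound hI ht (x - y)
  obtain ⟨B₃, hB₃⟩ := hψ.exists_bound hI ht x
  have key := le_two_mul_of_bootstrap (s := Icc 0 t)
    (f := fun s => ‖ψ s (x + y) + ψ s (x - y) - (2 : ℝ) • ψ s x‖)
    (a := 4 * L₂ * V * ‖y‖ ^ 2) (B := B₁ + B₂ + 2 * B₃) (fun s hs => by
      refine (norm_sub_le _ _).trans (add_le_add ((norm_add_le _ _).trans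
        (add_le_add (hB₁ s hs) (hB₂ s hs))) ?_)
      rw [norm_smul]
      simpa using hB₃ s hs) (fun A hA s hs => by
      have hA0 : 0 ≤ A := (norm_nonneg _).trans (hA s hs)
      have h1 := hψ (x + y) s (hI hs)
      have h2 := hψ (x - y) s (hI hs)
      have h3 := hψ x s (hI hs)
      have e : ψ s (x + y) + ψ s (x - y) - (2 : ℝ) • ψ s x = ∫ τ in (0 : ℝ)..s,
          (w τ (ψ τ (x + y)) + w τ (ψ τ (x - y)) - (2 : ℝ) • w τ (ψ τ x)) := by
        rw [intervalIntegral.integral_sub (by exact h1.1.add h2.1) (by exact h3.1.smul (2 : ℝ)),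
          intervalIntegral.integral_add h1.1 h2.1, intervalIntegral.integral_smul,
          h1.2, h2.2, h3.2]
        module
      have h4 : ‖ψ s (x + y) + ψ s (x - y) - (2 : ℝ) • ψ s x‖ ≤
          (4 * L₂ * ‖y‖ ^ 2 + L₁ * A) * V := by
        rw [e]
        refine norm_integral_le_of_le_toReal hw.lt_top hV (by positivity) ?_ hs
        filter_upwards [hw.lipschitz, hw.second, ae_restrict_mem measurableSet_Ioc] with τ k1 k2 hτ
        have hτ' : τ ∈ Icc 0 t := ⟨hτ.1.le, hτ.2⟩
        set p := ψ τ (x + y)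
        set q := ψ τ (x - y)
        set m := (1 / 2 : ℝ) • (p + q)
        set e := (1 / 2 : ℝ) • (p - q)
        have e1 : m + e = p := by simp only [m, e]; module
        have e2 : m - e = q := by simp only [m, e]; module
        have d1 := k2 m e
        have d2 := k1 m (ψ τ x)
        rw [e1, e2] at d1
        have d3 : ‖e‖ ≤ 2 * ‖y‖ := by
          have := hψ.norm_flow_sub_le hI ht hL₁ hw hV hsmall (x + y) (x - y) τ hτ'
          have e3 : x + y - (x - y) = (2 : ℝ) • y := by module
          rw [e3, norm_smul] at this
          simp only [e, norm_smul]
          norm_num at this ⊢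
          linarith
        have d4 : ‖m - ψ τ x‖ ≤ A / 2 := by
          have e4 : m - ψ τ x = (1 / 2 : ℝ) • (p + q - (2 : ℝ) • ψ τ x) := by
            simp only [m]; module
          rw [e4, norm_smul]
          have := hA τ hτ'
          norm_num at this ⊢
          linarith
        have e5 : w τ p + w τ q - (2 : ℝ) • w τ (ψ τ x) =
            (w τ p + w τ q - (2 : ℝ) • w τ m) + (2 : ℝ) • (w τ m - w τ (ψ τ x)) := by module
        rw [e5]
        refine (norm_add_le _ _).trans ?_
        rw [norm_smul]
        calc _ ≤ L₂ * (a τ).toReal * (2 * ‖y‖) ^ 2 + ‖(2 : ℝ)‖ * (L₁ * (a τ).toReal * (A / 2)) := by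
              gcongr
              · exact d1.trans (by gcongr)
              · exact d2.trans (by gcongr)
          _ = _ := by norm_num; ring
      have : L₁ * A * V ≤ A / 2 := by nlinarith
      nlinarith) t ⟨ht, le_rfl⟩
  calc _ ≤ _ := key
    _ = _ := by ring

end

/-! ### Scaling of the Littlewood-Paley kernels and reproduction of the blocks. -/

section

variable {d : ℕ}

/-! ### Rescaled kernels -/

theorem symbol_apply {η : Rd d → ℝ} (hη : ContDiff ℝ ∞ η) (hc : HasCompactSupport η) (l : ℤ)
    (ξ : Rd d) : symbol η hη hc l ξ = (η ((2 * Real.pi * (2 : ℝ) ^ (-l)) • ξ) : ℝ) := rfl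

/-- `K` is the rescaled kernel `r^d K₀(r ·)`. -/
def IsRescaled (r : ℝ) (K K₀ : 𝓢(Rd d, ℂ)) : Prop := ∀ x, K x = (r ^ d : ℝ) • K₀ (r • x)

/-- The symbols at different scales are dilates of each other. All norms of kernels thus reduce to
scale 0, with constants depending only on the cut-off. -/
theorem isRescaled_fourierInv_symbol {η : Rd d → ℝ} (hη : ContDiff ℝ ∞ η)
    (hc : HasCompactSupport η) (l : ℤ) :
    IsRescaled ((2 : ℝ) ^ l) (𝓕⁻ (symbol η hη hc l)) (𝓕⁻ (symbol η hη hc 0)) := by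
  intro x
  have hr : (0 : ℝ) < 2 ^ l := by positivity
  rw [SchwartzMap.fourierInv_coe, SchwartzMap.fourierInv_coe, Real.fourierInv_eq,
    Real.fourierInv_eq]
  have h := Measure.integral_comp_smul (volume : Measure (Rd d))
    (fun ξ => Real.fourierChar (inner ℝ ξ x) • symbol η hη hc l ξ) ((2 : ℝ) ^ l)
  rw [finrank_euclideanSpace_fin, abs_of_nonneg (by positivity)] at h
  have e : ∀ ξ : Rd d, Real.fourierChar (inner ℝ ξ ((2 : ℝ) ^ l • x)) • symbol η hη hc 0 ξ =
      Real.fourierChar (inner ℝ ((2 : ℝ) ^ l • ξ) x) • symbol η hη hc l ((2 : ℝ) ^ l • ξ) := by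
    intro ξ
    have e1 : 2 * Real.pi * (2 : ℝ) ^ (-l) * 2 ^ l = 2 * Real.pi * 2 ^ (-(0 : ℤ)) := by
      rw [mul_assoc, ← zpow_add₀ two_ne_zero]; simp
    rw [real_inner_smul_left, real_inner_smul_right, symbol_apply, symbol_apply, smul_smul, e1]
  simp_rw [e]
  rw [h, smul_smul, mul_inv_cancel₀ (by positivity), one_smul]

section

variable {r : ℝ} {K K₀ : 𝓢(Rd d, ℂ)}

theorem IsRescaled.fderiv_eq (h : IsRescaled r K K₀) :
    fderiv ℝ K = fun x => (r ^ d * r) • fderiv ℝ K₀ (r • x) := by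
  have : (K : Rd d → ℂ) = fun x => (r ^ d : ℝ) • K₀ (r • x) := funext h
  ext1 x
  have hd : DifferentiableAt ℝ (fun x => K₀ (r • x)) x :=
    (K₀.differentiableAt).comp x (by fun_prop)
  rw [this, fderiv_fun_const_smul hd, fderiv_comp_smul, smul_smul]

theorem IsRescaled.fderiv_fderiv_eq (h : IsRescaled r K K₀) :
    fderiv ℝ (fderiv ℝ K) = fun x => (r ^ d * r ^ 2) • fderiv ℝ (fderiv ℝ K₀) (r • x) := by
  ext1 x
  have hs : Differentiable ℝ (fderiv ℝ K₀) :=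
    ((K₀.smooth 2).fderiv_right (m := 1) (by norm_num)).differentiable one_ne_zero
  have hd : DifferentiableAt ℝ (fun x => fderiv ℝ K₀ (r • x)) x :=
    (hs _).comp x (by fun_prop)
  rw [h.fderiv_eq, fderiv_fun_const_smul hd, fderiv_comp_smul, smul_smul]
  congr 1; ring

theorem IsRescaled.normOne_eq (h : IsRescaled r K K₀) (hr : 0 < r) : normOne K = normOne K₀ := by
  have h2 := Measure.integral_comp_smul (volume : Measure (Rd d)) (fun x => ‖K₀ x‖) r
  rw [finrank_euclideanSpace_fin, abs_of_nonneg (by positivity)] at h2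
  rw [normOne, normOne]
  simp_rw [h _, norm_smul]
  rw [integral_const_mul, h2, smul_eq_mul, Real.norm_of_nonneg (by positivity), ← mul_assoc,
    mul_inv_cancel₀ (by positivity), one_mul]

theorem IsRescaled.normOneDeriv_eq (h : IsRescaled r K K₀) (hr : 0 < r) :
    normOneDeriv K = r * normOneDeriv K₀ := by
  have h2 := Measure.integral_comp_smul (volume : Measure (Rd d)) (fun x => ‖fderiv ℝ K₀ x‖) r
  rw [finrank_euclideanSpace_fin, abs_of_nonneg (by positivity)] at h2
  rw [normOneDeriv, normOneDeriv, h.fderiv_eq]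
  simp_rw [norm_smul]
  rw [integral_const_mul, h2, smul_eq_mul, Real.norm_of_nonneg (by positivity)]
  field_simp

theorem IsRescaled.lintegral_derivSize (h : IsRescaled r K K₀) (hr : 0 < r) :
    ∫⁻ x, derivSize K x = ENNReal.ofReal r * ∫⁻ x, derivSize K₀ x := by
  rw [← lintegral_rescale hr (measurable_derivSize K₀),
    ← lintegral_const_mul' _ _ ENNReal.ofReal_ne_top]
  congr 1; ext x
  rw [derivSize, h.fderiv_eq, derivSize, enorm_smul, Real.enorm_of_nonneg (by positivity),
    ENNReal.ofReal_mul (by positivity)]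
  ring

theorem IsRescaled.lintegral_derivTwoSize (h : IsRescaled r K K₀) (hr : 0 < r) :
    ∫⁻ x, derivTwoSize K x = ENNReal.ofReal (r ^ 2) * ∫⁻ x, derivTwoSize K₀ x := by
  rw [← lintegral_rescale hr (measurable_derivTwoSize K₀),
    ← lintegral_const_mul' _ _ ENNReal.ofReal_ne_top]
  congr 1; ext x
  have hn : ∀ (c : ℝ) (L : Rd d →L[ℝ] Rd d →L[ℝ] ℂ), ‖c • L‖ₑ = ENNReal.ofReal ‖c‖ * ‖L‖ₑ :=
    fun c L => calc
      ‖c • L‖ₑ = ENNReal.ofReal ‖c • L‖ := (ofReal_norm _).symm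
      _ = ENNReal.ofReal (‖c‖ * ‖L‖) :=
        congrArg _ (@norm_smul _ _ _ _ _ NormedSpace.toNormSMulClass c L)
      _ = ENNReal.ofReal ‖c‖ * ENNReal.ofReal ‖L‖ := ENNReal.ofReal_mul (norm_nonneg _)
      _ = _ := congrArg _ (ofReal_norm L)
  rw [derivTwoSize, h.fderiv_fderiv_eq, derivTwoSize, hn,
    Real.norm_of_nonneg (by positivity), ENNReal.ofReal_mul (by positivity)]
  ring

theorem IsRescaled.eLpNorm_derivSize (h : IsRescaled r K K₀) (hr : 0 < r) :
    eLpNorm (derivSize K) 2 volume =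
      ENNReal.ofReal (r ^ (1 + (d : ℝ) / 2)) * eLpNorm (derivSize K₀) 2 volume := by
  have e : (eLpNorm (derivSize K) 2 volume) ^ 2 =
      (ENNReal.ofReal (r ^ (1 + (d : ℝ) / 2)) * eLpNorm (derivSize K₀) 2 volume) ^ 2 := by
    rw [mul_pow, eLpNorm_two_sq, eLpNorm_two_sq]
    have hm : Measurable fun x => derivSize K₀ x ^ 2 := (measurable_derivSize K₀).pow_const 2
    rw [← lintegral_rescale hr hm, ← lintegral_const_mul' _ _ (by finiteness)]
    congr 1; ext x
    rw [derivSize, h.fderiv_eq, enorm_smul, Real.enorm_of_nonneg (by positivity), mul_pow, ← mul_assoc,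
      ← ENNReal.ofReal_pow (by positivity), ← ENNReal.ofReal_pow (by positivity),
      ← ENNReal.ofReal_mul (by positivity)]
    congr 2
    rw [← Real.rpow_natCast (r ^ (1 + (d : ℝ) / 2)) 2, ← Real.rpow_mul hr.le]
    have : (1 + (d : ℝ) / 2) * ((2 : ℕ) : ℝ) = ((2 + d : ℕ) : ℝ) := by push_cast; ring
    rw [this, Real.rpow_natCast]
    ring
  exact (ENNReal.pow_right_strictMono two_ne_zero).injective e

end

theorem lintegral_derivSize_lt_top (K : 𝓢(Rd d, ℂ)) : ∫⁻ x, derivSize K x < ⊤ :=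
  (SchwartzMap.fderivCLM ℝ (Rd d) ℂ K).integrable.2

theorem lintegral_derivTwoSize_lt_top (K : 𝓢(Rd d, ℂ)) : ∫⁻ x, derivTwoSize K x < ⊤ :=
  (SchwartzMap.fderivCLM ℝ (Rd d) _ (SchwartzMap.fderivCLM ℝ (Rd d) ℂ K)).integrable.2

theorem eLpNorm_derivSize_lt_top (K : 𝓢(Rd d, ℂ)) : eLpNorm (derivSize K) 2 volume < ⊤ :=
  (eLpNorm_enorm _).trans_lt ((SchwartzMap.fderivCLM ℝ (Rd d) ℂ K).memLp 2 volume).2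

/-! ### The kernels of the dyadic blocks -/

variable {χ : LPCutoff d}

theorem isRescaled_lowKernel (χ : LPCutoff d) (l : ℤ) :
    IsRescaled ((2 : ℝ) ^ l) (lowKernel χ l) (lowKernel χ 0) :=
  isRescaled_fourierInv_symbol _ _ l

theorem LPCutoff.eq_zero (χ : LPCutoff d) {ξ : Rd d} (h : 4 / 3 < ‖ξ‖) : χ.toFun ξ = 0 := by
  by_contra h0
  have := χ.support (subset_tsupport _ h0)
  rw [mem_closedBall_zero_iff] at this
  linarith

theorem LPCutoff.annulus_eq_zero_of_lt (χ : LPCutoff d) {ξ : Rd d} (h : ‖ξ‖ < 3 / 4) :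
    χ.annulus ξ = 0 := by
  rw [LPCutoff.annulus, χ.eq_one _ h.le, χ.eq_one, sub_self]
  rw [norm_smul]; norm_num; linarith [norm_nonneg ξ]

theorem LPCutoff.annulus_eq_zero_of_gt (χ : LPCutoff d) {ξ : Rd d} (h : 8 / 3 < ‖ξ‖) :
    χ.annulus ξ = 0 := by
  rw [LPCutoff.annulus, χ.eq_zero, χ.eq_zero, sub_self]
  · linarith
  · rw [norm_smul]; norm_num; linarith

/-- The kernel of `Δ̇_l`. -/
def blockKernel (χ : LPCutoff d) (l : ℤ) : 𝓢(Rd d, ℂ) :=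
  𝓕⁻ (symbol χ.annulus χ.annulus_smooth χ.annulus_hasCompactSupport l)

theorem dyadicBlock_eq (χ : LPCutoff d) (l : ℤ) (u : 𝓢'(Rd d, ℂ)) :
    dyadicBlock χ l u = conv (blockKernel χ l) u := rfl

theorem lowFreq_eq (χ : LPCutoff d) (l : ℤ) (u : 𝓢'(Rd d, ℂ)) :
    lowFreq χ l u = conv (lowKernel χ l) u := rfl

theorem fourier_blockKernel (χ : LPCutoff d) (l : ℤ) (ξ : Rd d) :
    𝓕 (blockKernel χ l) ξ = (χ.annulus ((2 * Real.pi * (2 : ℝ) ^ (-l)) • ξ) : ℝ) := by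
  rw [blockKernel, FourierTransform.fourier_fourierInv_eq, symbol_apply]

theorem fourier_lowKernel (χ : LPCutoff d) (l : ℤ) (ξ : Rd d) :
    𝓕 (lowKernel χ l) ξ = (χ.toFun ((2 * Real.pi * (2 : ℝ) ^ (-l)) • ξ) : ℝ) := by
  rw [lowKernel, FourierTransform.fourier_fourierInv_eq, symbol_apply]

/-- The low frequency symbol is one wherever φ(2^{-l}·) is nonzero, because (1/4)(8/3) = 2/3 ≤ 3/4.
A shift by one instead of two would give 4/3, beyond the ball where χ is known to be one. -/
theorem sconv_lowKernel_blockKernel (χ : LPCutoff d) (l : ℤ) :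
    sconv (lowKernel χ (l + 2)) (blockKernel χ l) = blockKernel χ l := by
  refine sconv_eq_of_fourier fun ξ => ?_
  rw [fourier_blockKernel, fourier_lowKernel]
  set ζ := (2 * Real.pi * (2 : ℝ) ^ (-l)) • ξ with hζ
  have e : (2 * Real.pi * (2 : ℝ) ^ (-(l + 2))) • ξ = (1 / 4 : ℝ) • ζ := by
    rw [hζ, smul_smul, neg_add, zpow_add₀ two_ne_zero]
    congr 1; norm_num; ring
  rw [e]
  rcases le_or_gt ‖ζ‖ (8 / 3) with h | h
  · rw [χ.eq_one ((1 / 4 : ℝ) • ζ)]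
    · simp
    · rw [norm_smul]; norm_num; linarith
  · rw [χ.annulus_eq_zero_of_gt h]; simp

theorem isReproduced_dyadicBlock (χ : LPCutoff d) (l : ℤ) (u : 𝓢'(Rd d, ℂ)) :
    IsReproduced (lowKernel χ (l + 2)) (dyadicBlock χ l u) := by
  intro p
  rw [dyadicBlock_eq]
  refine ⟨integrable_mul_conv _ _ _ _, ?_⟩
  rw [← conv_sconv, sconv_lowKernel_blockKernel]

theorem enorm_integral_mul_le {h A : Rd d → ℂ} (hh : Continuous h) (hA : Continuous A) (x : Rd d) :
    ‖∫ y, h (x - y) * A y‖ₑ ≤ eLpNorm h 2 volume * eLpNorm A 2 volume := by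
  calc _ ≤ ∫⁻ y, ‖h (x - y)‖ₑ * ‖A y‖ₑ := by
        refine (enorm_integral_le_lintegral_enorm _).trans (le_of_eq ?_)
        simp_rw [enorm_mul]
    _ ≤ (∫⁻ y, ‖h (x - y)‖ₑ ^ (2 : ℝ)) ^ (1 / (2 : ℝ)) * (∫⁻ y, ‖A y‖ₑ ^ (2 : ℝ)) ^ (1 / (2 : ℝ)) :=
        ENNReal.lintegral_mul_le_Lp_mul_Lq _ Real.HolderConjugate.two_two
          (by fun_prop) (by fun_prop)
    _ = _ := by
        rw [eLpNorm_eq_lintegral_rpow_enorm_toReal two_ne_zero ENNReal.ofNat_ne_top,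
          eLpNorm_eq_lintegral_rpow_enorm_toReal two_ne_zero ENNReal.ofNat_ne_top,
          lintegral_sub_left_eq_self (fun y => ‖h y‖ₑ ^ (2 : ℝ))]
        simp

/-- Reproduction and Cauchy-Schwarz turn an L² bound into a pointwise one. Boundedness is what makes
the block integrable against the Gaussian. -/
theorem exists_norm_dyadicBlock_le {l : ℤ} {u : 𝓢'(Rd d, ℂ)}
    (hu : eLpNorm (dyadicBlock χ l u) 2 volume < ⊤) : ∃ B, ∀ x, ‖dyadicBlock χ l u x‖ ≤ B := by
  refine ⟨(eLpNorm (lowKernel χ (l + 2)) 2 volume * eLpNorm (dyadicBlock χ l u) 2 volume).toReal,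
    fun x => ?_⟩
  have h := ((lowKernel χ (l + 2)).memLp 2 (volume : Measure (Rd d))).2
  rw [← toReal_enorm, (isReproduced_dyadicBlock χ l u x).2]
  refine ENNReal.toReal_mono (by finiteness) ?_
  exact enorm_integral_mul_le (lowKernel χ (l + 2)).continuous (continuous_conv _ _) x

end

/-! ### Inverting L_ε on a dyadic block. -/

section

variable {d : ℕ}

/-! ### Fourier multipliers on `L²` -/

theorem eLpNorm_fourier (s : 𝓢(Rd d, ℂ)) :
    eLpNorm (𝓕 s : 𝓢(Rd d, ℂ)) 2 volume = eLpNorm s 2 (volume : Measure (Rd d)) := by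
  have h := SchwartzMap.norm_fourier_toL2_eq s
  rw [SchwartzMap.norm_toLp, SchwartzMap.norm_toLp] at h
  exact (ENNReal.toReal_eq_toReal_iff' ((𝓕 s).memLp 2 volume).2.ne (s.memLp 2 volume).2.ne).1 h

theorem eLpNorm_sconv_le {n : 𝓢(Rd d, ℂ)} {c : ℝ} (hn : ∀ ξ, ‖𝓕 n ξ‖ ≤ c) (s : 𝓢(Rd d, ℂ)) :
    eLpNorm (sconv n s) 2 volume ≤ ENNReal.ofReal c * eLpNorm s 2 volume := by
  rw [← eLpNorm_fourier, ← eLpNorm_fourier s]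
  have hc : 0 ≤ c := (norm_nonneg _).trans (hn 0)
  refine eLpNorm_le_mul_eLpNorm_of_ae_le_mul (.of_forall fun ξ => ?_) 2
  rw [fourier_sconv, norm_mul]
  gcongr
  exact hn ξ

theorem exists_seq_schwartz_tendsto {A : Rd d → ℂ} (hA : MemLp A 2 volume) :
    ∃ s : ℕ → 𝓢(Rd d, ℂ), Tendsto (fun m => eLpNorm (⇑(s m) - A) 2 volume) atTop (𝓝 0) := by
  have hd := SchwartzMap.denseRange_toLpCLM (E := Rd d) (F := ℂ) (p := 2)
    (μ := (volume : Measure (Rd d))) ENNReal.ofNat_ne_top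
  obtain ⟨b, hb, hlim⟩ := mem_closure_iff_seq_limit.1 (hd (hA.toLp A))
  choose s hs using hb
  refine ⟨s, ?_⟩
  refine (Lp.tendsto_Lp_iff_tendsto_eLpNorm'' (fun m => s m)
    (fun m => (s m).memLp 2 volume) A hA).1 ?_
  have : (fun m => ((s m).memLp 2 (volume : Measure (Rd d))).toLp (s m)) = b := funext hs
  rwa [this]

/-- Plancherel settles Schwartz functions. For general A, approximation in L² gives pointwise
convergence of the convolutions by Cauchy-Schwarz, and Fatou's lemma passes the norm bound to the
limit. -/
theorem eLpNorm_integral_mul_le {n : 𝓢(Rd d, ℂ)} {c : ℝ} (hn : ∀ ξ, ‖𝓕 n ξ‖ ≤ c) {A : Rd d → ℂ}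
    (hAc : Continuous A) (hA : MemLp A 2 volume) :
    eLpNorm (fun x => ∫ y, n (x - y) * A y) 2 volume ≤
      ENNReal.ofReal c * eLpNorm A 2 volume := by
  obtain ⟨s, hs⟩ := exists_seq_schwartz_tendsto hA
  have hi : ∀ (x : Rd d) {B : Rd d → ℂ}, MemLp B 2 volume →
      Integrable fun y => n (x - y) * B y := fun x B hB => by
    have := ((reflectAt n x).memLp 2 (volume : Measure (Rd d))).integrable_mul hB
    refine this.congr (.of_forall fun y => ?_)
    simp [reflectAt_apply]
  have hlim : ∀ x, Tendsto (fun m => sconv n (s m) x) atTop (𝓝 (∫ y, n (x - y) * A y)) := by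
    intro x
    rw [tendsto_iff_edist_tendsto_0]
    have h0 : Tendsto (fun m => eLpNorm n 2 volume * eLpNorm (⇑(s m) - A) 2 volume) atTop
        (𝓝 0) := by
      have := ENNReal.Tendsto.const_mul hs (a := eLpNorm n 2 volume)
        (.inr (n.memLp 2 volume).2.ne)
      rwa [mul_zero] at this
    refine tendsto_of_tendsto_of_tendsto_of_le_of_le tendsto_const_nhds h0 (fun _ => zero_le)
      fun m => ?_
    rw [edist_eq_enorm_sub, sconv_apply_swap,
      ← integral_sub (hi x ((s m).memLp 2 volume)) (hi x hA)]
    simp_rw [← mul_sub]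
    exact enorm_integral_mul_le n.continuous ((s m).continuous.sub hAc) x
  refine (Lp.eLpNorm_lim_le_liminf_eLpNorm (fun m => (sconv n (s m)).continuous.aestronglyMeasurable)
    _ (.of_forall hlim)).trans ?_
  have h1 : Tendsto (fun m => ENNReal.ofReal c * (eLpNorm (⇑(s m) - A) 2 volume +
      eLpNorm A 2 volume)) atTop (𝓝 (ENNReal.ofReal c * (0 + eLpNorm A 2 volume))) :=
    ENNReal.Tendsto.const_mul (hs.add tendsto_const_nhds) (.inr ENNReal.ofReal_ne_top)
  rw [zero_add] at h1
  rw [← h1.liminf_eq]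
  refine liminf_le_liminf (.of_forall fun m => ?_)
  refine (eLpNorm_sconv_le hn (s m)).trans (mul_le_mul_right ?_ _)
  have := eLpNorm_add_le (((s m).memLp 2 (volume : Measure (Rd d))).1.sub hA.1) hA.1 one_le_two
  rwa [sub_add_cancel] at this

/-! ### The non-local operator on dyadic blocks -/

/-- The symbol of `L_ε`. -/
def nonlocalSymbol (ε : ℝ) (ξ : Rd d) : ℝ :=
  (ε ^ 2)⁻¹ * (Real.exp (-(ε ^ 2 * ‖(2 * Real.pi) • ξ‖ ^ 2)) - 1)

theorem contDiff_nonlocalSymbol (ε : ℝ) : ContDiff ℝ ∞ (nonlocalSymbol ε : Rd d → ℝ) := by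
  unfold nonlocalSymbol
  have : ContDiff ℝ ∞ fun ξ : Rd d => ‖(2 * Real.pi) • ξ‖ ^ 2 :=
    (contDiff_const_smul _).norm_sq ℝ
  fun_prop

theorem half_min_le_one_sub_exp {x : ℝ} (hx : 0 ≤ x) :
    1 / 2 * min x 1 ≤ 1 - Real.exp (-x) := by
  have h1 : Real.exp (-x) ≤ 1 / (1 + x) := by
    rw [Real.exp_neg, ← one_div]
    exact one_div_le_one_div_of_le (by positivity) (by linarith [Real.add_one_le_exp x])
  have h2 : 1 / 2 * min x 1 ≤ 1 - 1 / (1 + x) := by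
    have e : 1 - 1 / (1 + x) = x / (1 + x) := by field_simp; ring
    rw [e, le_div_iff₀ (by positivity)]
    rcases le_total x 1 with h | h
    · rw [min_eq_left h]; nlinarith
    · rw [min_eq_right h]; nlinarith
  linarith

/-- Apply 1 - e^{-x} ≥ min(x, 1)/2 at x = ε²|ξ|². The constant 9/128 is (3/8)²/2, with 3/8 the inner
radius of the wide annulus. -/
theorem mul_min_le_abs_nonlocalSymbol {ε : ℝ} (hε : 0 < ε) {b : ℝ} (hb : 0 ≤ b) {ξ : Rd d}
    (hξ : 3 / 8 * b ≤ ‖(2 * Real.pi) • ξ‖) :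
    9 / 128 * min (b ^ 2) (ε ^ 2)⁻¹ ≤ |nonlocalSymbol ε ξ| := by
  have h := half_min_le_one_sub_exp (x := ε ^ 2 * ‖(2 * Real.pi) • ξ‖ ^ 2) (by positivity)
  have e : |nonlocalSymbol ε ξ| =
      (ε ^ 2)⁻¹ * (1 - Real.exp (-(ε ^ 2 * ‖(2 * Real.pi) • ξ‖ ^ 2))) := by
    rw [nonlocalSymbol, abs_mul, abs_of_pos (by positivity), abs_sub_comm, abs_of_nonneg]
    have : Real.exp (-(ε ^ 2 * ‖(2 * Real.pi) • ξ‖ ^ 2)) ≤ 1 := Real.exp_le_one_iff.2 (by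
      have : 0 ≤ ε ^ 2 * ‖(2 * Real.pi) • ξ‖ ^ 2 := by positivity
      linarith)
    linarith
  rw [e]
  have h2 : (3 / 8 * b) ^ 2 ≤ ‖(2 * Real.pi) • ξ‖ ^ 2 := by gcongr
  have h3 : ε ^ 2 * (9 / 64 * min (b ^ 2) (ε ^ 2)⁻¹) ≤
      min (ε ^ 2 * ‖(2 * Real.pi) • ξ‖ ^ 2) 1 := by
    refine le_min ?_ ?_
    · have := min_le_left (b ^ 2) (ε ^ 2)⁻¹
      have : 9 / 64 * min (b ^ 2) (ε ^ 2)⁻¹ ≤ ‖(2 * Real.pi) • ξ‖ ^ 2 := by nlinarith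
      gcongr
    · have := min_le_right (b ^ 2) (ε ^ 2)⁻¹
      have h4 : ε ^ 2 * (ε ^ 2)⁻¹ = 1 := mul_inv_cancel₀ (by positivity)
      have h5 : 0 ≤ (ε ^ 2)⁻¹ := by positivity
      have h6 : 9 / 64 * min (b ^ 2) (ε ^ 2)⁻¹ ≤ (ε ^ 2)⁻¹ := by linarith
      calc _ ≤ ε ^ 2 * (ε ^ 2)⁻¹ := by gcongr
        _ = 1 := h4
  calc 9 / 128 * min (b ^ 2) (ε ^ 2)⁻¹
      = (ε ^ 2)⁻¹ * (1 / 2 * (ε ^ 2 * (9 / 64 * min (b ^ 2) (ε ^ 2)⁻¹))) := by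
        field_simp; ring
    _ ≤ _ := by gcongr; linarith

variable {χ : LPCutoff d}

/-- An annular cut-off equal to one on the support of `φ`. -/
def LPCutoff.wideAnnulus (χ : LPCutoff d) (ξ : Rd d) : ℝ :=
  χ.toFun ((1 / 4 : ℝ) • ξ) - χ.toFun ((2 : ℝ) • ξ)

theorem LPCutoff.wideAnnulus_smooth (χ : LPCutoff d) : ContDiff ℝ ∞ χ.wideAnnulus :=
  (χ.smooth.comp (contDiff_const_smul (1 / 4 : ℝ))).sub
    (χ.smooth.comp (contDiff_const_smul (2 : ℝ)))

theorem LPCutoff.wideAnnulus_hasCompactSupport (χ : LPCutoff d) :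
    HasCompactSupport χ.wideAnnulus :=
  (χ.hasCompactSupport.comp_smul (by norm_num : (1 / 4 : ℝ) ≠ 0)).sub
    (χ.hasCompactSupport.comp_smul (two_ne_zero))

theorem LPCutoff.wideAnnulus_eq_zero (χ : LPCutoff d) {ξ : Rd d} (h : ‖ξ‖ < 3 / 8) :
    χ.wideAnnulus ξ = 0 := by
  rw [LPCutoff.wideAnnulus, χ.eq_one, χ.eq_one, sub_self]
  · rw [norm_smul]; norm_num; linarith
  · rw [norm_smul]; norm_num; linarith [norm_nonneg ξ]

theorem LPCutoff.wideAnnulus_mul_annulus (χ : LPCutoff d) (ξ : Rd d) :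
    χ.wideAnnulus ξ * χ.annulus ξ = χ.annulus ξ := by
  rcases lt_or_ge ‖ξ‖ (3 / 4) with h | h
  · rw [χ.annulus_eq_zero_of_lt h, mul_zero]
  rcases lt_or_ge (8 / 3) ‖ξ‖ with h' | h'
  · rw [χ.annulus_eq_zero_of_gt h', mul_zero]
  · rw [LPCutoff.wideAnnulus, χ.eq_one, χ.eq_zero, sub_zero, one_mul]
    · rw [norm_smul]; norm_num; linarith
    · rw [norm_smul]; norm_num; linarith

theorem LPCutoff.exists_wideAnnulus_le (χ : LPCutoff d) :
    ∃ M : ℝ, 0 < M ∧ ∀ ξ, |χ.wideAnnulus ξ| ≤ M := by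
  obtain ⟨M, hM⟩ := χ.wideAnnulus_hasCompactSupport.exists_bound_of_continuous
    χ.wideAnnulus_smooth.continuous
  exact ⟨max M 1, by positivity, fun ξ => (hM ξ).trans (le_max_left _ _)⟩

/-- The symbol of an inverse of `L_ε` on the frequencies of size `2^l`. -/
def inverseSymbol (χ : LPCutoff d) (ε : ℝ) (l : ℤ) (ξ : Rd d) : ℝ :=
  χ.wideAnnulus ((2 * Real.pi * (2 : ℝ) ^ (-l)) • ξ) / nonlocalSymbol ε ξ

theorem two_zpow_le_of_wideAnnulus_ne_zero {l : ℤ} {ξ : Rd d}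
    (h : χ.wideAnnulus ((2 * Real.pi * (2 : ℝ) ^ (-l)) • ξ) ≠ 0) :
    3 / 8 * (2 : ℝ) ^ l ≤ ‖(2 * Real.pi) • ξ‖ := by
  by_contra! h1
  refine h (χ.wideAnnulus_eq_zero ?_)
  have e : (2 * Real.pi * (2 : ℝ) ^ (-l)) • ξ = (2 : ℝ) ^ (-l) • (2 * Real.pi) • ξ := by
    rw [smul_smul, mul_comm]
  rw [e, norm_smul, Real.norm_of_nonneg (by positivity), zpow_neg]
  rw [inv_mul_lt_iff₀ (by positivity)]
  linarith

theorem nonlocalSymbol_ne_zero {ε : ℝ} (hε : 0 < ε) {ξ : Rd d} (hξ : ξ ≠ 0) :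
    nonlocalSymbol ε ξ ≠ 0 := by
  have h1 : 0 < ‖(2 * Real.pi) • ξ‖ := norm_pos_iff.2 (smul_ne_zero (by positivity) hξ)
  have h := mul_min_le_abs_nonlocalSymbol hε h1.le (ξ := ξ) (by linarith)
  have : 0 < 9 / 128 * min (‖(2 * Real.pi) • ξ‖ ^ 2) (ε ^ 2)⁻¹ := by positivity
  exact abs_pos.1 (this.trans_le h)

theorem abs_inverseSymbol_le {M : ℝ} (hM : ∀ ξ, |χ.wideAnnulus ξ| ≤ M) {ε : ℝ} (hε : 0 < ε) (l : ℤ)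
    (ξ : Rd d) :
    |inverseSymbol χ ε l ξ| ≤ M * (128 / 9) * (min (((2 : ℝ) ^ l) ^ 2) (ε ^ 2)⁻¹)⁻¹ := by
  have hM0 : 0 ≤ M := (abs_nonneg _).trans (hM 0)
  by_cases h : χ.wideAnnulus ((2 * Real.pi * (2 : ℝ) ^ (-l)) • ξ) = 0
  · rw [inverseSymbol, h, zero_div, abs_zero]; positivity
  have h1 := mul_min_le_abs_nonlocalSymbol hε (by positivity)
    (two_zpow_le_of_wideAnnulus_ne_zero h)
  rw [inverseSymbol, abs_div, div_eq_mul_inv, mul_assoc M]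
  have e : 128 / 9 * (min (((2 : ℝ) ^ l) ^ 2) (ε ^ 2)⁻¹)⁻¹ =
      (9 / 128 * min (((2 : ℝ) ^ l) ^ 2) (ε ^ 2)⁻¹)⁻¹ := by
    rw [mul_inv]; norm_num
  rw [e]
  gcongr
  exact hM _

/-- The denominator vanishes only at the origin, and the numerator vanishes in a whole neighbourhood
of it. -/
theorem contDiff_inverseSymbol (χ : LPCutoff d) {ε : ℝ} (hε : 0 < ε) (l : ℤ) :
    ContDiff ℝ ∞ (inverseSymbol χ ε l) := by
  have h0 : ContDiff ℝ ∞ fun ξ : Rd d => χ.wideAnnulus ((2 * Real.pi * (2 : ℝ) ^ (-l)) • ξ) :=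
    χ.wideAnnulus_smooth.comp (contDiff_const_smul _)
  rw [contDiff_iff_contDiffAt]
  intro ξ
  by_cases hξ : ξ = 0
  · have : inverseSymbol χ ε l =ᶠ[𝓝 ξ] fun _ => 0 := by
      have hc : Continuous fun ξ : Rd d => ‖(2 * Real.pi * (2 : ℝ) ^ (-l)) • ξ‖ := by fun_prop
      have : ∀ᶠ ξ : Rd d in 𝓝 ξ, ‖(2 * Real.pi * (2 : ℝ) ^ (-l)) • ξ‖ < 3 / 8 :=
        hc.continuousAt.eventually_lt continuousAt_const (by simp [hξ])
      filter_upwards [this] with η hη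
      rw [inverseSymbol, χ.wideAnnulus_eq_zero hη, zero_div]
    exact contDiffAt_const.congr_of_eventuallyEq this
  · exact h0.contDiffAt.div (contDiff_nonlocalSymbol ε).contDiffAt (nonlocalSymbol_ne_zero hε hξ)

theorem hasCompactSupport_inverseSymbol (χ : LPCutoff d) (ε : ℝ) (l : ℤ) :
    HasCompactSupport (inverseSymbol χ ε l) := by
  have h := χ.wideAnnulus_hasCompactSupport.comp_smul
    (by positivity : (2 * Real.pi * (2 : ℝ) ^ (-l)) ≠ 0)
  exact h.mul_right (f' := fun ξ => (nonlocalSymbol ε ξ)⁻¹)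

/-- The kernel of an inverse of `L_ε` on the frequencies of size `2^l`. -/
def inverseKernel (χ : LPCutoff d) {ε : ℝ} (hε : 0 < ε) (l : ℤ) : 𝓢(Rd d, ℂ) :=
  𝓕⁻ (HasCompactSupport.toSchwartzMap (f := fun ξ : Rd d => ((inverseSymbol χ ε l ξ : ℝ) : ℂ))
    ((hasCompactSupport_inverseSymbol χ ε l).comp_left Complex.ofReal_zero)
    (Complex.ofRealCLM.contDiff.comp (contDiff_inverseSymbol χ hε l)))

theorem fourier_inverseKernel (χ : LPCutoff d) {ε : ℝ} (hε : 0 < ε) (l : ℤ) (ξ : Rd d) :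
    𝓕 (inverseKernel χ hε l) ξ = (inverseSymbol χ ε l ξ : ℝ) := by
  rw [inverseKernel, FourierTransform.fourier_fourierInv_eq]
  rfl

/-- The Schwartz function with Fourier transform `(φ̂_ε - 1)/ε² k̂`. -/
def nonlocalKernel (ε : ℝ) (k : 𝓢(Rd d, ℂ)) : 𝓢(Rd d, ℂ) :=
  ((ε ^ 2 : ℝ) : ℂ)⁻¹ • (SchwartzMap.fourierMultiplierCLM ℂ
    (𝓕 (fun x : Rd d => ((gaussianKernel ε x : ℝ) : ℂ))) k - k)

theorem conv_nonlocalDist {ε : ℝ} (hε : 0 < ε) (k : 𝓢(Rd d, ℂ)) (u : 𝓢'(Rd d, ℂ)) :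
    conv k (nonlocalDist ε u) = conv (nonlocalKernel ε k) u := by
  ext x
  have h := conv_fourierMultiplier (hasTemperateGrowth_fourier_gaussianKernel hε) k u x
  have e1 : conv k (nonlocalDist ε u) x = ((ε ^ 2 : ℝ) : ℂ)⁻¹ *
      (conv k (TemperedDistribution.fourierMultiplierCLM ℂ
        (𝓕 (fun x : Rd d => ((gaussianKernel ε x : ℝ) : ℂ))) u) x - conv k u x) := rfl
  rw [e1, h]
  simp only [conv, nonlocalKernel, reflectAt, map_smul, map_sub, smul_eq_mul]

theorem fourier_nonlocalKernel {ε : ℝ} (hε : 0 < ε) (k : 𝓢(Rd d, ℂ)) (ξ : Rd d) :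
    𝓕 (nonlocalKernel ε k) ξ = (nonlocalSymbol ε ξ : ℝ) * 𝓕 k ξ := by
  have e1 : 𝓕 (nonlocalKernel ε k) = ((ε ^ 2 : ℝ) : ℂ)⁻¹ • (SchwartzMap.smulLeftCLM ℂ
      (𝓕 (fun x : Rd d => ((gaussianKernel ε x : ℝ) : ℂ))) (𝓕 k) - 𝓕 k) := by
    rw [nonlocalKernel, FourierTransform.fourier_smul, SchwartzMap.fourierMultiplierCLM_apply]
    congr 1
    have := map_sub (FourierTransform.fourierCLM ℂ 𝓢(Rd d, ℂ)) (𝓕⁻ (SchwartzMap.smulLeftCLM ℂ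
      (𝓕 (fun x : Rd d => ((gaussianKernel ε x : ℝ) : ℂ))) (𝓕 k))) k
    simpa using this
  rw [e1, _root_.smul_apply, _root_.sub_apply, SchwartzMap.smulLeftCLM_apply_apply
    (hasTemperateGrowth_fourier_gaussianKernel hε), fourier_gaussianKernel hε, nonlocalSymbol]
  simp only [smul_eq_mul]
  push_cast
  ring

theorem sconv_inverseKernel (χ : LPCutoff d) {ε : ℝ} (hε : 0 < ε) (l : ℤ) :
    sconv (inverseKernel χ hε l) (nonlocalKernel ε (blockKernel χ l)) = blockKernel χ l := by
  refine sconv_eq_of_fourier fun ξ => ?_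
  rw [fourier_inverseKernel, fourier_nonlocalKernel hε, fourier_blockKernel]
  by_cases hξ : ξ = 0
  · rw [hξ, smul_zero, χ.annulus_eq_zero_of_lt (by simp)]
    simp
  · rw [← Complex.ofReal_mul, ← Complex.ofReal_mul]
    congr 1
    rw [inverseSymbol, ← mul_assoc, div_mul_cancel₀ _ (nonlocalSymbol_ne_zero hε hξ),
      χ.wideAnnulus_mul_annulus]

/-- `L_ε` is invertible on a dyadic block. -/
theorem exists_eLpNorm_dyadicBlock_le (χ : LPCutoff d) :
    ∃ C : ℝ, 0 < C ∧ ∀ (ε : ℝ), 0 < ε → ∀ (l : ℤ) (u : 𝓢'(Rd d, ℂ)),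
      ENNReal.ofReal (min (((2 : ℝ) ^ l) ^ 2) (ε ^ 2)⁻¹) * eLpNorm (dyadicBlock χ l u) 2 volume ≤
        ENNReal.ofReal C * eLpNorm (dyadicBlock χ l (nonlocalDist ε u)) 2 volume := by
  obtain ⟨M, hM0, hM⟩ := χ.exists_wideAnnulus_le
  -- M bounds the wide annular cut-off and 128/9 inverts the lower bound for the symbol; neither
  -- depends on ε or l.
  refine ⟨M * (128 / 9), by positivity, fun ε hε l u => ?_⟩
  set m := min (((2 : ℝ) ^ l) ^ 2) (ε ^ 2)⁻¹ with hm
  have hm0 : 0 < m := by positivity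
  have hc : Continuous (dyadicBlock χ l (nonlocalDist ε u)) := continuous_conv _ _
  rcases eq_or_ne (eLpNorm (dyadicBlock χ l (nonlocalDist ε u)) 2 volume) ⊤ with h | h
  · rw [h, ENNReal.mul_top (by simpa using by positivity)]
    exact le_top
  have h1 : dyadicBlock χ l u = fun x => ∫ y, inverseKernel χ hε l (x - y) *
      dyadicBlock χ l (nonlocalDist ε u) y := by
    ext x
    rw [dyadicBlock_eq, dyadicBlock_eq, conv_nonlocalDist hε, ← conv_sconv, sconv_inverseKernel]
  have h2 := eLpNorm_integral_mul_le (n := inverseKernel χ hε l) (c := M * (128 / 9) * m⁻¹)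
    (fun ξ => by
      rw [fourier_inverseKernel, Complex.norm_real]
      exact abs_inverseSymbol_le hM hε l ξ) hc ⟨hc.aestronglyMeasurable, h.lt_top⟩
  rw [← h1] at h2
  refine (mul_le_mul_right h2 _).trans (le_of_eq ?_)
  rw [← mul_assoc, ← ENNReal.ofReal_mul hm0.le]
  congr 2
  field_simp

end

/-! ### Besov embedding into Lipschitz functions; finiteness of V. -/

section

variable {d : ℕ}

/-! ### The gradient of a distribution in a Besov space -/

theorem fourier_lineDeriv_apply (k : 𝓢(Rd d, ℂ)) (e ξ : Rd d) :
    𝓕 (∂_{e} k) ξ = (2 * Real.pi * Complex.I) * ((inner ℝ ξ e : ℝ) * 𝓕 k ξ) := by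
  have : (fun ξ : Rd d => inner ℝ ξ e).HasTemperateGrowth := by fun_prop
  rw [SchwartzMap.fourier_lineDerivOp_eq, _root_.smul_apply,
    SchwartzMap.smulLeftCLM_apply_apply this, smul_eq_mul, Complex.real_smul]

theorem sconv_lineDeriv (h k : 𝓢(Rd d, ℂ)) (e : Rd d) : sconv h (∂_{e} k) = sconv (∂_{e} h) k := by
  refine sconv_eq_of_fourier fun ξ => ?_
  rw [fourier_sconv, fourier_lineDeriv_apply, fourier_lineDeriv_apply]
  ring

theorem lineDeriv_sconv (h k : 𝓢(Rd d, ℂ)) (e : Rd d) : ∂_{e} (sconv h k) = sconv (∂_{e} h) k := by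
  symm
  refine sconv_eq_of_fourier fun ξ => ?_
  rw [fourier_lineDeriv_apply, fourier_lineDeriv_apply, fourier_sconv]
  ring

variable {χ : LPCutoff d}

theorem lowKernel_succ_sub (χ : LPCutoff d) (l : ℤ) :
    lowKernel χ (l + 1) - lowKernel χ l = blockKernel χ l := by
  have h : symbol χ.toFun χ.smooth χ.hasCompactSupport (l + 1) -
      symbol χ.toFun χ.smooth χ.hasCompactSupport l =
      symbol χ.annulus χ.annulus_smooth χ.annulus_hasCompactSupport l := by
    ext ξ
    rw [_root_.sub_apply, symbol_apply, symbol_apply, symbol_apply, LPCutoff.annulus, smul_smul]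
    have : 2 * Real.pi * (2 : ℝ) ^ (-(l + 1)) = 1 / 2 * (2 * Real.pi * (2 : ℝ) ^ (-l)) := by
      rw [neg_add, zpow_add₀ two_ne_zero]; norm_num; ring
    rw [this, Complex.ofReal_sub]
  have h2 := map_sub (FourierTransform.fourierInvCLM ℂ 𝓢(Rd d, ℂ))
    (symbol χ.toFun χ.smooth χ.hasCompactSupport (l + 1))
    (symbol χ.toFun χ.smooth χ.hasCompactSupport l)
  rw [h] at h2
  exact h2.symm

theorem integral_lowKernel (χ : LPCutoff d) (l : ℤ) : ∫ y, lowKernel χ l y = 1 := by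
  have h := fourier_lowKernel χ l 0
  rw [smul_zero, χ.eq_one 0 (by rw [norm_zero]; norm_num), SchwartzMap.fourier_coe, Real.fourier_eq] at h
  simpa using h

theorem conv_sub_kernel (k k' : 𝓢(Rd d, ℂ)) (u : 𝓢'(Rd d, ℂ)) (x : Rd d) :
    conv (k - k') u x = conv k u x - conv k' u x := by
  simp only [conv, reflectAt, map_sub]

/-- The low frequency cut-offs form an approximate identity. -/
theorem tendsto_conv_lowKernel (χ : LPCutoff d) (g : 𝓢(Rd d, ℂ)) (u : 𝓢'(Rd d, ℂ)) :
    Tendsto (fun N : ℕ => conv (sconv (lowKernel χ N) g) u 0) atTop (𝓝 (conv g u 0)) := by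
  obtain ⟨C, M, hC, hb⟩ := exists_norm_conv_le g u
  have hc := continuous_conv g u
  -- Rescaling leaves a fixed kernel of integral χ(0) = 1 against the values of g * u at points
  -- tending to 0; polynomial growth of g * u provides the domination.
  have e : ∀ N : ℕ, conv (sconv (lowKernel χ N) g) u 0 =
      ∫ z, lowKernel χ 0 z * conv g u (-(((2 : ℝ) ^ N)⁻¹ • z)) := by
    intro N
    have hr : (0 : ℝ) < 2 ^ N := by positivity
    rw [conv_sconv]
    have h := Measure.integral_comp_smul (volume : Measure (Rd d))
      (fun z => lowKernel χ 0 z * conv g u (-(((2 : ℝ) ^ N)⁻¹ • z))) ((2 : ℝ) ^ N)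
    rw [finrank_euclideanSpace_fin, abs_of_nonneg (by positivity), eq_inv_smul_iff₀ (by positivity)]
      at h
    rw [← h, ← integral_smul, ← integral_neg_eq_self]
    congr 1; ext y
    have := isRescaled_lowKernel χ N y
    rw [zpow_natCast] at this
    rw [sub_neg_eq_add, zero_add, this, smul_smul, inv_mul_cancel₀ hr.ne', one_smul, smul_mul_assoc]
  simp_rw [e]
  have h0 : conv g u 0 = ∫ z, lowKernel χ 0 z * conv g u 0 := by
    rw [integral_mul_const, integral_lowKernel, one_mul]
  rw [h0]
  refine tendsto_integral_of_dominated_convergence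
    (fun z => C * (‖lowKernel χ 0 z‖ * (1 + ‖z‖) ^ M))
    (fun N => ((lowKernel χ 0).continuous.mul (hc.comp (by fun_prop))).aestronglyMeasurable)
    ((integrable_one_add_norm_pow_mul _ M).const_mul C) (fun N => .of_forall fun z => ?_)
    (.of_forall fun z => ?_)
  · rw [norm_mul]
    have h1 : ‖-(((2 : ℝ) ^ N)⁻¹ • z)‖ ≤ ‖z‖ := by
      rw [norm_neg, norm_smul, Real.norm_of_nonneg (by positivity)]
      exact mul_le_of_le_one_left (norm_nonneg _) (inv_le_one_of_one_le₀ (one_le_pow₀ one_le_two))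
    calc _ ≤ ‖lowKernel χ 0 z‖ * (C * (1 + ‖z‖) ^ M) := by
          gcongr
          exact (hb _).trans (by gcongr)
      _ = _ := by ring
  · refine tendsto_const_nhds.mul ((hc.tendsto 0).comp ?_)
    have h1 : Tendsto (fun N : ℕ => ((2 : ℝ) ^ N)⁻¹) atTop (𝓝 0) :=
      tendsto_inv_atTop_zero.comp (tendsto_pow_atTop_atTop_of_one_lt one_lt_two)
    simpa using (h1.smul_const z).neg

/-- Membership in 𝓢'_h enters here: the low frequencies tend to 0 uniformly and g is integrable. -/
theorem tendsto_conv_lowKernel_neg {u : 𝓢'(Rd d, ℂ)} (hu : MemSh χ u) (g : 𝓢(Rd d, ℂ)) :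
    Tendsto (fun N : ℕ => conv (sconv (lowKernel χ (-(N : ℤ))) g) u 0) atTop (𝓝 0) := by
  rw [tendsto_iff_edist_tendsto_0]
  have h1 : Tendsto (fun N : ℕ => (∫⁻ y, ‖g (0 - y)‖ₑ) *
      eLpNorm (lowFreq χ (-(N : ℤ)) u) ⊤ volume) atTop (𝓝 0) := by
    have h2 : Tendsto (fun N : ℕ => -(N : ℤ)) atTop atBot :=
      tendsto_neg_atTop_atBot.comp tendsto_natCast_atTop_atTop
    have h3 := ENNReal.Tendsto.const_mul (hu.comp h2) (a := ∫⁻ y, ‖g (0 - y)‖ₑ)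
      (.inr (by
        have := (reflectAt g 0).integrable (μ := volume).2
        simpa [HasFiniteIntegral, reflectAt_apply] using this.ne))
    rwa [mul_zero] at h3
  refine tendsto_of_tendsto_of_tendsto_of_le_of_le tendsto_const_nhds h1 (fun _ => zero_le)
    fun N => ?_
  rw [edist_zero_right, sconv_comm, conv_sconv, ← lowFreq_eq]
  calc _ ≤ ∫⁻ y, ‖g (0 - y) * lowFreq χ (-(N : ℤ)) u y‖ₑ := enorm_integral_le_lintegral_enorm _
    _ ≤ ∫⁻ y, ‖g (0 - y)‖ₑ * eLpNorm (lowFreq χ (-(N : ℤ)) u) ⊤ volume := by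
        refine lintegral_mono_ae ?_
        filter_upwards [ae_le_eLpNormEssSup (f := lowFreq χ (-(N : ℤ)) u) (μ := volume)] with y hy
        rw [enorm_mul, eLpNorm_exponent_top]
        gcongr
    _ = _ := lintegral_mul_const _
        (g.continuous.comp (continuous_const.sub continuous_id)).enorm.measurable

theorem sum_Ico_int_sub {E : Type*} [AddCommGroup E] (a : ℤ → E) (m : ℤ) (n : ℕ) :
    ∑ l ∈ Finset.Ico m (m + n), (a (l + 1) - a l) = a (m + n) - a m := by
  induction n with
  | zero => simp
  | succ n ih =>
    have : Finset.Ico m (m + ((n + 1 : ℕ) : ℤ)) = insert (m + n) (Finset.Ico m (m + n)) := by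
      ext; simp; lia
    rw [this, Finset.sum_insert (by simp), ih]
    push_cast
    rw [add_assoc]; abel

/-- A sum over ℤ that converges unconditionally may be evaluated along the intervals [-N, N). -/
theorem HasSum.eq_of_telescoping {E : Type*} [NormedAddCommGroup E] {a : ℤ → E} {A L : E}
    (h : HasSum (fun l => a (l + 1) - a l) L)
    (h1 : Tendsto (fun N : ℕ => a N) atTop (𝓝 A))
    (h2 : Tendsto (fun N : ℕ => a (-(N : ℤ))) atTop (𝓝 0)) : L = A := by
  have h3 : Tendsto (fun N : ℕ => Finset.Ico (-(N : ℤ)) N) atTop atTop := by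
    refine tendsto_atTop_finset_of_monotone (fun m n h => ?_) fun x => ⟨x.natAbs + 1, ?_⟩
    · exact Finset.Ico_subset_Ico (by simpa using h) (by simpa using h)
    · rw [Finset.mem_Ico]; omega
  have h4 := h.comp h3
  have h5 : Tendsto (fun N : ℕ => a N - a (-(N : ℤ))) atTop (𝓝 A) := by
    simpa using h1.sub h2
  refine tendsto_nhds_unique h4 (h5.congr fun N => ?_)
  have := sum_Ico_int_sub a (-(N : ℤ)) (2 * N)
  have e : -(N : ℤ) + ((2 * N : ℕ) : ℤ) = N := by push_cast; ring
  rw [e] at this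
  exact this.symm

/-- Bernstein's inequality: by reproduction the derivative falls on the low frequency kernel, and
Cauchy-Schwarz finishes. -/
theorem enorm_conv_lineDeriv_blockKernel_le (χ : LPCutoff d) (l : ℤ) (u : 𝓢'(Rd d, ℂ)) {e : Rd d}
    (he : ‖e‖ ≤ 1) (x : Rd d) :
    ‖conv (∂_{e} (blockKernel χ l)) u x‖ₑ ≤
      eLpNorm (derivSize (lowKernel χ (l + 2))) 2 volume * eLpNorm (dyadicBlock χ l u) 2 volume := by
  have h1 : conv (∂_{e} (blockKernel χ l)) u x =
      ∫ y, (∂_{e} (lowKernel χ (l + 2))) (x - y) * dyadicBlock χ l u y := by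
    rw [dyadicBlock_eq, ← conv_sconv, ← lineDeriv_sconv, sconv_lowKernel_blockKernel]
  rw [h1]
  refine (enorm_integral_mul_le (SchwartzMap.continuous _) (continuous_conv _ _) x).trans ?_
  refine mul_le_mul_left ?_ _
  refine eLpNorm_mono_enorm fun y => ?_
  rw [SchwartzMap.lineDerivOp_apply_eq_fderiv, enorm_eq_self, derivSize]
  refine ((fderiv ℝ (lowKernel χ (l + 2)) y).le_opENorm e).trans ?_
  refine mul_le_of_le_one_right' ?_
  rw [← ofReal_norm]
  exact ENNReal.ofReal_le_one.2 he

/-- The constant in the embedding of `Ḃ^{d/2+1}_{2,1}` in the Lipschitz functions. -/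
def embeddingConst (χ : LPCutoff d) : ℝ≥0∞ :=
  ENNReal.ofReal ((2 : ℝ) ^ (2 * (1 + (d : ℝ) / 2))) * eLpNorm (derivSize (lowKernel χ 0)) 2 volume

theorem embeddingConst_lt_top (χ : LPCutoff d) : embeddingConst χ < ⊤ :=
  ENNReal.mul_lt_top ENNReal.ofReal_lt_top (eLpNorm_derivSize_lt_top _)

theorem eLpNorm_derivSize_lowKernel (χ : LPCutoff d) (l : ℤ) :
    eLpNorm (derivSize (lowKernel χ (l + 2))) 2 volume =
      embeddingConst χ * ENNReal.ofReal ((2 : ℝ) ^ ((l : ℝ) * ((d : ℝ) / 2 + 1))) := by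
  rw [(isRescaled_lowKernel χ (l + 2)).eLpNorm_derivSize (by positivity), embeddingConst, mul_assoc,
    mul_comm (eLpNorm _ _ _), ← mul_assoc, ← ENNReal.ofReal_mul (by positivity)]
  congr 2
  rw [← Real.rpow_intCast, ← Real.rpow_mul two_pos.le, ← Real.rpow_add two_pos]
  congr 1
  push_cast
  ring

theorem distLinftyNorm_le {u : 𝓢'(Rd d, ℂ)} {G : Rd d → ℂ} (hG : Continuous G) {B : ℝ≥0∞}
    (hB : ∀ x, ‖G x‖ₑ ≤ B) (hB' : B ≠ ⊤) (h : ∀ g : 𝓢(Rd d, ℂ), u g = ∫ x, g x * G x) :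
    distLinftyNorm u ≤ B := by
  have hn : eLpNorm G ⊤ volume ≤ B := by
    rw [eLpNorm_exponent_top]
    exact essSup_le_of_ae_le _ (.of_forall hB)
  have hm : MemLp G ⊤ volume := ⟨hG.aestronglyMeasurable, hn.trans_lt hB'.lt_top⟩
  have e : Lp.toTemperedDistribution (hm.toLp G) = u := by
    ext g
    have h1 : Lp.toTemperedDistribution (hm.toLp G) g = ∫ x, g x • hm.toLp G x :=
      Lp.toTemperedDistribution_apply (μ := (volume : Measure (Rd d))) _ g
    rw [h1, h]
    refine integral_congr_ae ?_
    filter_upwards [hm.coeFn_toLp] with x hx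
    rw [hx, smul_eq_mul]
  refine (iInf₂_le (hm.toLp G) e).trans ?_
  rwa [Lp.enorm_def, eLpNorm_congr_ae hm.coeFn_toLp]

/-- By Bernstein the series of the ∂_e Δ̇_l u converges uniformly. Tested against g, its terms are
differences of consecutive low frequency cut-offs and telescope: the upper end tends to ∂_e u
because the cut-offs form an approximate identity, the lower end to 0 because u lies in 𝓢'_h. -/
theorem distLinftyNorm_lineDeriv_le {u : 𝓢'(Rd d, ℂ)} (hu : MemBesov χ ((d : ℝ) / 2 + 1) u)
    {e : Rd d} (he : ‖e‖ ≤ 1) :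
    distLinftyNorm (∂_{e} u) ≤ embeddingConst χ * besovNorm χ ((d : ℝ) / 2 + 1) u := by
  set b : ℤ → Rd d → ℂ := fun l => conv (∂_{e} (blockKernel χ l)) u with hbdef
  set β : ℤ → ℝ≥0∞ := fun l => embeddingConst χ *
    (ENNReal.ofReal ((2 : ℝ) ^ ((l : ℝ) * ((d : ℝ) / 2 + 1))) *
      eLpNorm (dyadicBlock χ l u) 2 volume) with hβ
  have hβsum : ∑' l, β l = embeddingConst χ * besovNorm χ ((d : ℝ) / 2 + 1) u := by
    rw [hβ, ENNReal.tsum_mul_left]; rfl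
  have hfin : embeddingConst χ * besovNorm χ ((d : ℝ) / 2 + 1) u ≠ ⊤ :=
    (ENNReal.mul_lt_top (embeddingConst_lt_top χ) hu.2).ne
  have hβfin : ∑' l, β l ≠ ⊤ := hβsum ▸ hfin
  have hb : ∀ l x, ‖b l x‖ₑ ≤ β l := fun l x => by
    refine (enorm_conv_lineDeriv_blockKernel_le χ l u he x).trans (le_of_eq ?_)
    rw [eLpNorm_derivSize_lowKernel, mul_assoc]
  have hb' : ∀ l x, ‖b l x‖ ≤ (β l).toReal := fun l x => by
    rw [← toReal_enorm]
    exact ENNReal.toReal_mono (ENNReal.ne_top_of_tsum_ne_top hβfin l) (hb l x)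
  have hs : Summable fun l => (β l).toReal := ENNReal.summable_toReal hβfin
  have hbc : ∀ l, Continuous (b l) := fun l => continuous_conv _ _
  refine distLinftyNorm_le (G := fun x => ∑' l, b l x) (continuous_tsum hbc hs hb') (fun x => ?_)
    hfin fun g => ?_
  · rw [← hβsum, ← ofReal_norm, ← ENNReal.ofReal_toReal hβfin]
    refine ENNReal.ofReal_le_ofReal ?_
    rw [ENNReal.tsum_toReal_eq (ENNReal.ne_top_of_tsum_ne_top hβfin)]
    exact tsum_of_norm_bounded hs.hasSum fun l => hb' l x
  · set k := ∂_{e} (reflectAt g 0) with hk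
    have e1 : (∂_{e} u) g = conv k u 0 := by
      rw [apply_eq_conv, conv_lineDeriv]
    have e2 : ∀ l, ∫ x, g x * b l x =
        conv (sconv (lowKernel χ (l + 1)) k) u 0 - conv (sconv (lowKernel χ l) k) u 0 := by
      intro l
      have h1 : ∫ x, g x * b l x = conv (sconv (blockKernel χ l) k) u 0 := by
        rw [hk, sconv_lineDeriv, sconv_comm, conv_sconv]
        simp [reflectAt_apply, hbdef]
      rw [h1, ← lowKernel_succ_sub, ← conv_sub_kernel]
      congr 1
      refine sconv_eq_of_fourier fun ξ => ?_
      have h2 : ∀ p q : 𝓢(Rd d, ℂ), 𝓕 (p - q) ξ = 𝓕 p ξ - 𝓕 q ξ := fun p q =>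
        congrArg (fun r : 𝓢(Rd d, ℂ) => r ξ) (map_sub (FourierTransform.fourierCLM ℂ 𝓢(Rd d, ℂ)) p q)
      rw [h2, h2, fourier_sconv, fourier_sconv, sub_mul]
    have hi : ∀ l, Integrable fun x => g x * b l x := fun l =>
      (g.integrable).mul_bdd (c := (β l).toReal) (hbc l).aestronglyMeasurable
        (.of_forall fun x => hb' l x)
    have hsum := hasSum_integral_of_summable_integral_norm hi (by
      refine Summable.of_nonneg_of_le (fun l => integral_nonneg fun _ => norm_nonneg _)
        (fun l => ?_) (hs.mul_left (normOne g))
      rw [normOne, ← integral_mul_const]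
      refine integral_mono (hi l).norm (g.integrable.norm.mul_const _) fun x => ?_
      rw [norm_mul]
      exact mul_le_mul_of_nonneg_left (hb' l x) (norm_nonneg _))
    simp_rw [e2] at hsum
    have := HasSum.eq_of_telescoping (a := fun l => conv (sconv (lowKernel χ l) k) u 0) hsum
      (tendsto_conv_lowKernel χ k u) (tendsto_conv_lowKernel_neg hu.1 k)
    rw [e1, ← this]
    simp_rw [tsum_mul_left]

/-! ### Integrability in time of the gradient of the velocity -/

/-- The map (x, τ) ↦ `conv k (u τ) x` is continuous in x and measurable in τ, hence jointly
measurable. Passing to null-measurable sets in τ avoids an exceptional null set depending on x. -/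
theorem aemeasurable_eLpNorm_conv {μ : Measure ℝ} {u : ℝ → 𝓢'(Rd d, ℂ)}
    (hu : ∀ g : 𝓢(Rd d, ℂ), AEMeasurable (fun τ => u τ g) μ) (k : 𝓢(Rd d, ℂ)) :
    AEMeasurable (fun τ => eLpNorm (conv k (u τ)) 2 volume) μ := by
  have h1 : Measurable (Function.uncurry fun (x : Rd d) (τ : NullMeasurableSpace ℝ μ) =>
      conv k (u τ) x) :=
    measurable_uncurry_of_continuous_of_measurable (fun τ => continuous_conv k (u τ))
      fun x => (hu (reflectAt k x)).nullMeasurable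
  have h2 : Measurable fun τ : NullMeasurableSpace ℝ μ => ∫⁻ x, ‖conv k (u τ) x‖ₑ ^ (2 : ℝ) :=
    Measurable.lintegral_prod_left' (h1.enorm.pow_const (2 : ℝ))
  have h3 : AEMeasurable (fun τ => ∫⁻ x, ‖conv k (u τ) x‖ₑ ^ (2 : ℝ)) μ :=
    NullMeasurable.aemeasurable h2
  refine (h3.pow_const (1 / (2 : ℝ))).congr (.of_forall fun τ => ?_)
  beta_reduce
  rw [eLpNorm_eq_lintegral_rpow_enorm_toReal two_ne_zero ENNReal.ofNat_ne_top]
  simp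

theorem aemeasurable_besovNorm {μ : Measure ℝ} {u : ℝ → 𝓢'(Rd d, ℂ)} (χ : LPCutoff d) (s : ℝ)
    (hu : ∀ g : 𝓢(Rd d, ℂ), AEMeasurable (fun τ => u τ g) μ) :
    AEMeasurable (fun τ => besovNorm χ s (u τ)) μ :=
  AEMeasurable.tsum fun l => (aemeasurable_eLpNorm_conv hu (blockKernel χ l)).const_mul _

theorem Ioc_subset_timeInterval {T : ℝ≥0∞} {t : ℝ} (ht : t ∈ timeInterval T) :
    Icc 0 t ⊆ timeInterval T := fun _ hs =>
  ⟨hs.1, (ENNReal.ofReal_le_ofReal hs.2).trans_lt ht.2⟩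

section

variable {T : ℝ≥0∞} {t : ℝ} {v : ℝ → Fin d → 𝓢'(Rd d, ℂ)}

theorem IsVelocity.ae_gradNorm_le (hv : IsVelocity χ (timeInterval T) v)
    (ht : t ∈ timeInterval T) :
    ∀ᵐ τ ∂(volume.restrict (Ioc 0 t)),
      gradNorm (v τ) ≤ embeddingConst χ * ∑ i, besovNorm χ ((d : ℝ) / 2 + 1) (v τ i) := by
  have h : ∀ i, ∀ᵐ τ ∂(volume.restrict (Ioc 0 t)), MemBesov χ ((d : ℝ) / 2 + 1) (v τ i) := fun i =>
    ae_restrict_of_ae_restrict_of_subset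
      (Ioc_subset_Icc_self.trans (Ioc_subset_timeInterval ht)) (hv i).2.1.2.1
  filter_upwards [ae_all_iff.2 h] with τ hτ
  refine iSup₂_le fun i k => ?_
  refine (distLinftyNorm_lineDeriv_le (hτ i) (by simp)).trans (mul_le_mul_right ?_ _)
  exact Finset.single_le_sum (f := fun i => besovNorm χ ((d : ℝ) / 2 + 1) (v τ i))
    (fun _ _ => zero_le) (Finset.mem_univ i)

theorem IsVelocity.lintegral_besovNorm_lt_top (hv : IsVelocity χ (timeInterval T) v)
    (ht : t ∈ timeInterval T) :
    ∫⁻ τ in Ioc 0 t, embeddingConst χ * ∑ i, besovNorm χ ((d : ℝ) / 2 + 1) (v τ i) < ⊤ := by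
  have hsub := Ioc_subset_Icc_self.trans (Ioc_subset_timeInterval ht)
  rw [lintegral_const_mul' _ _ (embeddingConst_lt_top χ).ne, lintegral_finsetSum']
  · refine ENNReal.mul_lt_top (embeddingConst_lt_top χ) (ENNReal.sum_lt_top.2 fun i _ => ?_)
    have := (hv i).2.1.2.2
    simp only [ENNReal.rpow_one] at this
    exact (lintegral_mono_set hsub).trans_lt this
  · intro i _
    exact (aemeasurable_besovNorm χ _ (hv i).2.1.1).mono_set hsub

/-- Since `lipIntegral` is a `toReal`, it would be 0 for an infinite integral; finiteness makes V
control the flow. -/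
theorem IsVelocity.lintegral_gradNorm_lt_top (hv : IsVelocity χ (timeInterval T) v)
    (ht : t ∈ timeInterval T) : ∫⁻ τ in Ioc 0 t, gradNorm (v τ) < ⊤ :=
  (lintegral_mono_ae (hv.ae_gradNorm_le ht)).trans_lt (hv.lintegral_besovNorm_lt_top ht)

theorem IsVelocity.ae_gradNorm_lt_top (hv : IsVelocity χ (timeInterval T) v)
    (ht : t ∈ timeInterval T) : ∀ᵐ τ ∂(volume.restrict (Ioc 0 t)), gradNorm (v τ) < ⊤ := by
  have h : ∀ i, ∀ᵐ τ ∂(volume.restrict (Ioc 0 t)), MemBesov χ ((d : ℝ) / 2 + 1) (v τ i) := fun i =>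
    ae_restrict_of_ae_restrict_of_subset
      (Ioc_subset_Icc_self.trans (Ioc_subset_timeInterval ht)) (hv i).2.1.2.1
  filter_upwards [ae_all_iff.2 h, hv.ae_gradNorm_le ht] with τ hτ h1
  exact h1.trans_lt (ENNReal.mul_lt_top (embeddingConst_lt_top χ)
    (ENNReal.sum_lt_top.2 fun i _ => (hτ i).2))

end

end

/-! ### Weights, flow bounds and the block-wise commutator estimate. -/

section

variable {d : ℕ}

/-! ### The commutator estimate -/

theorem exists_pos_hasSum_one : ∃ w : ℤ → ℝ, (∀ j, 0 < w j) ∧ HasSum w 1 := by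
  obtain ⟨w, hw, c, hc, -⟩ := posSumOfEncodable one_pos ℤ
  have hc0 : 0 < c := (hw 0).trans_le (le_hasSum hc 0 fun j _ => (hw j).le)
  exact ⟨fun j => w j / c, fun j => div_pos (hw j) hc0, by simpa [hc0.ne'] using hc.div_const c⟩

/-- A normalisation by a sequence of positive weights. -/
theorem exists_weights (a : ℤ → ℝ≥0∞) :
    ∃ c : ℤ → ℝ, (∀ j, 0 < c j) ∧ HasSum c 1 ∧
      ∀ j, a j ≤ 2 * ENNReal.ofReal (c j) * ∑' l, a l := by
  obtain ⟨w, hw, hs⟩ := exists_pos_hasSum_one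
  rcases eq_or_ne (∑' l, a l) 0 with h0 | h0
  · exact ⟨w, hw, hs, fun j => by simp [ENNReal.tsum_eq_zero.1 h0 j]⟩
  rcases eq_or_ne (∑' l, a l) ⊤ with h1 | h1
  · refine ⟨w, hw, hs, fun j => ?_⟩
    rw [h1, ENNReal.mul_top (by simpa using hw j)]
    exact le_top
  set B := (∑' l, a l).toReal with hB
  have hB0 : 0 < B := ENNReal.toReal_pos h0 h1
  have ha := ENNReal.ne_top_of_tsum_ne_top h1
  have hsum : HasSum (fun l => (a l).toReal) B := by
    rw [hB, ENNReal.tsum_toReal_eq ha]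
    exact (ENNReal.summable_toReal h1).hasSum
  -- The normalised sequence may vanish at some j, so it is averaged with fixed positive weights of
  -- sum one; this costs the factor 2. When the total is 0 or ∞, the fixed weights alone suffice.
  refine ⟨fun j => (a j).toReal / B / 2 + w j / 2,
    fun j => add_pos_of_nonneg_of_pos (by positivity) (half_pos (hw j)), ?_, fun j => ?_⟩
  · have := ((hsum.div_const B).div_const 2).add (hs.div_const 2)
    rwa [div_self hB0.ne', add_halves] at this
  · rw [← ENNReal.ofReal_toReal h1, ← hB, ← ENNReal.ofReal_ofNat, ← ENNReal.ofReal_mul two_pos.le,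
      ← ENNReal.ofReal_mul (by have := hw j; positivity), ← ENNReal.ofReal_toReal (ha j)]
    refine ENNReal.ofReal_le_ofReal ?_
    have e : 2 * ((a j).toReal / B / 2 + w j / 2) * B = (a j).toReal + w j * B := by
      field_simp
    rw [e]
    have := hw j
    have : 0 ≤ w j * B := by positivity
    linarith

theorem MemHybrid.eLpNorm_lt_top {χ : LPCutoff d} {γ ε s r : ℝ} {f : 𝓢'(Rd d, ℂ)} (hε : 0 < ε)
    (hf : MemHybrid χ γ ε s r f) (j : ℤ) : eLpNorm (dyadicBlock χ j f) 2 volume < ⊤ := by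
  have h := ENNReal.ne_top_of_tsum_ne_top hf.2.ne j
  refine ENNReal.lt_top_of_mul_ne_top_right h ?_
  rw [ne_eq, ENNReal.ofReal_eq_zero, not_le]
  split_ifs <;> positivity

theorem gradLe_gradNorm {w : Fin d → 𝓢'(Rd d, ℂ)} (hw : gradNorm w < ⊤) (i : Fin d) :
    GradLe (w i) (gradNorm w).toReal := by
  intro k
  have h : distLinftyNorm (∂_{(EuclideanSpace.single k (1 : ℝ) : Rd d)} (w i)) ≤ gradNorm w :=
    le_iSup₂ (f := fun i k => distLinftyNorm (∂_{(EuclideanSpace.single k (1 : ℝ) : Rd d)} (w i)))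
      i k
  exact ⟨h.trans_lt hw, ENNReal.toReal_mono hw.ne h⟩

variable {χ : LPCutoff d} {T : ℝ≥0∞} {t : ℝ} {v : ℝ → Fin d → 𝓢'(Rd d, ℂ)}

theorem IsVelocity.fieldBounds (hd : 0 < d) (hv : IsVelocity χ (timeInterval T) v)
    (ht : t ∈ timeInterval T) (l : ℤ) :
    FieldBounds (lowFreqField χ l v) (fun τ => gradNorm (v τ)) t
      (d ^ 2 * normOne (lowKernel χ 0)) (d ^ 2 * ((2 : ℝ) ^ l * normOneDeriv (lowKernel χ 0))) := by
  have h := hv.ae_gradNorm_lt_top ht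
  have hr := isRescaled_lowKernel χ l
  refine ⟨h, ?_, ?_⟩
  · filter_upwards [h] with τ hτ p q
    rw [← hr.normOne_eq (by positivity)]
    exact norm_lowFreqField_sub_le (gradLe_gradNorm hτ) p q
  · filter_upwards [h] with τ hτ p e
    rw [← hr.normOneDeriv_eq (by positivity)]
    exact norm_lowFreqField_second_le hd (gradLe_gradNorm hτ) p e

/-- The size of the perturbation of the identity produced by the flow, per unit of `V`. -/
def flowConst (χ : LPCutoff d) : ℝ :=
  d ^ 2 * (2 * normOne (lowKernel χ 0) + 4 * normOneDeriv (lowKernel χ 0)) + 1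

theorem normOneDeriv_nonneg (k : 𝓢(Rd d, ℂ)) : 0 ≤ normOneDeriv k :=
  integral_nonneg fun _ => norm_nonneg _

theorem flowConst_pos (χ : LPCutoff d) : 0 < flowConst χ := by
  have h1 := normOne_nonneg (lowKernel χ 0)
  have h2 := normOneDeriv_nonneg (lowKernel χ 0)
  unfold flowConst
  positivity

theorem IsVelocity.flow_bounds (hd : 0 < d) (hv : IsVelocity χ (timeInterval T) v)
    (ht : t ∈ timeInterval T) {j : ℤ} {ψ : ℝ → Rd d → Rd d}
    (hψ : IsFlow (timeInterval T) (lowFreqField χ (j - 1) v) ψ)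
    (hV : flowConst χ * lipIntegral v t ≤ 1 / 2) :
    IsNearId (flowConst χ * lipIntegral v t) (ψ t) ∧
      ∀ x y, ‖ψ t (x + y) + ψ t (x - y) - (2 : ℝ) • ψ t x‖ ≤
        flowConst χ * lipIntegral v t * (2 : ℝ) ^ j * ‖y‖ ^ 2 := by
  have hw := hv.fieldBounds hd ht (j - 1)
  have hI := Ioc_subset_timeInterval ht
  have hfin := hv.lintegral_gradNorm_lt_top ht
  have h1 := normOne_nonneg (lowKernel χ 0)
  have h2 := normOneDeriv_nonneg (lowKernel χ 0)
  have hV0 : 0 ≤ lipIntegral v t := ENNReal.toReal_nonneg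
  have hd0 : (0 : ℝ) ≤ d ^ 2 := by positivity
  have hδ : 2 * (d ^ 2 * normOne (lowKernel χ 0)) ≤ flowConst χ := by
    unfold flowConst; nlinarith [mul_nonneg hd0 h2]
  have hδ' : 4 * (d ^ 2 * normOneDeriv (lowKernel χ 0)) ≤ flowConst χ := by
    unfold flowConst; nlinarith [mul_nonneg hd0 h1]
  have hsmall : d ^ 2 * normOne (lowKernel χ 0) * lipIntegral v t ≤ 1 / 2 := by
    have := mul_le_mul_of_nonneg_right hδ hV0
    have : 0 ≤ d ^ 2 * normOne (lowKernel χ 0) * lipIntegral v t := by positivity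
    linarith
  refine ⟨(hψ.isNearId hI ht.1 (by positivity) hw hfin hsmall).mono
    (mul_le_mul_of_nonneg_right hδ hV0), fun x y => ?_⟩
  refine (hψ.norm_second_le hI ht.1 (by positivity) (by positivity) hw hfin hsmall x y).trans ?_
  change _ * lipIntegral v t * ‖y‖ ^ 2 ≤ _
  -- The index j - 1 of the truncation halves the 8 of `IsFlow.norm_second_le`, whence the 4 in
  -- `flowConst`.
  have e : 8 * ((d : ℝ) ^ 2 * ((2 : ℝ) ^ (j - 1) * normOneDeriv (lowKernel χ 0))) *
      lipIntegral v t * ‖y‖ ^ 2 =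
      4 * (d ^ 2 * normOneDeriv (lowKernel χ 0)) * lipIntegral v t * (2 : ℝ) ^ j * ‖y‖ ^ 2 := by
    rw [zpow_sub_one₀ two_ne_zero]; ring
  rw [e]
  gcongr

/-- The constant in the commutator estimate. -/
def commutatorConst (χ : LPCutoff d) : ℝ≥0∞ :=
  2 ^ d * ((∫⁻ y : Rd d, ‖gaussianKernel 1 y‖ₑ * ‖y‖ₑ ^ 2) *
      (4 * (∫⁻ z, derivSize (lowKernel χ 0) z) + 64 * ∫⁻ z, derivTwoSize (lowKernel χ 0) z)) +
    2 ^ d * (2 ^ (d + 1) * (∫⁻ x : Rd d, ‖gaussianKernel 1 x‖ₑ) +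
      ∫⁻ x : Rd d, ENNReal.ofReal (gaussianMoment x))

theorem commutatorConst_lt_top (χ : LPCutoff d) : commutatorConst χ < ⊤ := by
  have h1 := lintegral_derivSize_lt_top (lowKernel χ 0)
  have h2 := lintegral_derivTwoSize_lt_top (lowKernel χ 0)
  have h3 := lintegral_gaussianMoment_lt_top (d := d)
  have h4 := lintegral_enorm_gaussianKernel_lt_top (d := d)
  have h5 := lintegral_enorm_gaussianKernel_mul_sq_lt_top (d := d)
  unfold commutatorConst
  finiteness

/-- The bounds of order δ 2^{2j} and δ ε^{-2} both hold for all j and ε; whichever realises the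
minimum is used, and the constant is the sum of the two. -/
theorem eLpNorm_commutator_le {ε δ : ℝ} (hε : 0 < ε) (hδ0 : 0 ≤ δ) (hδ1 : δ ≤ 1 / 2) {j : ℤ}
    {ψ : Rd d → Rd d} (hψ : IsNearId δ ψ)
    (hψ2 : ∀ x y, ‖ψ (x + y) + ψ (x - y) - (2 : ℝ) • ψ x‖ ≤ δ * (2 : ℝ) ^ j * ‖y‖ ^ 2)
    {f : 𝓢'(Rd d, ℂ)} (hf : eLpNorm (dyadicBlock χ j f) 2 volume < ⊤) :
    eLpNorm (commutator χ ε j ψ f) 2 volume ≤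
      ENNReal.ofReal δ * commutatorConst χ * (ENNReal.ofReal (min (((2 : ℝ) ^ j) ^ 2) (ε ^ 2)⁻¹) *
        eLpNorm (dyadicBlock χ j f) 2 volume) := by
  obtain ⟨B, hB⟩ := exists_norm_dyadicBlock_le hf
  have hg : Continuous (dyadicBlock χ j f) := continuous_conv _ _
  set G := eLpNorm (dyadicBlock χ j f) 2 volume
  rcases min_choice (((2 : ℝ) ^ j) ^ 2) (ε ^ 2)⁻¹ with h | h
  · rw [h]
    refine (eLpNorm_nonlocal_sub_le_low hε hψ hδ1 hψ2 hg hB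
      (isReproduced_dyadicBlock χ j f)).trans ?_
    have hr := isRescaled_lowKernel χ (j + 2)
    rw [lintegral_enorm_gaussianKernel_mul_sq hε, hr.lintegral_derivSize (by positivity),
      hr.lintegral_derivTwoSize (by positivity)]
    have e1 : ENNReal.ofReal (δ * (2 : ℝ) ^ j) =
        ENNReal.ofReal δ * ENNReal.ofReal ((2 : ℝ) ^ j) := ENNReal.ofReal_mul hδ0
    -- The reproducing kernel sits at scale j + 2, so one derivative costs 4·2^j and two cost
    -- 16·4^j. With the factor 4 in front of the second-order term this gives the 4 and 64 of
    -- `commutatorConst`.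
    have e2 : ENNReal.ofReal ((2 : ℝ) ^ (j + 2)) = 4 * ENNReal.ofReal ((2 : ℝ) ^ j) := by
      rw [zpow_add₀ two_ne_zero, mul_comm, ENNReal.ofReal_mul (by positivity)]
      norm_num
    have e3 : ENNReal.ofReal (((2 : ℝ) ^ (j + 2)) ^ 2) = 16 * ENNReal.ofReal ((2 : ℝ) ^ j) ^ 2 := by
      rw [ENNReal.ofReal_pow (by positivity), e2]; ring
    have e4 : ENNReal.ofReal (((2 : ℝ) ^ j) ^ 2) = ENNReal.ofReal ((2 : ℝ) ^ j) ^ 2 :=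
      ENNReal.ofReal_pow (by positivity) _
    have e5 : ENNReal.ofReal (ε ^ 2)⁻¹ * ENNReal.ofReal (ε ^ 2) = 1 := by
      rw [← ENNReal.ofReal_mul (by positivity), inv_mul_cancel₀ (by positivity), ENNReal.ofReal_one]
    rw [e1, e2, e3, e4]
    set r := ENNReal.ofReal ((2 : ℝ) ^ j)
    set D := ENNReal.ofReal δ
    set M := ∫⁻ y : Rd d, ‖gaussianKernel 1 y‖ₑ * ‖y‖ₑ ^ 2
    set K₁ := ∫⁻ z, derivSize (lowKernel χ 0) z
    set K₂ := ∫⁻ z, derivTwoSize (lowKernel χ 0) z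
    calc _ = (ENNReal.ofReal (ε ^ 2)⁻¹ * ENNReal.ofReal (ε ^ 2)) *
          (D * (2 ^ d * (M * (4 * K₁ + 64 * K₂))) * (r ^ 2 * G)) := by ring
      _ = D * (2 ^ d * (M * (4 * K₁ + 64 * K₂))) * (r ^ 2 * G) := by rw [e5, one_mul]
      _ ≤ _ := by
        gcongr
        exact le_self_add
  · rw [h]
    refine (eLpNorm_nonlocal_sub_le_high hε hψ hδ0 hδ1 hg hB).trans ?_
    calc _ = ENNReal.ofReal δ * (2 ^ d * (2 ^ (d + 1) * (∫⁻ x : Rd d, ‖gaussianKernel 1 x‖ₑ) +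
          ∫⁻ x : Rd d, ENNReal.ofReal (gaussianMoment x))) *
          (ENNReal.ofReal (ε ^ 2)⁻¹ * G) := by ring
      _ ≤ _ := by
        gcongr
        exact le_add_self

end

end Capillary

end

/-! ### Assembly of the theorem. -/

theorem mainTheorem2 (d : ℕ) (hd : 0 < d) (χ : Capillary.LPCutoff d) (σ : ℝ) :
    ∃ C : ℝ, 0 < C ∧
      ∀ (γ ε : ℝ), 0 < γ → 0 < ε →
      ∀ f : 𝓢'(Capillary.Rd d, ℂ), Capillary.MemHybrid χ γ ε (σ + 2) σ f →
      ∃ c : ℤ → ℝ, (∀ j, 0 < c j) ∧ HasSum c 1 ∧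
        ∀ (T : ℝ≥0∞) (v : ℝ → Fin d → 𝓢'(Capillary.Rd d, ℂ)),
        Capillary.IsVelocity χ (Capillary.timeInterval T) v →
        ∀ t ∈ Capillary.timeInterval T,
        Real.exp (2 * C * Capillary.lipIntegral v t) - 1 ≤ 1 / 2 →
        ∀ (j : ℤ) (ψ : ℝ → Capillary.Rd d → Capillary.Rd d),
        Capillary.IsFlow (Capillary.timeInterval T) (Capillary.lowFreqField χ (j - 1) v) ψ →
        eLpNorm (Capillary.commutator χ ε j (ψ t) f) 2 volume ≤
          ENNReal.ofReal
              (C * Real.exp (C * Capillary.lipIntegral v t) *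
                (Capillary.lipIntegral v t + Real.exp (2 * C * Capillary.lipIntegral v t) - 1) *
                c j * (2 : ℝ) ^ (-((j : ℝ) * σ))) *
            Capillary.besovNorm χ σ (Capillary.nonlocalDist ε f) := by
  obtain ⟨C₁, hC₁, hlow⟩ := Capillary.exists_eLpNorm_dyadicBlock_le χ
  set κ := Capillary.flowConst χ
  have hκ : 0 < κ := Capillary.flowConst_pos χ
  set A := (Capillary.commutatorConst χ).toReal with hA
  have hA0 : 0 ≤ A := ENNReal.toReal_nonneg
  -- The first term is what the chain of inequalities produces, its 2 coming from `exists_weights`.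
  -- The added κ makes smallness of CV imply smallness of κV.
  refine ⟨2 * (κ * A * C₁) + κ, by positivity, fun γ ε _ hε f hf => ?_⟩
  set C := 2 * (κ * A * C₁) + κ with hC
  -- The weights are built from L_ε f alone, before the velocity, the time and the flow are
  -- introduced.
  obtain ⟨c, hc0, hc1, hc⟩ := Capillary.exists_weights fun l : ℤ =>
    ENNReal.ofReal ((2 : ℝ) ^ ((l : ℝ) * σ)) *
      eLpNorm (Capillary.dyadicBlock χ l (Capillary.nonlocalDist ε f)) 2 volume
  refine ⟨c, hc0, hc1, fun T v hv t ht hsmall j ψ hψ => ?_⟩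
  set V := Capillary.lipIntegral v t
  have hV0 : 0 ≤ V := ENNReal.toReal_nonneg
  -- From 1 + 2CV ≤ e^{2CV} ≤ 3/2.
  have hCV : C * V ≤ 1 / 4 := by
    have := Real.add_one_le_exp (2 * C * V)
    linarith
  have hκV : κ * V ≤ 1 / 2 := by
    have : 0 ≤ κ * A * C₁ * V := by positivity
    rw [hC] at hCV
    nlinarith
  obtain ⟨hψ1, hψ2⟩ := hv.flow_bounds hd ht hψ hκV
  have h1 := Capillary.eLpNorm_commutator_le hε (by positivity) hκV hψ1 hψ2 (hf.eLpNorm_lt_top hε j)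
  set a := eLpNorm (Capillary.dyadicBlock χ j (Capillary.nonlocalDist ε f)) 2 volume
  set B := Capillary.besovNorm χ σ (Capillary.nonlocalDist ε f) with hB
  have h2 : a ≤ ENNReal.ofReal (2 * c j * (2 : ℝ) ^ (-((j : ℝ) * σ))) * B := by
    have e : ENNReal.ofReal ((2 : ℝ) ^ (-((j : ℝ) * σ))) *
        ENNReal.ofReal ((2 : ℝ) ^ ((j : ℝ) * σ)) = 1 := by
      rw [← ENNReal.ofReal_mul (by positivity), ← Real.rpow_add two_pos, neg_add_cancel,
        Real.rpow_zero, ENNReal.ofReal_one]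
    calc a = ENNReal.ofReal ((2 : ℝ) ^ (-((j : ℝ) * σ))) *
          (ENNReal.ofReal ((2 : ℝ) ^ ((j : ℝ) * σ)) * a) := by rw [← mul_assoc, e, one_mul]
      _ ≤ ENNReal.ofReal ((2 : ℝ) ^ (-((j : ℝ) * σ))) * (2 * ENNReal.ofReal (c j) * B) :=
          mul_le_mul_right (hc j) _
      _ = _ := by
          have := (hc0 j).le
          rw [ENNReal.ofReal_mul (by positivity), ENNReal.ofReal_mul two_pos.le,
            ENNReal.ofReal_ofNat]
          ring
  have h3 : ENNReal.ofReal (κ * V) * Capillary.commutatorConst χ * ENNReal.ofReal C₁ =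
      ENNReal.ofReal (κ * A * C₁ * V) := by
    rw [← ENNReal.ofReal_toReal (Capillary.commutatorConst_lt_top χ).ne, ← hA,
      ← ENNReal.ofReal_mul (by positivity), ← ENNReal.ofReal_mul (by positivity)]
    congr 1; ring
  -- Both exponentials are at least 1, so the right-hand side dominates CV.
  have h4 : 2 * (κ * A * C₁ * V) ≤
      C * Real.exp (C * V) * (V + Real.exp (2 * C * V) - 1) := by
    have hC0 : 0 ≤ C := by positivity
    have i1 : 1 ≤ Real.exp (C * V) := Real.one_le_exp (by positivity)
    have i2 : 1 ≤ Real.exp (2 * C * V) := Real.one_le_exp (by positivity)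
    calc 2 * (κ * A * C₁ * V) ≤ C * 1 * V := by rw [hC]; nlinarith
      _ ≤ _ := by gcongr; linarith
  calc _ ≤ _ := h1
    _ ≤ ENNReal.ofReal (κ * V) * Capillary.commutatorConst χ * (ENNReal.ofReal C₁ * a) :=
        mul_le_mul_right (hlow ε hε j f) _
    _ = ENNReal.ofReal (κ * A * C₁ * V) * a := by rw [← mul_assoc, h3]
    _ ≤ ENNReal.ofReal (κ * A * C₁ * V) *
          (ENNReal.ofReal (2 * c j * (2 : ℝ) ^ (-((j : ℝ) * σ))) * B) := mul_le_mul_right h2 _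
    _ = ENNReal.ofReal (2 * (κ * A * C₁ * V) * c j * (2 : ℝ) ^ (-((j : ℝ) * σ))) * B := by
        rw [← mul_assoc, ← ENNReal.ofReal_mul (by positivity)]
        congr 2; ring
    _ ≤ _ := by
        have := (hc0 j).le
        gcongr
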